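/- Everything is in the $C^\infty$ category. Let $M\subset\mathbb C^n$ be a real hypersurface, $p\in M$, with bundles $T=TM$, $H$ (the complex tangent bundle), $\mathbb CH=H^{10}\oplus H^{01}$, $H^{01}=\overline{H^{10}}$, $Q=T/H$, where $\mathbb CT,\mathbb CH,\mathbb CQ$ denote complexifications. A contact form is a smooth real $1$-form on $M$ (near $p$) vanishing on $H$; vector fields are smooth local sections near $p$. The Levi form $\tau^2_p:H^{10}_p\times H^{01}_p\to\mathbb CQ_p$ is the $\mathbb C$-bilinear map with $\langle\theta_p,\tau^2_p(L^2_p,L^1_p)\rangle=i\langle\theta,[L^2,L^1]\rangle_p$ for all contact forms $\theta$ and all $L^2\in H^{10}$, $L^1\in H^{01}$. Its rank is the Levi rank of $M$ at $p$; $K^{10}_p\subset H^{10}_p$ is its kernel, $K^{01}_p=\overline{K^{10}_p}$, $\mathbb CK_p=K^{10}_p\oplus K^{01}_p$. Let $\mathcal T_L=d\circ\iota_L+\iota_L\circ d$ be the Lie derivative on forms, with $d\theta(X,Y)=X\theta(Y)-Y\theta(X)-\theta([X,Y])$. (1) (Tensors.) The map $\tau^2_p$ exists and is unique. There are unique $\mathbb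 C$-trilinear maps $$\tau^3_p:\mathbb CT_p\times K^{10}_p\times K^{01}_p\to\mathbb CQ_p,\quad \tau^{21}_p:H^{10}_p\times H^{10}_p\times K^{01}_p\to\mathbb CQ_p,\quad \tau^{21}_p:\mathbb CH_p\times\mathbb CK_p\times\mathbb CK_p\to\mathbb CQ_p$$ such that for every contact form $\theta$: $\langle\theta_p,\tau^3_p(L^3_p,L^2_p,L^1_p)\rangle=i\,(L^3\langle\theta,[L^2,L^1]\rangle)_p$ for $L^3\in\mathbb CT$, $L^2\in H^{10}$, $L^1\in H^{01}$ with $L^2_p\in K^{10}_p$, $L^1_p\in K^{01}_p$; and $\langle\theta_p,\tau^{21}_p(L^3_p,L^2_p,v^1)\rangle=\langle\mathcal T_{L^3}\mathcal T_{L^2}\theta,v^1\rangle_p$ (Ebenfelt's tensor $\psi_3$) for $L^3,L^2\in H^{10}$, $v^1\in K^{01}_p$, respectively for $L^3,L^2\in\mathbb CH$ with $L^2_p\in\mathbb CK_p$ and $v^1\in\mathbb CK_p$. (2) (Normal form.) If $M$ has Levi rank $q$ at $p$, then $q\le n-1$ and there are local holomorphic coordinates $(w,z_2,z_3)\in\mathbb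 C\times\mathbb C^q\times\mathbb C^{n-q-1}$ vanishing at $p$ in which $M$ is given near $p$ by $w+\bar w=\varphi(z,\bar z,i(w-\bar w))$ with $\varphi=\varphi(z,\bar z,u)$ smooth and real and $\varphi=\varphi^2+\varphi^3+O(4)$, where $O(4)$ denotes terms of total order at least $4$ in $(z,\bar z,u)$, $$\varphi^2=\sum_j\pm|z_{2j}|^2,\qquad \varphi^3=2\,\mathrm{Re}\,\varphi^{21}(z,\bar z_3)+\sum_j\varepsilon_j|z_{3j}|^2u,\quad \varepsilon_j\in\{-1,0,1\},$$ $$\varphi^{21}=\sum a_{jkl}z_{2j}z_{2k}\bar z_{3l}+\sum b_{jkl}z_{2j}z_{3k}\bar z_{3l}+\sum c_{jkl}z_{3j}z_{3k}\bar z_{3l},\qquad a_{jkl},b_{jkl},c_{jkl}\in\mathbb C.$$ (3) (Agreement.) $\tau^{21}_p(v^3,v^2,v^1)=i\,\tau^3_p(v^3,v^2,v^1)$ for all $v^2\in K^{10}_p$, $v^1\in K^{01}_p$ and all $v^3\in\mathbb CH_p$ (for the first version of $\tau^{21}_p$: all $v^3\in H^{10}_p$). (4) (All cubic terms come from the tensors.)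 In any coordinates as in (2), with $\theta=i\partial\rho$, $\rho=-2\mathrm{Re}\,w+\varphi$, and with $\varphi^3$ regarded as the function $\varphi^3(z,\bar z,i(w-\bar w))$ of $(w,z)$, $$\langle\theta_0,\tau^3_0(v^3,v^2,v^1)\rangle=-\partial_{v^3}\partial_{v^2}\partial_{v^1}\varphi^3\quad(v^3\in\mathbb CT_0,\ v^2\in K^{10}_0,\ v^1\in K^{01}_0),$$ $$\langle\theta_0,\tau^{21}_0(v^3,v^2,v^1)\rangle=-i\,\partial_{v^3}\partial_{v^2}\partial_{v^1}\varphi^3\quad(v^3,v^2\in H^{10}_0,\ v^1\in K^{01}_0).$$ (5) (Complete set of third order invariants.) Let $M'\subset\mathbb C^n$ be another real hypersurface, $p'\in M'$, and $A$ a $\mathbb C$-linear automorphism of $\mathbb C^n$. There is a local biholomorphism $F$ with $F(p)=p'$, $dF_p=A$ that maps $M$ to $M'$ up to order $4$ (that is, $\rho'\circ F-\rho=O(|x-p|^4)$ for some local defining functions $\rho$ of $M$ at $p$ and $\rho'$ of $M'$ at $p'$) if and only if $A$ maps $T_pM$ onto $T_{p'}M'$ and carries $\tau^2_p$, $\tau^3_p$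 and $\tau^{21}_p$ (on $H^{10}_p\times H^{10}_p\times K^{01}_p$) to the corresponding tensors of $M'$ at $p'$. In that case it also carries $\tau^{21}_p$ on $\mathbb CH_p\times\mathbb CK_p\times\mathbb CK_p$ to that of $M'$ at $p'$. -/

import Mathlib

open scoped ContDiff Topology

noncomputable section

namespace CRCubic

/-! ### Complexified tangent vectors, vector fields and one-forms on `ℂⁿ` -/

/-- The standard space `ℂⁿ`. -/
abbrev Cn (n : ℕ) := Fin n → ℂ

/-- The complexified real tangent space of `ℂⁿ` at a point: the pair `(a, b)` stands for the
complex tangent vector `∑ aⱼ ∂/∂zⱼ + ∑ bⱼ ∂/∂z̄ⱼ`. A real tangent vector `X ∈ ℂⁿ` is the pair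
`(X, X̄)`. -/
abbrev CVec (n : ℕ) := Cn n × Cn n

/-- Complex conjugation of complex tangent vectors. -/
def conjVec (n : ℕ) : CVec n →ₛₗ[starRingEnd ℂ] CVec n where
  toFun v := (star v.2, star v.1)
  map_add' v w := by ext <;> simp
  map_smul' c v := by ext <;> simp

/-- A smooth (`C^∞`) map near `p`. -/
def SmoothNear {E F : Type*} [NormedAddCommGroup E] [NormedSpace ℝ E]
    [NormedAddCommGroup F] [NormedSpace ℝ F] (f : E → F) (p : E) : Prop :=
  ∃ U : Set E, IsOpen U ∧ p ∈ U ∧ ContDiffOn ℝ ∞ f U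

section ComplexExtension

variable {n : ℕ} {F : Type*} [NormedAddCommGroup F] [NormedSpace ℝ F] [NormedSpace ℂ F]
  [IsScalarTower ℝ ℂ F]

/-- The complex linear extension of a real linear map `A : ℂⁿ → F` to complex tangent vectors:
if `A = df`, its value at `(a, b)` is `∑ aⱼ ∂f/∂zⱼ + ∑ bⱼ ∂f/∂z̄ⱼ`; on a real vector
`(X, X̄)` its value is `A X`. -/
def cExt (A : Cn n →L[ℝ] F) : CVec n →ₗ[ℂ] F where
  toFun v := (1 / 2 : ℂ) • (A v.1 - Complex.I • A (Complex.I • v.1)) +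
    (1 / 2 : ℂ) • (A (star v.2) + Complex.I • A (Complex.I • star v.2))
  map_add' v w := by
    simp only [Prod.fst_add, Prod.snd_add, star_add, smul_add, map_add]
    module
  map_smul' c v := by
    have key : ∀ (d : ℂ) (x : Cn n),
        A (d • x) = (d.re : ℂ) • A x + (d.im : ℂ) • A (Complex.I • x) := by
      intro d x
      have h : d • x = d.re • x + d.im • (Complex.I • x) := by
        ext i
        simp only [Pi.add_apply, Pi.smul_apply, smul_eq_mul, Complex.real_smul]
        conv_lhs => rw [← Complex.re_add_im d]
        ring
      rw [h, map_add, map_smul, map_smul]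
      congr 1
      · exact (algebraMap_smul ℂ d.re (A x)).symm
      · exact (algebraMap_smul ℂ d.im (A (Complex.I • x))).symm
    have hI : ∀ x : Cn n, A (Complex.I • (Complex.I • x)) = -A x := by
      intro x
      rw [smul_smul, Complex.I_mul_I, neg_one_smul, map_neg]
    simp only [Prod.smul_fst, Prod.smul_snd, star_smul, RingHom.id_apply]
    rw [smul_comm Complex.I c v.1, smul_comm Complex.I (star c) (star v.2)]
    rw [key c v.1, key c (Complex.I • v.1), key (star c) (star v.2),
      key (star c) (Complex.I • star v.2), hI, hI]
    have hc : c = (c.re : ℂ) + (c.im : ℂ) * Complex.I := (Complex.re_add_im c).symm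
    have h1 : (star c).re = c.re := rfl
    have h2 : (star c).im = -c.im := rfl
    rw [h1, h2]
    generalize (c.re : ℝ) = x at hc ⊢
    generalize (c.im : ℝ) = y at hc ⊢
    subst hc
    have hII : Complex.I * Complex.I = -1 := Complex.I_mul_I
    push_cast
    match_scalars <;> ring_nf <;> simp <;> ring

/-- The derivative `ξ f` of a function `f` along a complex vector field `ξ`. -/
def der (ξ : Cn n → CVec n) (f : Cn n → F) : Cn n → F :=
  fun x => cExt (fderiv ℝ f x) (ξ x)

end ComplexExtension

variable {n : ℕ}

/-- The Lie bracket `[ξ, η]` of complex vector fields. -/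
def bracket (ξ η : Cn n → CVec n) : Cn n → CVec n :=
  fun x => der ξ η x - der η ξ x

/-- The `ℂ`-bilinear pairing `⟨θ, ξ⟩` of a complex one-form with a complex vector field. -/
def pairing (θ : Cn n → Cn n →L[ℝ] ℂ) (ξ : Cn n → CVec n) : Cn n → ℂ :=
  fun x => cExt (θ x) (ξ x)

/-- The exterior derivative of a one-form: `dθ(X, Y) = X(θ(Y)) - Y(θ(X))` for constant `X, Y`. -/
def extD (θ : Cn n → Cn n →L[ℝ] ℂ) : Cn n → Cn n →L[ℝ] Cn n →L[ℝ] ℂ :=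
  fun x => fderiv ℝ θ x - (fderiv ℝ θ x).flip

/-- The Lie derivative `d ∘ ι_ξ + ι_ξ ∘ d` of a one-form along a complex vector field `ξ`. -/
def lieD (ξ : Cn n → CVec n) (θ : Cn n → Cn n →L[ℝ] ℂ) : Cn n → Cn n →L[ℝ] ℂ :=
  fun x => fderiv ℝ (pairing θ ξ) x + cExt (extD θ x) (ξ x)

/-! ### Real hypersurfaces and their bundles -/

/-- `ρ` is a smooth local defining function of `M` near `p`. -/
def IsDefiningFunction (M : Set (Cn n)) (p : Cn n) (ρ : Cn n → ℝ) : Prop :=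
  ∃ U : Set (Cn n), IsOpen U ∧ p ∈ U ∧ ContDiffOn ℝ ∞ ρ U ∧
    (∀ x ∈ U, fderiv ℝ ρ x ≠ 0) ∧ ∀ x ∈ U, x ∈ M ↔ ρ x = 0

/-- `M` is a smooth real hypersurface of `ℂⁿ`. -/
def IsRealHypersurface (M : Set (Cn n)) : Prop :=
  ∀ p ∈ M, ∃ ρ, IsDefiningFunction M p ρ

/-- The complexified tangent space `ℂT_p` of `M` (the kernel of `dρ` at `p` for one, equivalently
for every, defining function `ρ`). -/
def cT (M : Set (Cn n)) (p : Cn n) : Submodule ℂ (CVec n) :=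
  ⨅ (ρ : Cn n → ℝ) (_ : IsDefiningFunction M p ρ),
    LinearMap.ker (cExt (Complex.ofRealCLM.comp (fderiv ℝ ρ p)))

/-- The space `H¹⁰_p` of `(1,0)` tangent vectors of `M`. -/
def H10 (M : Set (Cn n)) (p : Cn n) : Submodule ℂ (CVec n) :=
  cT M p ⊓ LinearMap.ker (LinearMap.snd ℂ (Cn n) (Cn n))

/-- The space `H⁰¹_p`, the conjugate of `H¹⁰_p`. -/
def H01 (M : Set (Cn n)) (p : Cn n) : Submodule ℂ (CVec n) :=
  (H10 M p).comap (conjVec n)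

/-- The complexified holomorphic tangent space `ℂH_p = H¹⁰_p ⊕ H⁰¹_p`. -/
def cH (M : Set (Cn n)) (p : Cn n) : Submodule ℂ (CVec n) :=
  H10 M p ⊔ H01 M p

/-- The complexified normal space `ℂQ_p = ℂT_p / ℂH_p`. -/
abbrev cQ (M : Set (Cn n)) (p : Cn n) :=
  ↥(cT M p) ⧸ (cH M p).submoduleOf (cT M p)

/-- The class in `ℂQ_p` of a vector of `ℂT_p`. -/
def toQ (M : Set (Cn n)) (p : Cn n) : ↥(cT M p) →ₗ[ℂ] cQ M p :=
  ((cH M p).submoduleOf (cT M p)).mkQ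

/-- `ξ` is (a smooth extension to a neighbourhood of `p` in `ℂⁿ` of) a smooth local section near
`p` of the bundle over `M` with fibres `V x`. -/
def IsSection (M : Set (Cn n)) (p : Cn n) (V : Cn n → Submodule ℂ (CVec n))
    (ξ : Cn n → CVec n) : Prop :=
  ∃ U : Set (Cn n), IsOpen U ∧ p ∈ U ∧ ContDiffOn ℝ ∞ ξ U ∧ ∀ x ∈ U ∩ M, ξ x ∈ V x

/-- `θ` is (a smooth extension to a neighbourhood of `p` in `ℂⁿ` of) a contact form on `M` near
`p`: a smooth one-form vanishing on `H` and real on `T`. -/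
def IsContactForm (M : Set (Cn n)) (p : Cn n) (θ : Cn n → Cn n →L[ℝ] ℂ) : Prop :=
  ∃ U : Set (Cn n), IsOpen U ∧ p ∈ U ∧ ContDiffOn ℝ ∞ θ U ∧
    ∀ x ∈ U ∩ M, (∀ v ∈ cH M x, cExt (θ x) v = 0) ∧
      ∀ X : Cn n, ((X, star X) : CVec n) ∈ cT M x → (θ x X).im = 0

/-- `⟨θ_p, t⟩ = c` for the class `t ∈ ℂQ_p`, where `θ` is a contact form. -/
def PairsTo (M : Set (Cn n)) (p : Cn n) (θ : Cn n → Cn n →L[ℝ] ℂ) (t : cQ M p) (c : ℂ) : Prop :=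
  ∀ u : cT M p, toQ M p u = t → cExt (θ p) (u : CVec n) = c

/-! ### The Levi form -/

/-- The defining property of the Levi form:
`⟨θ_p, τ²(L²_p, L¹_p)⟩ = i ⟨θ, [L², L¹]⟩_p` for `L² ∈ H¹⁰`, `L¹ ∈ H⁰¹`. -/
def IsLeviForm (M : Set (Cn n)) (p : Cn n) (τ : H10 M p →ₗ[ℂ] H01 M p →ₗ[ℂ] cQ M p) : Prop :=
  ∀ (θ : Cn n → Cn n →L[ℝ] ℂ) (L2 L1 : Cn n → CVec n),
    IsContactForm M p θ → IsSection M p (H10 M) L2 → IsSection M p (H01 M) L1 →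
    ∀ (v2 : H10 M p) (v1 : H01 M p), L2 p = v2 → L1 p = v1 →
      PairsTo M p θ (τ v2 v1) (Complex.I * pairing θ (bracket L2 L1) p)

open Classical in
/-- The Levi form `τ²_p : H¹⁰_p × H⁰¹_p → ℂQ_p`. -/
def leviForm (M : Set (Cn n)) (p : Cn n) : H10 M p →ₗ[ℂ] H01 M p →ₗ[ℂ] cQ M p :=
  if h : ∃ τ, IsLeviForm M p τ then h.choose else 0

/-- The rank of the Levi form at `p`. -/
def leviRank (M : Set (Cn n)) (p : Cn n) : ℕ :=
  Module.finrank ℂ (LinearMap.range (leviForm M p))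

/-- The Levi kernel `K¹⁰_p`. -/
def K10 (M : Set (Cn n)) (p : Cn n) : Submodule ℂ (CVec n) :=
  (LinearMap.ker (leviForm M p)).map (H10 M p).subtype

/-- The conjugate Levi kernel `K⁰¹_p`. -/
def K01 (M : Set (Cn n)) (p : Cn n) : Submodule ℂ (CVec n) :=
  (K10 M p).comap (conjVec n)

/-- The complexified Levi kernel `ℂK_p = K¹⁰_p ⊕ K⁰¹_p`. -/
def cK (M : Set (Cn n)) (p : Cn n) : Submodule ℂ (CVec n) :=
  K10 M p ⊔ K01 M p

/-! ### The cubic tensors -/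

/-- The defining property of the tensor `τ³_p`:
`⟨θ_p, τ³(L³_p, L²_p, L¹_p)⟩ = i (L³⟨θ, [L², L¹]⟩)_p` for contact forms `θ` and local sections
`L³ ∈ ℂT`, `L² ∈ H¹⁰`, `L¹ ∈ H⁰¹` with `L²_p ∈ K¹⁰_p`, `L¹_p ∈ K⁰¹_p`. -/
def IsTau3 (M : Set (Cn n)) (p : Cn n)
    (τ : cT M p →ₗ[ℂ] K10 M p →ₗ[ℂ] K01 M p →ₗ[ℂ] cQ M p) : Prop :=
  ∀ (θ : Cn n → Cn n →L[ℝ] ℂ) (L3 L2 L1 : Cn n → CVec n),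
    IsContactForm M p θ → IsSection M p (cT M) L3 → IsSection M p (H10 M) L2 →
    IsSection M p (H01 M) L1 →
    ∀ (v3 : cT M p) (v2 : K10 M p) (v1 : K01 M p), L3 p = v3 → L2 p = v2 → L1 p = v1 →
      PairsTo M p θ (τ v3 v2 v1) (Complex.I * der L3 (pairing θ (bracket L2 L1)) p)

/-- The defining property of Ebenfelt's tensor `ψ₃ = τ²¹_p` on `H¹⁰_p × H¹⁰_p × K⁰¹_p`:
`⟨θ_p, τ²¹(L³_p, L²_p, v¹)⟩ = ⟨𝒯_{L³} 𝒯_{L²} θ, v¹⟩_p`, where `𝒯` is the Lie derivative. -/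
def IsTau21 (M : Set (Cn n)) (p : Cn n)
    (τ : H10 M p →ₗ[ℂ] H10 M p →ₗ[ℂ] K01 M p →ₗ[ℂ] cQ M p) : Prop :=
  ∀ (θ : Cn n → Cn n →L[ℝ] ℂ) (L3 L2 : Cn n → CVec n),
    IsContactForm M p θ → IsSection M p (H10 M) L3 → IsSection M p (H10 M) L2 →
    ∀ (v3 v2 : H10 M p) (v1 : K01 M p), L3 p = v3 → L2 p = v2 →
      PairsTo M p θ (τ v3 v2 v1) (cExt (lieD L3 (lieD L2 θ) p) (v1 : CVec n))

/-- The defining property of Ebenfelt's tensor on `ℂH_p × ℂK_p × ℂK_p` (same formula, with local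
sections `L³, L² ∈ ℂH` such that `L²_p ∈ ℂK_p`). -/
def IsTau21Ext (M : Set (Cn n)) (p : Cn n)
    (τ : cH M p →ₗ[ℂ] cK M p →ₗ[ℂ] cK M p →ₗ[ℂ] cQ M p) : Prop :=
  ∀ (θ : Cn n → Cn n →L[ℝ] ℂ) (L3 L2 : Cn n → CVec n),
    IsContactForm M p θ → IsSection M p (cH M) L3 → IsSection M p (cH M) L2 →
    ∀ (v3 : cH M p) (v2 v1 : cK M p), L3 p = v3 → L2 p = v2 →
      PairsTo M p θ (τ v3 v2 v1) (cExt (lieD L3 (lieD L2 θ) p) (v1 : CVec n))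

open Classical in
/-- The tensor `τ³_p`. -/
def tau3 (M : Set (Cn n)) (p : Cn n) : cT M p →ₗ[ℂ] K10 M p →ₗ[ℂ] K01 M p →ₗ[ℂ] cQ M p :=
  if h : ∃ τ, IsTau3 M p τ then h.choose else 0

open Classical in
/-- Ebenfelt's tensor `τ²¹_p` on `H¹⁰_p × H¹⁰_p × K⁰¹_p`. -/
def tau21 (M : Set (Cn n)) (p : Cn n) : H10 M p →ₗ[ℂ] H10 M p →ₗ[ℂ] K01 M p →ₗ[ℂ] cQ M p :=
  if h : ∃ τ, IsTau21 M p τ then h.choose else 0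

open Classical in
/-- Ebenfelt's tensor `τ²¹_p` on `ℂH_p × ℂK_p × ℂK_p`. -/
def tau21Ext (M : Set (Cn n)) (p : Cn n) : cH M p →ₗ[ℂ] cK M p →ₗ[ℂ] cK M p →ₗ[ℂ] cQ M p :=
  if h : ∃ τ, IsTau21Ext M p τ then h.choose else 0

/-! The graphs of the tensors: the arguments `v` lie in the respective domains and `u ∈ ℂT_p`
represents the value of the tensor in `ℂQ_p`. -/

/-- `v² ∈ H¹⁰_p`, `v¹ ∈ H⁰¹_p` and `τ²_p(v², v¹) = u mod ℂH_p`. -/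
def LeviGraph (M : Set (Cn n)) (p : Cn n) (v2 v1 u : CVec n) : Prop :=
  ∃ (h2 : v2 ∈ H10 M p) (h1 : v1 ∈ H01 M p) (h : u ∈ cT M p),
    leviForm M p ⟨v2, h2⟩ ⟨v1, h1⟩ = toQ M p ⟨u, h⟩

/-- `v³ ∈ ℂT_p`, `v² ∈ K¹⁰_p`, `v¹ ∈ K⁰¹_p` and `τ³_p(v³, v², v¹) = u mod ℂH_p`. -/
def Tau3Graph (M : Set (Cn n)) (p : Cn n) (v3 v2 v1 u : CVec n) : Prop :=
  ∃ (h3 : v3 ∈ cT M p) (h2 : v2 ∈ K10 M p) (h1 : v1 ∈ K01 M p) (h : u ∈ cT M p),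
    tau3 M p ⟨v3, h3⟩ ⟨v2, h2⟩ ⟨v1, h1⟩ = toQ M p ⟨u, h⟩

/-- `v³, v² ∈ H¹⁰_p`, `v¹ ∈ K⁰¹_p` and `τ²¹_p(v³, v², v¹) = u mod ℂH_p`. -/
def Tau21Graph (M : Set (Cn n)) (p : Cn n) (v3 v2 v1 u : CVec n) : Prop :=
  ∃ (h3 : v3 ∈ H10 M p) (h2 : v2 ∈ H10 M p) (h1 : v1 ∈ K01 M p) (h : u ∈ cT M p),
    tau21 M p ⟨v3, h3⟩ ⟨v2, h2⟩ ⟨v1, h1⟩ = toQ M p ⟨u, h⟩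

/-- `v³ ∈ ℂH_p`, `v², v¹ ∈ ℂK_p` and `τ²¹_p(v³, v², v¹) = u mod ℂH_p`. -/
def Tau21ExtGraph (M : Set (Cn n)) (p : Cn n) (v3 v2 v1 u : CVec n) : Prop :=
  ∃ (h3 : v3 ∈ cH M p) (h2 : v2 ∈ cK M p) (h1 : v1 ∈ cK M p) (h : u ∈ cT M p),
    tau21Ext M p ⟨v3, h3⟩ ⟨v2, h2⟩ ⟨v1, h1⟩ = toQ M p ⟨u, h⟩

/-! ### The cubic normal form -/

/-- The coefficients of a cubic normal form in the coordinates
`(w, z₂, z₃) ∈ ℂ × ℂ^q × ℂ^r`. -/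
structure CubicData (q r : ℕ) where
  /-- the signs of the Levi form -/
  sgn : Fin q → ℝ
  sgn_mem : ∀ j, sgn j = 1 ∨ sgn j = -1
  /-- coefficients of `z₂ z₂ z̄₃` -/
  a : Fin q → Fin q → Fin r → ℂ
  /-- coefficients of `z₂ z₃ z̄₃` -/
  b : Fin q → Fin r → Fin r → ℂ
  /-- coefficients of `z₃ z₃ z̄₃` -/
  c : Fin r → Fin r → Fin r → ℂ
  /-- coefficients of `|z₃ⱼ|² u` -/
  eps : Fin r → ℝ
  eps_mem : ∀ j, eps j = -1 ∨ eps j = 0 ∨ eps j = 1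

namespace CubicData

variable {q r : ℕ} (D : CubicData q r)

/-- `φ² = ∑ ± |z₂ⱼ|²`. -/
def phi2 (z2 : Fin q → ℂ) : ℝ := ∑ j, D.sgn j * ‖z2 j‖ ^ 2

/-- The polynomial `φ²¹(z, z̄₃)`. -/
def phi21 (z2 : Fin q → ℂ) (z3 : Fin r → ℂ) : ℂ :=
  (∑ j, ∑ k, ∑ l, D.a j k l * z2 j * z2 k * star (z3 l)) +
  (∑ j, ∑ k, ∑ l, D.b j k l * z2 j * z3 k * star (z3 l)) +
  (∑ j, ∑ k, ∑ l, D.c j k l * z3 j * z3 k * star (z3 l))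

/-- `φ¹¹¹ = ∑ εⱼ |z₃ⱼ|² u`. -/
def phi111 (z3 : Fin r → ℂ) (u : ℝ) : ℝ := ∑ j, D.eps j * ‖z3 j‖ ^ 2 * u

/-- `φ³ = 2 Re φ²¹ + φ¹¹¹`. -/
def phi3 (z2 : Fin q → ℂ) (z3 : Fin r → ℂ) (u : ℝ) : ℝ :=
  2 * (D.phi21 z2 z3).re + D.phi111 z3 u

end CubicData

/-- `Φ = (w, z₂, z₃)` are local holomorphic coordinates vanishing at `p` in which `M` is given by
`w + w̄ = φ(z, z̄, i(w - w̄))` with `φ` smooth and `φ = φ² + φ³ + O(4)`, the terms `φ²` and `φ³`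
being given by the normal form data `D`. Note `w + w̄ = 2 Re w` and `i(w - w̄) = -2 Im w`. -/
structure IsCubicNormalForm {q r : ℕ} (M : Set (Cn n)) (p : Cn n)
    (Φ : Cn n → ℂ × (Fin q → ℂ) × (Fin r → ℂ)) (φ : (Fin q → ℂ) × (Fin r → ℂ) × ℝ → ℝ)
    (D : CubicData q r) : Prop where
  analytic : AnalyticAt ℂ Φ p
  bijective : Function.Bijective (fderiv ℂ Φ p)
  map_zero : Φ p = 0
  smooth : SmoothNear φ 0
  graph : ∀ᶠ x in 𝓝 p,
    x ∈ M ↔ 2 * (Φ x).1.re = φ ((Φ x).2.1, (Φ x).2.2, -2 * (Φ x).1.im)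
  expansion : (fun y : (Fin q → ℂ) × (Fin r → ℂ) × ℝ =>
      φ y - (D.phi2 y.1 + D.phi3 y.1 y.2.1 y.2.2)) =O[𝓝 0] fun y => ‖y‖ ^ 4

/-- The cubic term `φ³(z, z̄, i(w - w̄))` as a function on the tangent space of `ℂⁿ` at `p`
(identified with the `(w, z)`-space by the linear part of the coordinates `Φ`). -/
def cubicTerm {q r : ℕ} (p : Cn n) (Φ : Cn n → ℂ × (Fin q → ℂ) × (Fin r → ℂ))
    (D : CubicData q r) : Cn n → ℂ :=
  fun x => ((D.phi3 (fderiv ℂ Φ p x).2.1 (fderiv ℂ Φ p x).2.2 (-2 * (fderiv ℂ Φ p x).1.im) : ℝ) : ℂ)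

/-- The third derivative `∂_{v³} ∂_{v²} ∂_{v¹} P` at the origin along constant complex vector
fields. -/
def thirdDer (P : Cn n → ℂ) (v3 v2 v1 : CVec n) : ℂ :=
  der (fun _ => v3) (der (fun _ => v2) (der (fun _ => v1) P)) 0

/-- The value `⟨θ₀, u⟩` of the contact form `θ = i∂ρ`, `ρ = -2 Re w + φ`, of the normal form at
the reference point; there `θ₀ = -i dw`. -/
def normalContact {q r : ℕ} (p : Cn n) (Φ : Cn n → ℂ × (Fin q → ℂ) × (Fin r → ℂ))
    (u : CVec n) : ℂ :=
  -Complex.I * (fderiv ℂ Φ p u.1).1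

/-! ### Third order equivalence -/

/-- The action of a complex linear map of `ℂⁿ` on complex tangent vectors. -/
def push (A : Cn n →L[ℂ] Cn n) (v : CVec n) : CVec n := (A v.1, star (A (star v.2)))

/-- There is a local biholomorphism `F` with `F(p) = p'` and differential `A` at `p` that maps
`(M, p)` to `(M', p')` up to terms of order at least four: for suitable defining functions `ρ` of
`M` near `p` and `ρ'` of `M'` near `p'` one has `ρ' ∘ F = ρ + O(4)` at `p`. -/
def ThirdOrderEquivVia (M : Set (Cn n)) (p : Cn n) (M' : Set (Cn n)) (p' : Cn n)
    (A : Cn n ≃L[ℂ] Cn n) : Prop :=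
  ∃ F : Cn n → Cn n, AnalyticAt ℂ F p ∧ F p = p' ∧ HasFDerivAt F (A : Cn n →L[ℂ] Cn n) p ∧
    ∃ ρ ρ' : Cn n → ℝ, IsDefiningFunction M p ρ ∧ IsDefiningFunction M' p' ρ' ∧
      (fun x => ρ' (F x) - ρ x) =O[𝓝 p] fun x => ‖x - p‖ ^ 4

end CRCubic

end

open CRCubic

/-!
Everything is computed with the complex differential `cd f`, the complex linear extension of the
differential of `f` to complex tangent vectors. For a defining function `ρ` the form `i ∂ρ` is a
contact form, it identifies `ℂQ_p` with `ℂ` (`thetaQ`), and every contact form is a multiple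
`f · i ∂ρ` along `M` (`IsContactForm.exists_factor`). Differentiating the equations that hold along
`M` for sections of `ℂH` shows that brackets and Lie derivatives of contact forms are expressed
through the two-form `∂∂̄ρ` (`IsSection.cd_bracket`, `cExt_lieD_lieD_contact`). In particular the
Levi form is minus the complex Hessian of `ρ` (`isLeviForm_iff`).

For the cubic tensors, suppose that `ρ` agrees up to terms of order four with `R ∘ Ψ`, where `Ψ` is
a system of holomorphic coordinates tangent to the identity and the complex Hessian of `R` at the
origin annihilates the Levi kernel in all directions, not only in those of `ℂH` (`HasModel`). Then
the derivatives of the vector fields and the second derivatives of `Ψ` drop out of the defining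
expressions of the tensors, or cancel against a bracket, and only the third derivative of `R`
remains: `i ∂ρ` pairs with `τ³` to minus this derivative, and with `τ²¹` to `-i` times it
(`HasModel.isTau3_iff`, `HasModel.isTau21_iff`, `HasModel.isTau21Ext_iff`). Existence and
uniqueness of the tensors, and their agreement up to the factor `i`, are read off.

Models exist by a normalisation of Taylor polynomials (`exists_model_of_jet`). Choose linear
coordinates `(w, z₂, z₃)` with `dρ = -2 Re w` and Levi form `∑ ± |z₂ⱼ|²` (`exists_adapted`). A
quadratic or cubic monomial is the real part of a holomorphic one, which is absorbed into `w`, or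
has a conjugated factor. A factor `w̄ = 2 Re w - w` is removed by multiplying `ρ` by a function and
by a holomorphic term; a factor `z̄₂` in a cubic monomial is removed by a change of `z₂`, since
`∑ ± |z₂ⱼ|²` is nondegenerate. What remains are the terms of `φ²¹` and a Hermitian form in `z₃`
times `u` (`isNormal2_quadratic`, `isNormal3_cubic`). The complex Hessian of such a polynomial
involves `z₂` alone, so it is a model in the above sense (`IsNormalised.hasModel`). The Hermitian
form is a value of `τ³`, hence it is diagonal if the coordinates `z₃` are chosen accordingly, and the
graph function `φ` is obtained from the inverse function theorem (`exists_isCubicNormalForm`).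
Conversely the polynomial of any cubic normal form is a model of `-2 Re w + φ`, which gives the
formulas for its cubic term (`IsCubicNormalForm.cubic_eq`).

A third order equivalence `F` pulls normalising coordinates back to normalising coordinates with the
same model, so it transports all tensors (`transport_of_equiv`). If, conversely, `A` preserves the
tensors, both hypersurfaces are normalised in linear coordinates that correspond under `A`; the
polynomials `φ²¹` and the Hermitian forms are values of `τ²¹` and `τ³`, so the models are equal, and
`Φ'⁻¹ ∘ Φ` is the required biholomorphism (`equiv_of_tensors`).
-/

noncomputable section

namespace CRCubic

/-! ### The complex differential and smooth germs -/

section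

variable {n : ℕ}

section ComplexDerivative

variable {F G : Type*} [NormedAddCommGroup F] [NormedSpace ℝ F] [NormedSpace ℂ F]
  [IsScalarTower ℝ ℂ F] [NormedAddCommGroup G] [NormedSpace ℝ G] [NormedSpace ℂ G]
  [IsScalarTower ℝ ℂ G]

theorem norm_star_cn (x : Cn n) : ‖star x‖ = ‖x‖ := by
  simp [Pi.norm_def]

theorem norm_cExt_le (A : Cn n →L[ℝ] F) (v : CVec n) : ‖cExt A v‖ ≤ 2 * ‖A‖ * ‖v‖ := by
  have h1 : ‖v.1‖ ≤ ‖v‖ := norm_fst_le v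
  have h2 : ‖v.2‖ ≤ ‖v‖ := norm_snd_le v
  have key : ∀ x : Cn n, ‖x‖ ≤ ‖v‖ → ‖A x‖ ≤ ‖A‖ * ‖v‖ := fun x hx =>
    (A.le_opNorm x).trans (by gcongr)
  have hI : ∀ x : Cn n, ‖Complex.I • x‖ = ‖x‖ := fun x => by rw [norm_smul]; simp
  have hs : ‖star v.2‖ ≤ ‖v‖ := by rw [norm_star_cn]; exact h2
  have a1 := key v.1 h1
  have a2 := key (Complex.I • v.1) (by rw [hI]; exact h1)
  have a3 := key (star v.2) hs
  have a4 := key (Complex.I • star v.2) (by rw [hI]; exact hs)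
  show ‖(1 / 2 : ℂ) • (A v.1 - Complex.I • A (Complex.I • v.1)) +
    (1 / 2 : ℂ) • (A (star v.2) + Complex.I • A (Complex.I • star v.2))‖ ≤ _
  refine (norm_add_le _ _).trans ?_
  rw [norm_smul, norm_smul]
  have b1 := norm_sub_le (A v.1) (Complex.I • A (Complex.I • v.1))
  have b2 := norm_add_le (A (star v.2)) (Complex.I • A (Complex.I • star v.2))
  rw [norm_smul] at b1 b2
  simp only [Complex.norm_I, one_mul] at b1 b2
  have h12 : ‖(1 / 2 : ℂ)‖ = 1 / 2 := by norm_num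
  rw [h12]
  linarith

/-- The complex linear extension `cExt` as a continuous bilinear operation. -/
def cExtL : (Cn n →L[ℝ] F) →L[ℂ] CVec n →L[ℂ] F :=
  LinearMap.mkContinuous₂
    { toFun := fun A => cExt A
      map_add' := fun A B => by
        ext v <;> simp [cExt] <;> module
      map_smul' := fun c A => by
        ext v <;> simp [cExt, smul_comm Complex.I c] <;> module } 2
    (fun A v => norm_cExt_le A v)

@[simp]
theorem cExtL_apply (A : Cn n →L[ℝ] F) (v : CVec n) : cExtL A v = cExt A v := rfl

theorem cExt_add_left (A B : Cn n →L[ℝ] F) (v : CVec n) :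
    cExt (A + B) v = cExt A v + cExt B v := by
  simp only [← cExtL_apply, map_add]; rfl

theorem cExt_sub_left (A B : Cn n →L[ℝ] F) (v : CVec n) :
    cExt (A - B) v = cExt A v - cExt B v := by
  simp only [← cExtL_apply, map_sub]; rfl

theorem cExt_comp (L : F →L[ℂ] G) (A : Cn n →L[ℝ] F) (v : CVec n) :
    cExt ((L.restrictScalars ℝ).comp A) v = L (cExt A v) := by
  simp [cExt]

/-- The value on a real vector. -/
theorem cExt_real (A : Cn n →L[ℝ] F) (X : Cn n) : cExt A (X, star X) = A X := by
  simp only [cExt, LinearMap.coe_mk, AddHom.coe_mk, star_star]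
  module

/-- The complex differential of a function `f`: its value at a complex vector `(a, b)` is
`∑ aⱼ ∂f/∂zⱼ + ∑ bⱼ ∂f/∂z̄ⱼ`. Since it is again a function with values in a complex normed space,
it can be iterated: `cd (cd f)` and `cd (cd (cd f))` are the second and third derivatives. -/
def cd (f : Cn n → F) (x : Cn n) : CVec n →L[ℂ] F := cExtL (fderiv ℝ f x)

theorem cd_apply (f : Cn n → F) (x : Cn n) (v : CVec n) : cd f x v = cExt (fderiv ℝ f x) v := rfl

theorem cd_congr {f g : Cn n → F} {x : Cn n} (h : f =ᶠ[𝓝 x] g) : cd f x = cd g x := by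
  rw [cd, cd, h.fderiv_eq]

/-- `f` is smooth near `p`, as an eventual statement: unlike `ContDiffAt ℝ ∞ f p`, which allows the
neighbourhood to shrink with the order of differentiability, this is `SmoothNear f p`. -/
def SmAt {E F : Type*} [NormedAddCommGroup E] [NormedSpace ℝ E]
    [NormedAddCommGroup F] [NormedSpace ℝ F] (f : E → F) (p : E) : Prop :=
  ∀ᶠ x in 𝓝 p, ContDiffAt ℝ ∞ f x

section SmAt

variable {E F G : Type*} [NormedAddCommGroup E] [NormedSpace ℝ E]
    [NormedAddCommGroup F] [NormedSpace ℝ F] [NormedAddCommGroup G] [NormedSpace ℝ G]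
    {f : E → F} {p : E}

protected theorem SmAt.contDiffAt (h : SmAt f p) : ContDiffAt ℝ ∞ f p := h.self_of_nhds

protected theorem SmAt.differentiableAt (h : SmAt f p) : DifferentiableAt ℝ f p :=
  h.contDiffAt.differentiableAt (by simp)

protected theorem SmAt.eventually (h : SmAt f p) : ∀ᶠ x in 𝓝 p, SmAt f x :=
  eventually_eventually_nhds.2 h

theorem _root_.ContDiff.smAt (h : ContDiff ℝ ∞ f) : SmAt f p :=
  Filter.Eventually.of_forall fun _ => h.contDiffAt

protected theorem SmAt.fderiv (h : SmAt f p) : SmAt (fderiv ℝ f) p := by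
  filter_upwards [h] with x hx
  exact hx.fderiv_right (m := ∞) (by simp)

protected theorem SmAt.continuousAt (h : SmAt f p) : ContinuousAt f p := h.contDiffAt.continuousAt

protected theorem SmAt.comp {g : F → G} (hg : SmAt g (f p)) (hf : SmAt f p) :
    SmAt (fun x => g (f x)) p := by
  filter_upwards [hf, hf.continuousAt.eventually hg] with x hx hgx
  exact ContDiffAt.comp x hgx hx

theorem smAt_const (c : F) : SmAt (fun _ : E => c) p := contDiff_const.smAt

protected theorem SmAt.add {g : E → F} (hf : SmAt f p) (hg : SmAt g p) :
    SmAt (fun x => f x + g x) p := by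
  filter_upwards [hf, hg] with x h1 h2 using h1.add h2

protected theorem SmAt.sub {g : E → F} (hf : SmAt f p) (hg : SmAt g p) :
    SmAt (fun x => f x - g x) p := by
  filter_upwards [hf, hg] with x h1 h2 using h1.sub h2

protected theorem SmAt.mul {f g : E → ℂ} (hf : SmAt f p) (hg : SmAt g p) :
    SmAt (fun x => f x * g x) p := by
  filter_upwards [hf, hg] with x h1 h2 using h1.mul h2

protected theorem SmAt.inv {f : E → ℂ} (hf : SmAt f p) (h0 : f p ≠ 0) :
    SmAt (fun x => (f x)⁻¹) p := by
  filter_upwards [hf, hf.continuousAt.eventually_ne h0] with x h1 h2 using h1.inv h2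

protected theorem SmAt.smul [NormedSpace ℂ F] [IsScalarTower ℝ ℂ F] {c : E → ℂ} (hc : SmAt c p)
    (hf : SmAt f p) : SmAt (fun x => c x • f x) p := by
  filter_upwards [hc, hf] with x h1 h2 using h1.smul h2

protected theorem SmAt.prodMk {g : E → G} (hf : SmAt f p) (hg : SmAt g p) :
    SmAt (fun x => (f x, g x)) p := by
  filter_upwards [hf, hg] with x h1 h2 using h1.prodMk h2

protected theorem SmAt.clm (L : F →L[ℝ] G) (hf : SmAt f p) : SmAt (fun x => L (f x)) p := by
  filter_upwards [hf] with x h1 using L.contDiff.contDiffAt.comp x h1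

protected theorem SmAt.clmC [NormedSpace ℂ F] [NormedSpace ℂ G] [IsScalarTower ℝ ℂ F]
    [IsScalarTower ℝ ℂ G] (L : F →L[ℂ] G) (hf : SmAt f p) : SmAt (fun x => L (f x)) p :=
  hf.clm (L.restrictScalars ℝ)

protected theorem SmAt.fst {f : E → F × G} (hf : SmAt f p) : SmAt (fun x => (f x).1) p :=
  hf.clm (ContinuousLinearMap.fst ℝ F G)

protected theorem SmAt.snd {f : E → F × G} (hf : SmAt f p) : SmAt (fun x => (f x).2) p :=
  hf.clm (ContinuousLinearMap.snd ℝ F G)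

protected theorem SmAt.clm_apply {A : E → F →L[ℝ] G} (hA : SmAt A p) (hf : SmAt f p) :
    SmAt (fun x => A x (f x)) p := by
  filter_upwards [hA, hf] with x h1 h2 using h1.clm_apply h2

protected theorem SmAt.clmC_apply [NormedSpace ℂ F] [NormedSpace ℂ G] [IsScalarTower ℝ ℂ F]
    [IsScalarTower ℝ ℂ G] {A : E → F →L[ℂ] G} (hA : SmAt A p) (hf : SmAt f p) :
    SmAt (fun x => A x (f x)) p :=
  SmAt.clm_apply (A := fun x => (A x).restrictScalars ℝ)
    (hA.clm (ContinuousLinearMap.restrictScalarsL ℂ F G ℝ ℝ)) hf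

theorem smAt_of_contDiffOn {U : Set E} (hU : IsOpen U) (hp : p ∈ U) (h : ContDiffOn ℝ ∞ f U) :
    SmAt f p := by
  filter_upwards [hU.mem_nhds hp] with x hx using h.contDiffAt (hU.mem_nhds hx)

protected theorem SmAt.exists_contDiffOn (h : SmAt f p) {P : E → Prop} (hP : ∀ᶠ x in 𝓝 p, P x) :
    ∃ U : Set E, IsOpen U ∧ p ∈ U ∧ ContDiffOn ℝ ∞ f U ∧ ∀ x ∈ U, P x := by
  obtain ⟨U, hU, hUo, hpU⟩ := eventually_nhds_iff.1 (h.and hP)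
  exact ⟨U, hUo, hpU, fun x hx => (hU x hx).1.contDiffWithinAt, fun x hx => (hU x hx).2⟩

end SmAt

protected theorem SmAt.cd {f : Cn n → F} {p : Cn n} (h : SmAt f p) : SmAt (cd f) p :=
  h.fderiv.clmC cExtL

theorem cd_const (c : F) (x : Cn n) : cd (fun _ : Cn n => c) x = 0 := by
  simp [cd]

theorem cd_add {f g : Cn n → F} {x : Cn n} (hf : DifferentiableAt ℝ f x)
    (hg : DifferentiableAt ℝ g x) : cd (fun y => f y + g y) x = cd f x + cd g x := by
  simp only [cd]; rw [fderiv_fun_add hf hg, map_add]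

theorem cd_sub {f g : Cn n → F} {x : Cn n} (hf : DifferentiableAt ℝ f x)
    (hg : DifferentiableAt ℝ g x) : cd (fun y => f y - g y) x = cd f x - cd g x := by
  simp only [cd]; rw [fderiv_fun_sub hf hg, map_sub]

theorem cd_clm_comp (L : F →L[ℂ] G) {f : Cn n → F} {x : Cn n} (hf : DifferentiableAt ℝ f x) :
    cd (fun y => L (f y)) x = L.comp (cd f x) := by
  refine ContinuousLinearMap.ext fun v => ?_
  have h : HasFDerivAt (fun y => L (f y)) ((L.restrictScalars ℝ).comp (fderiv ℝ f x)) x :=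
    (L.restrictScalars ℝ).hasFDerivAt.comp x hf.hasFDerivAt
  rw [cd_apply, h.fderiv, cExt_comp]; rfl

theorem cd_clm_apply {A : Cn n → F →L[ℂ] G} {ξ : Cn n → F} {x : Cn n}
    (hA : DifferentiableAt ℝ A x) (hξ : DifferentiableAt ℝ ξ x) (v : CVec n) :
    cd (fun y => A y (ξ y)) x v = cd A x v (ξ x) + A x (cd ξ x v) := by
  have hA' : HasFDerivAt (fun y => (A y).restrictScalars ℝ)
      ((ContinuousLinearMap.restrictScalarsL ℂ F G ℝ ℝ).comp (fderiv ℝ A x)) x :=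
    (ContinuousLinearMap.restrictScalarsL ℂ F G ℝ ℝ).hasFDerivAt.comp x hA.hasFDerivAt
  have h := hA'.clm_apply hξ.hasFDerivAt
  have h2 : fderiv ℝ (fun y => A y (ξ y)) x = _ := h.fderiv
  rw [cd_apply, h2]
  simp [cExt, cd, ContinuousLinearMap.comp_apply]
  module

theorem cd_mul {f g : Cn n → ℂ} {x : Cn n} (hf : DifferentiableAt ℝ f x)
    (hg : DifferentiableAt ℝ g x) (v : CVec n) :
    cd (fun y => f y * g y) x v = cd f x v * g x + f x * cd g x v := by
  have h := hf.hasFDerivAt.mul hg.hasFDerivAt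
  have h2 : fderiv ℝ (fun y => f y * g y) x = _ := h.fderiv
  rw [cd_apply, h2]
  simp [cExt, cd]
  ring

/-- Derivatives along constant complex vectors commute. -/
theorem cd_cd_symm {f : Cn n → F} {x : Cn n} (hf : ContDiffAt ℝ ∞ f x) (v w : CVec n) :
    cd (cd f) x v w = cd (cd f) x w v := by
  have hd : DifferentiableAt ℝ (fderiv ℝ f) x :=
    (hf.fderiv_right (m := ∞) (by simp)).differentiableAt (by simp)
  have h1 : cd (cd f) x = (cExtL (F := F)).comp (cd (fderiv ℝ f) x) :=
    cd_clm_comp (cExtL (n := n) (F := F)) hd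
  have hs : ∀ a b, fderiv ℝ (fderiv ℝ f) x a b = fderiv ℝ (fderiv ℝ f) x b a := by
    have := hf.isSymmSndFDerivAt (by
      rw [minSmoothness_of_isRCLikeNormedField]
      exact WithTop.coe_le_coe.2 le_top)
    exact fun a b => this a b
  rw [h1]
  simp only [ContinuousLinearMap.comp_apply, cExtL_apply, cd_apply]
  generalize fderiv ℝ (fderiv ℝ f) x = B at hs
  simp only [cExt, LinearMap.coe_mk, AddHom.coe_mk, add_apply, sub_apply, smul_apply]
  rw [hs v.1 w.1, hs v.1 (Complex.I • w.1), hs v.1 (star w.2), hs v.1 (Complex.I • star w.2),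
    hs (Complex.I • v.1) w.1, hs (Complex.I • v.1) (Complex.I • w.1),
    hs (Complex.I • v.1) (star w.2), hs (Complex.I • v.1) (Complex.I • star w.2),
    hs (star v.2) w.1, hs (star v.2) (Complex.I • w.1), hs (star v.2) (star w.2),
    hs (star v.2) (Complex.I • star w.2), hs (Complex.I • star v.2) w.1,
    hs (Complex.I • star v.2) (Complex.I • w.1), hs (Complex.I • star v.2) (star w.2),
    hs (Complex.I • star v.2) (Complex.I • star w.2)]
  module

end ComplexDerivative

end

/-! ### Holomorphic maps, brackets and Lie derivatives -/

section

variable {n : ℕ}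

section Holomorphic

variable {F G : Type*} [NormedAddCommGroup F] [NormedSpace ℝ F] [NormedSpace ℂ F]
  [IsScalarTower ℝ ℂ F] [NormedAddCommGroup G] [NormedSpace ℝ G] [NormedSpace ℂ G]
  [IsScalarTower ℝ ℂ G]

theorem _root_.AnalyticAt.smAt [CompleteSpace F] {f : Cn n → F} {p : Cn n}
    (h : AnalyticAt ℂ f p) : SmAt f p := by
  filter_upwards [h.eventually_analyticAt] with x hx
  exact (hx.restrictScalars (𝕜 := ℝ)).contDiffAt

theorem cExt_restrictScalars (A : Cn n →L[ℂ] F) (v : CVec n) :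
    cExt (A.restrictScalars ℝ) v = A v.1 := by
  have hI : ∀ x : F, Complex.I • Complex.I • x = -x := fun x => by
    rw [smul_smul, Complex.I_mul_I, neg_one_smul]
  simp only [cExt, LinearMap.coe_mk, AddHom.coe_mk, ContinuousLinearMap.coe_restrictScalars',
    map_smul, hI]
  module

theorem cd_of_holomorphic {f : Cn n → F} {x : Cn n} (h : DifferentiableAt ℂ f x) (v : CVec n) :
    cd f x v = fderiv ℂ f x v.1 := by
  rw [cd_apply, (h.hasFDerivAt.restrictScalars ℝ).fderiv, cExt_restrictScalars]

theorem cd_clm (L : Cn n →L[ℂ] F) (x : Cn n) (v : CVec n) :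
    cd (fun y => L y) x v = L v.1 := by
  rw [cd_of_holomorphic L.differentiableAt, ContinuousLinearMap.fderiv]

theorem star_cExt (A : Cn n →L[ℝ] ℂ) (v : CVec n) :
    cExt (Complex.conjCLE.toContinuousLinearMap.comp A) v = star (cExt A (conjVec n v)) := by
  simp [cExt, conjVec]
  ring

theorem cd_star {f : Cn n → ℂ} {x : Cn n} (hf : DifferentiableAt ℝ f x) (v : CVec n) :
    cd (fun y => star (f y)) x v = star (cd f x (conjVec n v)) := by
  have h : HasFDerivAt (fun y => star (f y))
      (Complex.conjCLE.toContinuousLinearMap.comp (fderiv ℝ f x)) x :=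
    (Complex.conjCLE.toContinuousLinearMap).hasFDerivAt.comp x hf.hasFDerivAt
  rw [cd_apply, h.fderiv, star_cExt]; rfl

@[simp] theorem conjVec_fst (v : CVec n) : (conjVec n v).1 = star v.2 := rfl
@[simp] theorem conjVec_snd (v : CVec n) : (conjVec n v).2 = star v.1 := rfl
@[simp] theorem conjVec_conjVec (v : CVec n) : conjVec n (conjVec n v) = v := by
  ext <;> simp [conjVec]

protected theorem SmAt.star {f : Cn n → ℂ} {p : Cn n} (hf : SmAt f p) :
    SmAt (fun x => star (f x)) p :=
  hf.clm Complex.conjCLE.toContinuousLinearMap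

/-- The complex conjugation of `ℂⁿ` as a continuous real linear map. -/
def starCn (n : ℕ) : Cn n →L[ℝ] Cn n :=
  LinearMap.toContinuousLinearMap
    { toFun := fun x => star x
      map_add' := fun x y => star_add x y
      map_smul' := fun c x => by ext i; simp }

@[simp] theorem starCn_apply (x : Cn n) : starCn n x = star x := rfl

/-- The chain rule for the complex differential under a holomorphic map. -/
theorem cd_comp_holomorphic {f : Cn n → F} {Ψ : Cn n → Cn n} {x : Cn n}
    (hf : DifferentiableAt ℝ f (Ψ x)) (hΨ : DifferentiableAt ℂ Ψ x) (v : CVec n) :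
    cd (fun y => f (Ψ y)) x v = cd f (Ψ x) (push (fderiv ℂ Ψ x) v) := by
  have h : HasFDerivAt (fun y => f (Ψ y))
      ((fderiv ℝ f (Ψ x)).comp ((fderiv ℂ Ψ x).restrictScalars ℝ)) x :=
    hf.hasFDerivAt.comp x (hΨ.hasFDerivAt.restrictScalars ℝ)
  rw [cd_apply, h.fderiv, cd_apply]
  simp [cExt, push]

/-- A holomorphic map has a smooth complex Jacobian `x ↦ push (DΨ x) v`. -/
theorem smAt_push_fderiv {Ψ : Cn n → Cn n} {p : Cn n} (hΨ : AnalyticAt ℂ Ψ p) {ξ : Cn n → CVec n}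
    (hξ : SmAt ξ p) : SmAt (fun x => push (fderiv ℂ Ψ x) (ξ x)) p := by
  have hD : SmAt (fun x => fderiv ℂ Ψ x) p := hΨ.fderiv.smAt
  refine SmAt.prodMk (hD.clmC_apply hξ.fst) ?_
  exact SmAt.clm (starCn n) (hD.clmC_apply (SmAt.clm (starCn n) hξ.snd))

end Holomorphic

section LieDerivative

protected theorem SmAt.cExtL {F : Type*} [NormedAddCommGroup F] [NormedSpace ℝ F] [NormedSpace ℂ F]
    [IsScalarTower ℝ ℂ F] {θ : Cn n → Cn n →L[ℝ] F} {p : Cn n} (h : SmAt θ p) :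
    SmAt (fun x => cExtL (θ x)) p := h.clmC cExtL

theorem cExt_flip (B : Cn n →L[ℝ] Cn n →L[ℝ] ℂ) (v w : CVec n) :
    cExt (cExt B.flip v) w = cExt (cExt B w) v := by
  simp only [cExt, LinearMap.coe_mk, AddHom.coe_mk, add_apply, sub_apply, smul_apply,
    ContinuousLinearMap.flip_apply]
  module

/-- Cartan's formula for the Lie derivative of a one-form, in coordinates. -/
theorem cExt_lieD {θ : Cn n → Cn n →L[ℝ] ℂ} {ξ : Cn n → CVec n} {x : Cn n}
    (hθ : DifferentiableAt ℝ θ x) (hξ : DifferentiableAt ℝ ξ x) (v : CVec n) :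
    cExt (lieD ξ θ x) v =
      cd (fun y => cExtL (θ y)) x (ξ x) v + cExtL (θ x) (cd ξ x v) := by
  have hc : DifferentiableAt ℝ (fun y => cExtL (θ y)) x :=
    ((cExtL (n := n) (F := ℂ)).restrictScalars ℝ).differentiableAt.comp x hθ
  have h1 : cExt (fderiv ℝ (pairing θ ξ) x) v =
      cd (fun y => cExtL (θ y)) x v (ξ x) + cExtL (θ x) (cd ξ x v) :=
    cd_clm_apply (A := fun y => cExtL (θ y)) hc hξ v
  have h2 : ∀ u, cd (fun y => cExtL (θ y)) x u = cExtL (cd θ x u) := fun u => by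
    rw [cd_clm_comp cExtL hθ]; rfl
  rw [lieD, cExt_add_left, h1, extD, cExt_sub_left, cExt_sub_left, cExt_flip, h2, h2]
  simp only [cExtL_apply, cd_apply]
  ring

protected theorem SmAt.pairing {θ : Cn n → Cn n →L[ℝ] ℂ} {ξ : Cn n → CVec n} {x : Cn n}
    (hθ : SmAt θ x) (hξ : SmAt ξ x) : SmAt (pairing θ ξ) x :=
  SmAt.clmC_apply (A := fun y => cExtL (θ y)) hθ.cExtL hξ

protected theorem SmAt.flip {E E' F : Type*} [NormedAddCommGroup E] [NormedSpace ℝ E]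
    [NormedAddCommGroup E'] [NormedSpace ℝ E'] [NormedAddCommGroup F] [NormedSpace ℝ F]
    {B : E' → E →L[ℝ] E →L[ℝ] F} {x : E'} (h : SmAt B x) : SmAt (fun y => (B y).flip) x := by
  have hb : IsBoundedLinearMap ℝ (fun T : E →L[ℝ] E →L[ℝ] F => T.flip) :=
    { map_add := fun _ _ => rfl
      map_smul := fun _ _ => rfl
      bound := ⟨1, one_pos, fun T => by simp⟩ }
  filter_upwards [h] with y hy
  have hc : ContDiff ℝ ∞ (fun T : E →L[ℝ] E →L[ℝ] F => T.flip) :=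
    IsBoundedLinearMap.contDiff (F := E →L[ℝ] E →L[ℝ] F) hb
  exact hc.contDiffAt.comp y hy

protected theorem SmAt.lieD {θ : Cn n → Cn n →L[ℝ] ℂ} {ξ : Cn n → CVec n} {x : Cn n}
    (hθ : SmAt θ x) (hξ : SmAt ξ x) : SmAt (lieD ξ θ) x := by
  have h1 : SmAt (extD θ) x :=
    hθ.fderiv.sub hθ.fderiv.flip
  exact (hθ.pairing hξ).fderiv.add (h1.cExtL.clmC_apply hξ)

protected theorem SmAt.bracket {ξ η : Cn n → CVec n} {x : Cn n} (hξ : SmAt ξ x) (hη : SmAt η x) :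
    SmAt (bracket ξ η) x :=
  (hη.cd.clmC_apply hξ).sub (hξ.cd.clmC_apply hη)

theorem bracket_apply (ξ η : Cn n → CVec n) (x : Cn n) :
    bracket ξ η x = cd η x (ξ x) - cd ξ x (η x) := rfl

/-- Two successive Lie derivatives of a one-form, in terms of brackets. -/
theorem cExt_lieD_lieD {θ : Cn n → Cn n →L[ℝ] ℂ} {ξ3 ξ2 ξ1 : Cn n → CVec n} {x : Cn n}
    (hθ : SmAt θ x) (h3 : SmAt ξ3 x) (h2 : SmAt ξ2 x) (h1 : SmAt ξ1 x) :
    cExt (lieD ξ3 (lieD ξ2 θ) x) (ξ1 x) =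
      cd (pairing (lieD ξ2 θ) ξ1) x (ξ3 x) -
        cExt (lieD ξ2 θ x) (bracket ξ3 ξ1 x) := by
  have hη := hθ.lieD h2
  rw [cExt_lieD hη.differentiableAt h3.differentiableAt]
  have : cd (pairing (lieD ξ2 θ) ξ1) x (ξ3 x) = _ :=
    cd_clm_apply (A := fun y => cExtL (lieD ξ2 θ y)) hη.cExtL.differentiableAt
      h1.differentiableAt (ξ3 x)
  rw [this, bracket_apply, map_sub]
  simp only [cExtL_apply]
  ring

theorem cExt_lieD_eq {θ : Cn n → Cn n →L[ℝ] ℂ} {ξ η : Cn n → CVec n} {x : Cn n}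
    (hθ : SmAt θ x) (hξ : SmAt ξ x) (hη : SmAt η x) :
    cExt (lieD ξ θ x) (η x) =
      cd (pairing θ η) x (ξ x) - pairing θ (bracket ξ η) x := by
  rw [cExt_lieD hθ.differentiableAt hξ.differentiableAt]
  have : cd (pairing θ η) x (ξ x) = _ :=
    cd_clm_apply (A := fun y => cExtL (θ y)) hθ.cExtL.differentiableAt
      hη.differentiableAt (ξ x)
  rw [this, pairing, bracket_apply, map_sub]
  simp only [cExtL_apply]
  ring

end LieDerivative

end

/-! ### Taylor expansion of third order -/

section

section Taylor

variable {E F : Type*} [NormedAddCommGroup E] [NormedSpace ℝ E]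
    [NormedAddCommGroup F] [NormedSpace ℝ F]

theorem isBigO_pow_mono {E F : Type*} [NormedAddCommGroup E] [NormedAddCommGroup F]
    {f : E → F} {j k : ℕ} (hjk : k ≤ j)
    (h : f =O[𝓝 0] fun x => ‖x‖ ^ j) : f =O[𝓝 0] fun x => ‖x‖ ^ k := by
  refine h.trans (Asymptotics.IsBigO.of_bound 1 ?_)
  filter_upwards [Metric.closedBall_mem_nhds (0 : E) one_pos] with x hx
  rw [mem_closedBall_zero_iff] at hx
  simp only [norm_pow, norm_norm, one_mul]
  exact pow_le_pow_of_le_one (norm_nonneg x) hx hjk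

/-- Integrating an estimate for the derivative. -/
theorem isBigO_of_fderiv {f : E → F} {k : ℕ} (hf : ∀ᶠ x in 𝓝 0, DifferentiableAt ℝ f x)
    (h0 : f 0 = 0) (h : fderiv ℝ f =O[𝓝 0] fun x => ‖x‖ ^ k) :
    f =O[𝓝 0] fun x => ‖x‖ ^ (k + 1) := by
  obtain ⟨C, hC⟩ := h.bound
  obtain ⟨ε, hε, hb⟩ := Metric.eventually_nhds_iff_ball.1 (hf.and hC)
  refine Asymptotics.IsBigO.of_bound C ?_
  filter_upwards [Metric.ball_mem_nhds (0 : E) hε] with x hx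
  rw [mem_ball_zero_iff] at hx
  have hsub : ∀ y ∈ Metric.closedBall (0 : E) ‖x‖, y ∈ Metric.ball (0 : E) ε := fun y hy => by
    rw [mem_closedBall_zero_iff] at hy
    rw [mem_ball_zero_iff]
    exact hy.trans_lt hx
  have hC0 : 0 ≤ C ∨ ‖x‖ ^ k = 0 := by
    by_contra! hcon
    have := (hb x (mem_ball_zero_iff.2 hx)).2
    rw [norm_pow, norm_norm] at this
    have h2 : 0 < ‖x‖ ^ k := lt_of_le_of_ne (by positivity) hcon.2.symm
    have := (norm_nonneg _).trans this
    nlinarith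
  have hbound : ∀ y ∈ Metric.closedBall (0 : E) ‖x‖, ‖fderiv ℝ f y‖ ≤ C * ‖x‖ ^ k := fun y hy => by
    refine (hb y (hsub y hy)).2.trans ?_
    rw [norm_pow, norm_norm]
    rw [mem_closedBall_zero_iff] at hy
    rcases hC0 with hC0 | hC0
    · gcongr
    · have : ‖y‖ ^ k = 0 := by
        refine le_antisymm ?_ (by positivity)
        rw [← hC0]; gcongr
      rw [this, hC0]
  have := (convex_closedBall (0 : E) ‖x‖).norm_image_sub_le_of_norm_fderiv_le
    (fun y hy => (hb y (hsub y hy)).1) hbound (Metric.mem_closedBall_self (norm_nonneg x))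
    (mem_closedBall_zero_iff.2 le_rfl : x ∈ _)
  rw [h0, sub_zero, sub_zero] at this
  rw [norm_pow, norm_norm, pow_succ]
  linarith

protected theorem SmAt.sub_isBigO_one {f : E → F} (hf : SmAt f 0) :
    (fun x => f x - f 0) =O[𝓝 0] fun x => ‖x‖ ^ 1 := by
  have := hf.differentiableAt.hasFDerivAt.isBigO_sub
  simpa using this.norm_right

protected theorem SmAt.taylor_one {f : E → F} (hf : SmAt f 0) :
    (fun x => f x - (f 0 + fderiv ℝ f 0 x)) =O[𝓝 0] fun x => ‖x‖ ^ 2 := by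
  have hd : ∀ᶠ x in 𝓝 0, HasFDerivAt (fun x => f x - (f 0 + fderiv ℝ f 0 x))
      (fderiv ℝ f x - fderiv ℝ f 0) x := by
    filter_upwards [hf.eventually] with x hx
    exact hx.differentiableAt.hasFDerivAt.sub
      ((fderiv ℝ f 0).hasFDerivAt.const_add (f 0))
  refine isBigO_of_fderiv (hd.mono fun x hx => hx.differentiableAt) (by simp) ?_
  refine hf.fderiv.sub_isBigO_one.congr' ?_ Filter.EventuallyEq.rfl
  filter_upwards [hd] with x hx using hx.fderiv.symm

protected theorem SmAt.fderiv_fderiv_symm {f : E → F} {p : E} (hf : SmAt f p) (v w : E) :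
    fderiv ℝ (fderiv ℝ f) p v w = fderiv ℝ (fderiv ℝ f) p w v := by
  have := hf.contDiffAt.isSymmSndFDerivAt (by
      rw [minSmoothness_of_isRCLikeNormedField]
      exact WithTop.coe_le_coe.2 le_top)
  exact this v w

protected theorem SmAt.taylor_two {f : E → F} (hf : SmAt f 0) :
    (fun x => f x - (f 0 + fderiv ℝ f 0 x + (1 / 2 : ℝ) • fderiv ℝ (fderiv ℝ f) 0 x x))
      =O[𝓝 0] fun x => ‖x‖ ^ 3 := by
  have hd : ∀ᶠ x in 𝓝 0, HasFDerivAt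
      (fun x => f x - (f 0 + fderiv ℝ f 0 x + (1 / 2 : ℝ) • fderiv ℝ (fderiv ℝ f) 0 x x))
      (fderiv ℝ f x - (fderiv ℝ f 0 + fderiv ℝ (fderiv ℝ f) 0 x)) x := by
    filter_upwards [hf.eventually] with x hx
    have hq : HasFDerivAt (fun x => fderiv ℝ (fderiv ℝ f) 0 x x) _ x :=
      (fderiv ℝ (fderiv ℝ f) 0).hasFDerivAt.clm_apply (hasFDerivAt_id x)
    refine (hx.differentiableAt.hasFDerivAt.sub
      (((fderiv ℝ f 0).hasFDerivAt.const_add (f 0)).add (hq.const_smul (1 / 2 : ℝ)))).congr_fderiv ?_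
    ext v
    simp only [sub_apply, add_apply, smul_apply, ContinuousLinearMap.comp_apply,
      ContinuousLinearMap.flip_apply, ContinuousLinearMap.id_apply]
    rw [hf.fderiv_fderiv_symm v x]
    module
  refine isBigO_of_fderiv (hd.mono fun x hx => hx.differentiableAt) (by simp) ?_
  refine hf.fderiv.taylor_one.congr' ?_ Filter.EventuallyEq.rfl
  filter_upwards [hd] with x hx using hx.fderiv.symm

protected theorem SmAt.fderiv3_symm_left {f : E → F} {p : E} (hf : SmAt f p) (u v w : E) :
    fderiv ℝ (fderiv ℝ (fderiv ℝ f)) p u v w =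
      fderiv ℝ (fderiv ℝ (fderiv ℝ f)) p v u w := by
  rw [hf.fderiv.fderiv_fderiv_symm]

protected theorem SmAt.fderiv3_symm_right {f : E → F} {p : E} (hf : SmAt f p) (u v w : E) :
    fderiv ℝ (fderiv ℝ (fderiv ℝ f)) p u v w =
      fderiv ℝ (fderiv ℝ (fderiv ℝ f)) p u w v := by
  have key : ∀ a b : E, HasFDerivAt (fun x => fderiv ℝ (fderiv ℝ f) x a b)
      ((ContinuousLinearMap.apply ℝ F b).comp ((ContinuousLinearMap.apply ℝ (E →L[ℝ] F) a).comp
        (fderiv ℝ (fderiv ℝ (fderiv ℝ f)) p))) p := fun a b =>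
    ((hf.fderiv.fderiv.differentiableAt.hasFDerivAt.clm_apply (hasFDerivAt_const a p)).clm_apply
      (hasFDerivAt_const b p)).congr_fderiv (by ext; simp)
  have h2 := (key w v).congr_of_eventuallyEq (f₁ := fun x =>
    fderiv ℝ (fderiv ℝ f) x v w) (by
      filter_upwards [hf.eventually] with x hx using hx.fderiv_fderiv_symm v w)
  have := (key v w).unique h2
  simpa using congrArg (fun A => A u) this

/-- Taylor's formula of third order. -/
protected theorem SmAt.taylor_three {f : E → F} (hf : SmAt f 0) :
    (fun x => f x - (f 0 + fderiv ℝ f 0 x + (1 / 2 : ℝ) • fderiv ℝ (fderiv ℝ f) 0 x x +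
      (1 / 6 : ℝ) • fderiv ℝ (fderiv ℝ (fderiv ℝ f)) 0 x x x)) =O[𝓝 0] fun x => ‖x‖ ^ 4 := by
  have hd : ∀ᶠ x in 𝓝 0, HasFDerivAt
      (fun x => f x - (f 0 + fderiv ℝ f 0 x + (1 / 2 : ℝ) • fderiv ℝ (fderiv ℝ f) 0 x x +
      (1 / 6 : ℝ) • fderiv ℝ (fderiv ℝ (fderiv ℝ f)) 0 x x x))
      (fderiv ℝ f x - (fderiv ℝ f 0 + fderiv ℝ (fderiv ℝ f) 0 x +
        (1 / 2 : ℝ) • fderiv ℝ (fderiv ℝ (fderiv ℝ f)) 0 x x)) x := by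
    filter_upwards [hf.eventually] with x hx
    have hq : HasFDerivAt (fun x => fderiv ℝ (fderiv ℝ f) 0 x x) _ x :=
      (fderiv ℝ (fderiv ℝ f) 0).hasFDerivAt.clm_apply (hasFDerivAt_id x)
    have hc : HasFDerivAt (fun x => fderiv ℝ (fderiv ℝ (fderiv ℝ f)) 0 x x x) _ x :=
      ((fderiv ℝ (fderiv ℝ (fderiv ℝ f)) 0).hasFDerivAt.clm_apply (hasFDerivAt_id x)).clm_apply
        (hasFDerivAt_id x)
    refine (hx.differentiableAt.hasFDerivAt.sub
      ((((fderiv ℝ f 0).hasFDerivAt.const_add (f 0)).add (hq.const_smul (1 / 2 : ℝ))).add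
        (hc.const_smul (1 / 6 : ℝ)))).congr_fderiv ?_
    ext v
    simp only [sub_apply, add_apply, smul_apply, ContinuousLinearMap.comp_apply,
      ContinuousLinearMap.flip_apply, ContinuousLinearMap.id_apply, id_eq]
    rw [hf.fderiv_fderiv_symm v x, hf.fderiv3_symm_left v x x, hf.fderiv3_symm_right x v x]
    module
  refine isBigO_of_fderiv (hd.mono fun x hx => hx.differentiableAt) (by simp) ?_
  refine hf.fderiv.taylor_two.congr' ?_ Filter.EventuallyEq.rfl
  filter_upwards [hd] with x hx using hx.fderiv.symm

/-- A cubic polynomial curve vanishing to fourth order at the origin is zero. -/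
theorem cubic_eq_zero_of_isBigO {a b c d : F}
    (h : (fun t : ℝ => a + t • b + t ^ 2 • c + t ^ 3 • d) =O[𝓝 0] fun t => t ^ 4) :
    a = 0 ∧ b = 0 ∧ c = 0 ∧ d = 0 := by
  have step : ∀ (f : ℝ → F) (k : ℕ), Continuous f → (f =O[𝓝[≠] 0] fun t : ℝ => t ^ (k + 1)) →
      f 0 = 0 := by
    intro f k hf ho
    have h1 : Filter.Tendsto (fun t : ℝ => t ^ (k + 1)) (𝓝[≠] 0) (𝓝 0) := by
      have : Continuous fun t : ℝ => t ^ (k + 1) := by fun_prop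
      simpa using (this.tendsto 0).mono_left nhdsWithin_le_nhds
    exact tendsto_nhds_unique ((hf.tendsto 0).mono_left nhdsWithin_le_nhds) (ho.trans_tendsto h1)
  have div : ∀ (f : ℝ → F) (k : ℕ), ((fun t => t • f t) =O[𝓝[≠] 0] fun t : ℝ => t ^ (k + 1)) →
      (f =O[𝓝[≠] 0] fun t : ℝ => t ^ k) := by
    intro f k ho
    have := (Asymptotics.isBigO_refl (fun t : ℝ => t⁻¹) (𝓝[≠] 0)).smul ho
    refine this.congr' ?_ ?_
    · filter_upwards [self_mem_nhdsWithin] with t ht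
      rw [smul_smul, inv_mul_cancel₀ ht, one_smul]
    · filter_upwards [self_mem_nhdsWithin] with t ht
      rw [smul_eq_mul, pow_succ', ← mul_assoc, inv_mul_cancel₀ ht, one_mul]
  have h0 := h.mono (nhdsWithin_le_nhds (s := {0}ᶜ))
  have ha : a = 0 := by simpa using step _ 3 (by fun_prop) h0
  subst ha
  have h1 := div (fun t => b + t • c + t ^ 2 • d) 3 (h0.congr_left fun t => by module)
  have hb : b = 0 := by simpa using step _ 2 (by fun_prop) h1
  subst hb
  have h2 := div (fun t => c + t • d) 2 (h1.congr_left fun t => by module)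
  have hc : c = 0 := by simpa using step _ 1 (by fun_prop) h2
  subst hc
  have h3 := div (fun _ => d) 1 (h2.congr_left fun t => by module)
  exact ⟨rfl, rfl, rfl, by simpa using step _ 0 (by fun_prop) h3⟩

/-- A smooth function vanishing to fourth order has vanishing derivatives up to order three. -/
protected theorem SmAt.fderiv_eq_zero_of_isBigO {f : E → F} (hf : SmAt f 0)
    (h : f =O[𝓝 0] fun x => ‖x‖ ^ 4) :
    fderiv ℝ f 0 = 0 ∧ fderiv ℝ (fderiv ℝ f) 0 = 0 ∧
      fderiv ℝ (fderiv ℝ (fderiv ℝ f)) 0 = 0 := by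
  have hT := (h.sub hf.taylor_three).congr_left (fun x => sub_sub_cancel _ _)
  have hline : ∀ x : E, fderiv ℝ f 0 x = 0 ∧ fderiv ℝ (fderiv ℝ f) 0 x x = 0 ∧
      fderiv ℝ (fderiv ℝ (fderiv ℝ f)) 0 x x x = 0 := by
    intro x
    have hlim : Filter.Tendsto (fun t : ℝ => t • x) (𝓝 0) (𝓝 0) := by
      have : Continuous fun t : ℝ => t • x := by fun_prop
      simpa using this.tendsto 0
    have h1 := hT.comp_tendsto hlim
    have h2 : (fun t : ℝ => f 0 + t • fderiv ℝ f 0 x +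
        t ^ 2 • ((1 / 2 : ℝ) • fderiv ℝ (fderiv ℝ f) 0 x x) +
        t ^ 3 • ((1 / 6 : ℝ) • fderiv ℝ (fderiv ℝ (fderiv ℝ f)) 0 x x x)) =O[𝓝 0]
        fun t => t ^ 4 := by
      refine (h1.congr_left fun t => ?_).trans (Asymptotics.IsBigO.of_bound (‖x‖ ^ 4) ?_)
      · simp only [Function.comp_apply, map_smul, smul_apply]
        module
      · refine Filter.Eventually.of_forall fun t => ?_
        simp only [Function.comp_apply, norm_smul, norm_pow, norm_mul, norm_norm]
        exact le_of_eq (by ring)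
    obtain ⟨-, hb, hc, hd⟩ := cubic_eq_zero_of_isBigO h2
    refine ⟨hb, ?_, ?_⟩
    · simpa using hc
    · simpa using hd
  refine ⟨ContinuousLinearMap.ext fun x => (hline x).1, ?_, ?_⟩
  · refine ContinuousLinearMap.ext fun x => ContinuousLinearMap.ext fun y => ?_
    have hxy := (hline (x + y)).2.1
    have hs := hf.fderiv_fderiv_symm (p := 0)
    generalize fderiv ℝ (fderiv ℝ f) 0 = B at *
    simp only [map_add, add_apply, (hline x).2.1, (hline y).2.1, zero_add, add_zero, hs y x] at hxy
    have h2 : (2 : ℝ) • B x y = 0 := by rw [two_smul]; exact hxy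
    simpa using h2
  · have hs1 := hf.fderiv3_symm_left (p := 0)
    have hs2 := hf.fderiv3_symm_right (p := 0)
    have hd : ∀ x, fderiv ℝ (fderiv ℝ (fderiv ℝ f)) 0 x x x = 0 := fun x => (hline x).2.2
    generalize fderiv ℝ (fderiv ℝ (fderiv ℝ f)) 0 = B at *
    have hxyy : ∀ x y, B x y y = 0 := by
      intro x y
      have h1 := hd (x + y)
      have h2 := hd (x - y)
      simp only [map_add, map_sub, add_apply, sub_apply, hd, hs2 y y x, hs1 y x, hs2 x y x] at h1 h2
      have h3 : (6 : ℝ) • B x y y = 0 := by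
        have h4 := congrArg₂ (· + ·) h1 h2
        rw [← add_zero (0 : F), ← h4]
        module
      simpa using h3
    refine ContinuousLinearMap.ext fun x => ContinuousLinearMap.ext fun y =>
      ContinuousLinearMap.ext fun z => ?_
    have h1 := hxyy x (y + z)
    simp only [map_add, add_apply, hxyy, hs2 x z y, zero_add, add_zero] at h1
    have h2 : (2 : ℝ) • B x y z = 0 := by rw [two_smul]; exact h1
    simpa using h2

end Taylor

variable {n : ℕ}

section

variable {F G : Type*} [NormedAddCommGroup F] [NormedSpace ℝ F] [NormedSpace ℂ F]
  [IsScalarTower ℝ ℂ F] [NormedAddCommGroup G] [NormedSpace ℝ G] [NormedSpace ℂ G]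
  [IsScalarTower ℝ ℂ G]

theorem cd_clm_apply_const {A : Cn n → F →L[ℂ] G} {x : Cn n} (hA : DifferentiableAt ℝ A x)
    (c : F) (v : CVec n) : cd (fun y => A y c) x v = cd A x v c := by
  rw [cd_clm_apply hA (differentiableAt_const c), cd_const]
  simp

end

theorem SmAt.cd_cd_apply {f : Cn n → ℂ} {p : Cn n} (hf : SmAt f p) (v w : CVec n) :
    cd (cd f) p v w = cExt (cExt (fderiv ℝ (fderiv ℝ f) p) v) w := by
  have h : cd (cd f) p = (cExtL (F := ℂ)).comp (cd (fderiv ℝ f) p) :=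
    cd_clm_comp (cExtL (n := n) (F := ℂ)) hf.fderiv.differentiableAt
  rw [h]; rfl

theorem SmAt.cd_cd_cd_apply_const {f : Cn n → ℂ} {p : Cn n} (hf : SmAt f p) (v w u : CVec n) :
    cd (cd (cd f)) p v w u = cd (fun x => cd (cd f) x w u) p v := by
  have h1 : DifferentiableAt ℝ (fun x => cd (cd f) x w) p :=
    (hf.cd.cd.clmC_apply (smAt_const w)).differentiableAt
  rw [cd_clm_apply_const h1, cd_clm_apply_const hf.cd.cd.differentiableAt]

/-- A function on `ℂⁿ` vanishing to fourth order at `p` has vanishing complex differentials up to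
order three there. -/
protected theorem SmAt.cd_eq_zero_of_isBigO {f : Cn n → ℂ} {p : Cn n} (hf : SmAt f p)
    (h : f =O[𝓝 p] fun x => ‖x - p‖ ^ 4) :
    cd f p = 0 ∧ cd (cd f) p = 0 ∧
      cd (cd (cd f)) p = 0 := by
  have hlim : Filter.Tendsto (fun x : Cn n => p + x) (𝓝 0) (𝓝 p) := by
    have : Continuous fun x : Cn n => p + x := by fun_prop
    simpa using this.tendsto 0
  have hf0 : SmAt (fun x => f (p + x)) 0 :=
    SmAt.comp (g := f) (by simpa using hf) (f := fun x => p + x)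
      (ContDiff.smAt (by fun_prop))
  have h0 : (fun x => f (p + x)) =O[𝓝 0] fun x => ‖x‖ ^ 4 := by
    have := h.comp_tendsto hlim
    simpa [Function.comp_def] using this
  obtain ⟨h1, h2, h3⟩ := hf0.fderiv_eq_zero_of_isBigO h0
  have e1 : fderiv ℝ (fun x => f (p + x)) = fun x => fderiv ℝ f (p + x) := by
    funext x; exact fderiv_comp_add_left p
  rw [e1] at h1 h2 h3
  have e2 : fderiv ℝ (fun x => fderiv ℝ f (p + x)) =
      fun x => fderiv ℝ (fderiv ℝ f) (p + x) := by
    funext x; exact fderiv_comp_add_left (f := fderiv ℝ f) p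
  rw [e2] at h2 h3
  have h3 := (fderiv_comp_add_left (𝕜 := ℝ) (f := fderiv ℝ (fderiv ℝ f)) (x := 0) p).symm.trans h3
  simp only [add_zero] at h1 h2 h3
  refine ⟨by simp [cd, h1], ?_, ?_⟩
  · refine ContinuousLinearMap.ext fun v => ContinuousLinearMap.ext fun w => ?_
    rw [hf.cd_cd_apply, h2]
    simp [cExt]
  · refine ContinuousLinearMap.ext fun v => ContinuousLinearMap.ext fun w =>
      ContinuousLinearMap.ext fun u => ?_
    rw [hf.cd_cd_cd_apply_const]
    have e : (fun x => cd (cd f) x w u) =ᶠ[𝓝 p]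
        fun x => cExt (cExt (fderiv ℝ (fderiv ℝ f) x) w) u := by
      filter_upwards [hf.eventually] with x hx using hx.cd_cd_apply w u
    rw [cd_congr e, cd_apply]
    have hD : HasFDerivAt (𝕜 := ℝ) (fun x => fderiv ℝ (fderiv ℝ f) x) 0 p :=
      hf.fderiv.fderiv.differentiableAt.hasFDerivAt.congr_fderiv h3
    have : HasFDerivAt (𝕜 := ℝ) (fun x => cExt (cExt (fderiv ℝ (fderiv ℝ f) x) w) u) 0 p := by
      simp only [cExt, LinearMap.coe_mk, AddHom.coe_mk]
      have hab : ∀ a b, HasFDerivAt (𝕜 := ℝ) (fun x => fderiv ℝ (fderiv ℝ f) x a b) 0 p := fun a b =>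
        ((hD.clm_apply (hasFDerivAt_const a p)).clm_apply (hasFDerivAt_const b p)).congr_fderiv
          (by ext; simp)
      simp only [add_apply, sub_apply, smul_apply]
      refine HasFDerivAt.congr_fderiv ((((((hab _ _).sub ((hab _ _).const_smul Complex.I)).const_smul
        (1 / 2 : ℂ)).add (((hab _ _).add ((hab _ _).const_smul Complex.I)).const_smul
        (1 / 2 : ℂ))).sub (((((hab _ _).sub ((hab _ _).const_smul Complex.I)).const_smul
        (1 / 2 : ℂ)).add (((hab _ _).add ((hab _ _).const_smul Complex.I)).const_smul
        (1 / 2 : ℂ))).const_smul Complex.I)).const_smul (1 / 2 : ℂ) |>.add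
        ((((((hab _ _).sub ((hab _ _).const_smul Complex.I)).const_smul
        (1 / 2 : ℂ)).add (((hab _ _).add ((hab _ _).const_smul Complex.I)).const_smul
        (1 / 2 : ℂ))).add (((((hab _ _).sub ((hab _ _).const_smul Complex.I)).const_smul
        (1 / 2 : ℂ)).add (((hab _ _).add ((hab _ _).const_smul Complex.I)).const_smul
        (1 / 2 : ℂ))).const_smul Complex.I)).const_smul (1 / 2 : ℂ))) (by simp)
    rw [this.fderiv]
    simp [cExt]

end

/-! ### Bundles, contact forms and sections in terms of a defining function -/

section

variable {n : ℕ} {M : Set (Cn n)} {p : Cn n} {ρ : Cn n → ℝ}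

/-- A real function regarded as a complex valued one. -/
def rc (ρ : Cn n → ℝ) : Cn n → ℂ := fun x => (ρ x : ℂ)

protected theorem SmAt.rc (h : SmAt ρ p) : SmAt (rc ρ) p := h.clm Complex.ofRealCLM

theorem cd_rc (h : DifferentiableAt ℝ ρ p) :
    cd (rc ρ) p = cExtL (Complex.ofRealCLM.comp (fderiv ℝ ρ p)) := by
  have : HasFDerivAt (rc ρ) (Complex.ofRealCLM.comp (fderiv ℝ ρ p)) p :=
    Complex.ofRealCLM.hasFDerivAt.comp p h.hasFDerivAt
  rw [cd, this.fderiv]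

theorem cd_rc_real (h : DifferentiableAt ℝ ρ p) (X : Cn n) :
    cd (rc ρ) p (X, star X) = (fderiv ℝ ρ p X : ℂ) := by
  rw [cd_rc h, cExtL_apply, cExt_real]; rfl

theorem cd_rc_conjVec (h : DifferentiableAt ℝ ρ p) (v : CVec n) :
    cd (rc ρ) p (conjVec n v) = star (cd (rc ρ) p v) := by
  have h1 : DifferentiableAt ℝ (rc ρ) p := Complex.ofRealCLM.differentiableAt.comp p h
  have h2 := cd_star h1 (conjVec n v)
  rw [conjVec_conjVec] at h2
  rw [← h2]
  congr 1
  congr 1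
  funext y
  simp [rc]

namespace IsDefiningFunction

theorem smAt (h : IsDefiningFunction M p ρ) : SmAt ρ p := by
  obtain ⟨U, hU, hp, hs, -, -⟩ := h
  exact smAt_of_contDiffOn hU hp hs

theorem eventually (h : IsDefiningFunction M p ρ) :
    ∀ᶠ x in 𝓝 p, IsDefiningFunction M x ρ := by
  obtain ⟨U, hU, hp, hs, hd, hm⟩ := h
  filter_upwards [hU.mem_nhds hp] with x hx using ⟨U, hU, hx, hs, hd, hm⟩

theorem fderiv_ne_zero (h : IsDefiningFunction M p ρ) : fderiv ℝ ρ p ≠ 0 := by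
  obtain ⟨U, hU, hp, hs, hd, hm⟩ := h
  exact hd p hp

theorem eventually_mem_iff (h : IsDefiningFunction M p ρ) : ∀ᶠ x in 𝓝 p, x ∈ M ↔ ρ x = 0 := by
  obtain ⟨U, hU, hp, hs, hd, hm⟩ := h
  filter_upwards [hU.mem_nhds hp] with x hx using hm x hx

theorem mem_iff (h : IsDefiningFunction M p ρ) : p ∈ M ↔ ρ p = 0 :=
  h.eventually_mem_iff.self_of_nhds

end IsDefiningFunction

/-- The Lagrange multiplier rule: a smooth function that vanishes on `M` has a differential
proportional to that of a defining function. -/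
theorem fderiv_eq_smul_of_eventually_eq_zero (hρ : IsDefiningFunction M p ρ) (hp : p ∈ M)
    {F : Cn n → ℝ} (hF : SmAt F p) (h0 : ∀ᶠ x in 𝓝[M] p, F x = 0) :
    ∃ c : ℝ, fderiv ℝ F p = c • fderiv ℝ ρ p := by
  have hρp : ρ p = 0 := hρ.mem_iff.1 hp
  have hFp : F p = 0 := h0.self_of_nhdsWithin hp
  have hext : IsLocalExtrOn F {x | ρ x = ρ p} p := by
    refine Or.inl ?_
    rw [IsMinFilter]
    rw [eventually_nhdsWithin_iff] at h0 ⊢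
    filter_upwards [h0, hρ.eventually_mem_iff] with x hx hxM hxρ
    rw [hFp, hx (hxM.2 (by rw [← hρp]; exact hxρ))]
  obtain ⟨a, b, hab, h⟩ := hext.exists_multipliers_of_hasStrictFDerivAt_1d
    (hρ.smAt.contDiffAt.hasStrictFDerivAt (by simp)) (hF.contDiffAt.hasStrictFDerivAt (by simp))
  have hb : b ≠ 0 := by
    rintro rfl
    rw [zero_smul, add_zero, smul_eq_zero] at h
    rcases h with h | h
    · exact hab (by rw [h]; rfl)
    · exact hρ.fderiv_ne_zero h
  refine ⟨-(b⁻¹ * a), ?_⟩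
  have := congrArg (fun A => b⁻¹ • A) h
  simp only [smul_add, smul_smul, inv_mul_cancel₀ hb, one_smul, smul_zero] at this
  ext1 X
  have hX := congrArg (fun A => A X) this
  simp only [add_apply, smul_apply, smul_eq_mul, zero_apply] at hX ⊢
  linarith

theorem cd_eq_smul_of_eventually_eq_zero (hρ : IsDefiningFunction M p ρ) (hp : p ∈ M)
    {F : Cn n → ℂ} (hF : SmAt F p) (h0 : ∀ᶠ x in 𝓝[M] p, F x = 0) :
    ∃ c : ℂ, cd F p = c • cd (rc ρ) p := by
  obtain ⟨c, hc⟩ := fderiv_eq_smul_of_eventually_eq_zero hρ hp (F := fun x => (F x).re)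
    (hF.clm Complex.reCLM) (by filter_upwards [h0] with x hx; rw [hx]; rfl)
  obtain ⟨d, hd⟩ := fderiv_eq_smul_of_eventually_eq_zero hρ hp (F := fun x => (F x).im)
    (hF.clm Complex.imCLM) (by filter_upwards [h0] with x hx; rw [hx]; rfl)
  have h1 : HasFDerivAt (fun x => (F x).re) (Complex.reCLM.comp (fderiv ℝ F p)) p :=
    Complex.reCLM.hasFDerivAt.comp p hF.differentiableAt.hasFDerivAt
  have h2 : HasFDerivAt (fun x => (F x).im) (Complex.imCLM.comp (fderiv ℝ F p)) p :=
    Complex.imCLM.hasFDerivAt.comp p hF.differentiableAt.hasFDerivAt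
  rw [h1.fderiv] at hc
  rw [h2.fderiv] at hd
  refine ⟨c + d * Complex.I, ?_⟩
  rw [cd_rc hρ.smAt.differentiableAt, cd, ← map_smul]
  congr 1
  ext1 X
  have e1 := congrArg (fun A => A X) hc
  have e2 := congrArg (fun A => A X) hd
  simp only [ContinuousLinearMap.comp_apply, Complex.reCLM_apply, Complex.imCLM_apply, smul_apply,
    smul_eq_mul, Complex.ofRealCLM_apply] at e1 e2 ⊢
  apply Complex.ext <;> simp [e1, e2]

/-- One defining function suffices to describe `ℂT_p`, since the differentials of any two are
proportional. -/
theorem mem_cT (hρ : IsDefiningFunction M p ρ) (hp : p ∈ M) {v : CVec n} :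
    v ∈ cT M p ↔ cd (rc ρ) p v = 0 := by
  have key : ∀ r, IsDefiningFunction M p r →
      cExtL (Complex.ofRealCLM.comp (fderiv ℝ r p)) = cd (rc r) p := fun r hr =>
    (cd_rc hr.smAt.differentiableAt).symm
  simp only [cT, Submodule.mem_iInf, LinearMap.mem_ker]
  constructor
  · intro h
    rw [← key ρ hρ]; exact h ρ hρ
  · intro h r hr
    rw [← cExtL_apply, key r hr]
    obtain ⟨c, hc⟩ := cd_eq_smul_of_eventually_eq_zero hρ hp hr.smAt.rc (by
      rw [eventually_nhdsWithin_iff]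
      filter_upwards [hr.eventually_mem_iff] with x hx hxM
      simp [rc, hx.1 hxM])
    rw [hc, smul_apply, h, smul_zero]

theorem mem_H10 (hρ : IsDefiningFunction M p ρ) (hp : p ∈ M) {v : CVec n} :
    v ∈ H10 M p ↔ v.2 = 0 ∧ cd (rc ρ) p (v.1, 0) = 0 := by
  simp only [H10, Submodule.mem_inf, mem_cT hρ hp, LinearMap.mem_ker, LinearMap.snd_apply]
  constructor
  · rintro ⟨h1, h2⟩; rw [← h2]; exact ⟨rfl, h1⟩
  · rintro ⟨h1, h2⟩; rw [← h1] at h2; exact ⟨h2, h1⟩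

theorem mem_H01 (hρ : IsDefiningFunction M p ρ) (hp : p ∈ M) {v : CVec n} :
    v ∈ H01 M p ↔ v.1 = 0 ∧ cd (rc ρ) p (0, v.2) = 0 := by
  rw [H01, Submodule.mem_comap, mem_H10 hρ hp]
  have : ((conjVec n v).1, (0 : Cn n)) = conjVec n (0, v.2) := by simp [conjVec]
  rw [this, cd_rc_conjVec hρ.smAt.differentiableAt]
  simp

theorem mem_cH (hρ : IsDefiningFunction M p ρ) (hp : p ∈ M) {v : CVec n} :
    v ∈ cH M p ↔ cd (rc ρ) p (v.1, 0) = 0 ∧ cd (rc ρ) p (0, v.2) = 0 := by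
  rw [cH, Submodule.mem_sup]
  constructor
  · rintro ⟨y, hy, z, hz, rfl⟩
    rw [mem_H10 hρ hp] at hy
    rw [mem_H01 hρ hp] at hz
    simp only [Prod.fst_add, Prod.snd_add, hy.1, hz.1, add_zero, zero_add]
    exact ⟨hy.2, hz.2⟩
  · rintro ⟨h1, h2⟩
    exact ⟨(v.1, 0), (mem_H10 hρ hp).2 ⟨rfl, h1⟩, (0, v.2), (mem_H01 hρ hp).2 ⟨rfl, h2⟩, by simp⟩

theorem H10_le_cH : H10 M p ≤ cH M p := le_sup_left
theorem H01_le_cH : H01 M p ≤ cH M p := le_sup_right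

theorem cH_le_cT (hρ : IsDefiningFunction M p ρ) (hp : p ∈ M) : cH M p ≤ cT M p := by
  intro v hv
  rw [mem_cH hρ hp] at hv
  rw [mem_cT hρ hp]
  have : v = (v.1, 0) + (0, v.2) := by simp
  rw [this, map_add, hv.1, hv.2, add_zero]

/-- For tangent vectors, lying in `ℂH` is a condition on the `(1,0)` part only. -/
theorem mem_cH_of_mem_cT (hρ : IsDefiningFunction M p ρ) (hp : p ∈ M) {v : CVec n}
    (hv : v ∈ cT M p) : v ∈ cH M p ↔ cd (rc ρ) p (v.1, 0) = 0 := by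
  rw [mem_cH hρ hp, and_iff_left_of_imp]
  intro h
  rw [mem_cT hρ hp] at hv
  have : v = (v.1, 0) + (0, v.2) := by simp
  rwa [this, map_add, h, zero_add] at hv

theorem eventually_nhdsWithin_defining (hρ : IsDefiningFunction M p ρ) :
    ∀ᶠ x in 𝓝[M] p, x ∈ M ∧ IsDefiningFunction M x ρ :=
  Filter.Eventually.and self_mem_nhdsWithin (hρ.eventually.filter_mono nhdsWithin_le_nhds)

/-- A function vanishing on `M` has vanishing derivatives in tangential directions. -/
theorem cd_eq_zero_of_mem_cT (hρ : IsDefiningFunction M p ρ) (hp : p ∈ M)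
    {F : Cn n → ℂ} (hF : SmAt F p) (h0 : ∀ᶠ x in 𝓝[M] p, F x = 0) {v : CVec n}
    (hv : v ∈ cT M p) : cd F p v = 0 := by
  obtain ⟨c, hc⟩ := cd_eq_smul_of_eventually_eq_zero hρ hp hF h0
  rw [hc, smul_apply, (mem_cT hρ hp).1 hv, smul_zero]

theorem eventually_cd_eq_zero (hρ : IsDefiningFunction M p ρ)
    {F : Cn n → ℂ} (hF : SmAt F p) (h0 : ∀ᶠ x in 𝓝[M] p, F x = 0) :
    ∀ᶠ x in 𝓝[M] p, ∀ v ∈ cT M x, cd F x v = 0 := by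
  filter_upwards [eventually_nhdsWithin_defining hρ, hF.eventually.filter_mono nhdsWithin_le_nhds,
    eventually_eventually_nhdsWithin.2 h0] with x hx hFx h0x v hv
  exact cd_eq_zero_of_mem_cT hx.2 hx.1 hFx h0x hv

/-- Two functions that agree on `M` have the same derivatives in tangential directions. -/
theorem cd_eq_of_mem_cT (hρ : IsDefiningFunction M p ρ) (hp : p ∈ M)
    {F G : Cn n → ℂ} (hF : SmAt F p) (hG : SmAt G p) (h0 : ∀ᶠ x in 𝓝[M] p, F x = G x)
    {v : CVec n} (hv : v ∈ cT M p) : cd F p v = cd G p v := by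
  have := cd_eq_zero_of_mem_cT hρ hp (hF.sub hG) (by
    filter_upwards [h0] with x hx; rw [hx, sub_self]) hv
  rw [cd_sub hF.differentiableAt hG.differentiableAt] at this
  exact sub_eq_zero.1 this

/-- The projection of complex tangent vectors to their `(1,0)` part. -/
def P10 (n : ℕ) : CVec n →L[ℂ] CVec n :=
  (ContinuousLinearMap.inl ℂ (Cn n) (Cn n)).comp (ContinuousLinearMap.fst ℂ (Cn n) (Cn n))

/-- The projection of complex tangent vectors to their `(0,1)` part. -/
def P01 (n : ℕ) : CVec n →L[ℂ] CVec n :=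
  (ContinuousLinearMap.inr ℂ (Cn n) (Cn n)).comp (ContinuousLinearMap.snd ℂ (Cn n) (Cn n))

@[simp] theorem P10_apply (v : CVec n) : P10 n v = (v.1, 0) := rfl
@[simp] theorem P01_apply (v : CVec n) : P01 n v = (0, v.2) := rfl

theorem P10_add_P01 (v : CVec n) : P10 n v + P01 n v = v := by simp

theorem exists_cd_ne_zero (hρ : IsDefiningFunction M p ρ) :
    ∃ a : Cn n, cd (rc ρ) p (a, 0) ≠ 0 := by
  by_contra! h
  refine hρ.fderiv_ne_zero (ContinuousLinearMap.ext fun X => ?_)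
  have h1 : cd (rc ρ) p (0, star X) = 0 := by
    have := cd_rc_conjVec hρ.smAt.differentiableAt (X, 0)
    rw [h X] at this
    simpa [conjVec] using this
  have h2 := cd_rc_real hρ.smAt.differentiableAt X
  have : ((X, star X) : CVec n) = (X, 0) + (0, star X) := by simp
  rw [this, map_add, h, h1, add_zero] at h2
  exact_mod_cast h2.symm

/-- The contact form `i ∂ρ`. -/
def theta0 (ρ : Cn n → ℝ) : Cn n → Cn n →L[ℝ] ℂ := fun x =>
  (Complex.I • (cd (rc ρ) x).comp (ContinuousLinearMap.inl ℂ (Cn n) (Cn n))).restrictScalars ℝ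

theorem cExt_theta0 (x : Cn n) (v : CVec n) :
    cExt (theta0 ρ x) v = Complex.I * cd (rc ρ) x (v.1, 0) := by
  rw [theta0, cExt_restrictScalars]; rfl

theorem smAt_theta0 (h : SmAt ρ p) : SmAt (theta0 ρ) p := by
  have h1 : SmAt (fun x => (Complex.I • (ContinuousLinearMap.compL ℂ (Cn n) (CVec n) ℂ).flip
      (ContinuousLinearMap.inl ℂ (Cn n) (Cn n))) (cd (rc ρ) x)) p :=
    SmAt.clmC (G := Cn n →L[ℂ] ℂ) _ h.rc.cd
  exact SmAt.clm (G := Cn n →L[ℝ] ℂ) (ContinuousLinearMap.restrictScalarsL ℂ (Cn n) ℂ ℝ ℝ) h1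

theorem isContactForm_theta0 (hρ : IsDefiningFunction M p ρ) : IsContactForm M p (theta0 ρ) := by
  obtain ⟨U, hU, hp, hs, hd⟩ := (smAt_theta0 hρ.smAt).exists_contDiffOn hρ.eventually
  refine ⟨U, hU, hp, hs, fun x hx => ⟨fun v hv => ?_, fun X hX => ?_⟩⟩
  · rw [cExt_theta0, ((mem_cH (hd x hx.1) hx.2).1 hv).1, mul_zero]
  · have h1 := (mem_cT (hd x hx.1) hx.2).1 hX
    have h2 := cd_rc_conjVec (hd x hx.1).smAt.differentiableAt (X, 0)
    have h3 : ((X, star X) : CVec n) = (X, 0) + conjVec n (X, 0) := by simp [conjVec]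
    rw [h3, map_add, h2] at h1
    have h4 : theta0 ρ x X = Complex.I * cd (rc ρ) x (X, 0) := rfl
    rw [h4]
    have h5 := congrArg Complex.re h1
    simp at h5
    simp
    linarith

theorem IsContactForm.smAt {θ : Cn n → Cn n →L[ℝ] ℂ} (h : IsContactForm M p θ) : SmAt θ p := by
  obtain ⟨U, hU, hp, hs, -⟩ := h
  exact smAt_of_contDiffOn hU hp hs

theorem IsContactForm.eventually_cH {θ : Cn n → Cn n →L[ℝ] ℂ} (h : IsContactForm M p θ) :
    ∀ᶠ x in 𝓝[M] p, ∀ v ∈ cH M x, cExt (θ x) v = 0 := by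
  obtain ⟨U, hU, hp, hs, hc⟩ := h
  rw [eventually_nhdsWithin_iff]
  filter_upwards [hU.mem_nhds hp] with x hx hxM using (hc x ⟨hx, hxM⟩).1

theorem IsSection.smAt {V : Cn n → Submodule ℂ (CVec n)} {ξ : Cn n → CVec n}
    (h : IsSection M p V ξ) : SmAt ξ p := by
  obtain ⟨U, hU, hp, hs, -⟩ := h
  exact smAt_of_contDiffOn hU hp hs

theorem IsSection.eventually_mem {V : Cn n → Submodule ℂ (CVec n)} {ξ : Cn n → CVec n}
    (h : IsSection M p V ξ) : ∀ᶠ x in 𝓝[M] p, ξ x ∈ V x := by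
  obtain ⟨U, hU, hp, hs, hc⟩ := h
  rw [eventually_nhdsWithin_iff]
  filter_upwards [hU.mem_nhds hp] with x hx hxM using hc x ⟨hx, hxM⟩

theorem IsSection.mono {V W : Cn n → Submodule ℂ (CVec n)} {ξ : Cn n → CVec n}
    (h : IsSection M p V ξ) (hVW : ∀ x, V x ≤ W x) : IsSection M p W ξ := by
  obtain ⟨U, hU, hp, hs, hc⟩ := h
  exact ⟨U, hU, hp, hs, fun x hx => hVW x (hc x hx)⟩

/-- Every contact form is a multiple of `i ∂ρ` along `M`. -/
theorem IsContactForm.exists_factor (hρ : IsDefiningFunction M p ρ) {θ : Cn n → Cn n →L[ℝ] ℂ}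
    (h : IsContactForm M p θ) : ∃ f : Cn n → ℂ, SmAt f p ∧ ∀ᶠ x in 𝓝[M] p, ∀ u ∈ cT M x,
      cExt (θ x) u = f x * (Complex.I * cd (rc ρ) x (u.1, 0)) := by
  obtain ⟨a, ha⟩ := exists_cd_ne_zero hρ
  have hg := hρ.smAt.rc.cd
  have hga : SmAt (fun x => cd (rc ρ) x (a, 0)) p := hg.clmC_apply (smAt_const _)
  have hgb : SmAt (fun x => cd (rc ρ) x (0, star a)) p := hg.clmC_apply (smAt_const _)
  have hb : ∀ x, DifferentiableAt ℝ ρ x → cd (rc ρ) x (a, 0) ≠ 0 →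
      cd (rc ρ) x (0, star a) ≠ 0 := by
    intro x hx hax
    have := cd_rc_conjVec hx (a, 0)
    have h3 : ((0, star a) : CVec n) = conjVec n (a, 0) := by simp [conjVec]
    rw [h3, this]
    simpa using hax
  have hbp := hb p hρ.smAt.differentiableAt ha
  -- a vector field transverse to `ℂH` on which `i ∂ρ` is one
  let T : Cn n → CVec n := fun x => (-Complex.I * (cd (rc ρ) x (a, 0))⁻¹) • ((a, 0) : CVec n) +
    (Complex.I * (cd (rc ρ) x (0, star a))⁻¹) • ((0, star a) : CVec n)
  have hT : SmAt T p := (((smAt_const _).mul (hga.inv ha)).smul (smAt_const _)).add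
    (((smAt_const _).mul (hgb.inv hbp)).smul (smAt_const _))
  refine ⟨fun x => cExt (θ x) (T x), h.smAt.cExtL.clmC_apply hT, ?_⟩
  filter_upwards [eventually_nhdsWithin_defining hρ, h.eventually_cH,
    (hga.continuousAt.eventually_ne ha).filter_mono nhdsWithin_le_nhds] with x hx hcH hax u hu
  have hbx := hb x hx.2.smAt.differentiableAt hax
  have hTT : T x ∈ cT M x := by
    rw [mem_cT hx.2 hx.1]
    simp only [T, map_add, map_smul, smul_eq_mul]
    field_simp
    ring
  have hT1 : Complex.I * cd (rc ρ) x ((T x).1, 0) = 1 := by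
    have : (((T x).1, 0) : CVec n) = (-Complex.I * (cd (rc ρ) x (a, 0))⁻¹) • ((a, 0) : CVec n) := by
      simp [T]
    rw [this, map_smul, smul_eq_mul]
    field_simp
    simp
  set t := Complex.I * cd (rc ρ) x (u.1, 0) with ht
  have hmem : u - t • T x ∈ cH M x := by
    rw [mem_cH_of_mem_cT hx.2 hx.1 ((cT M x).sub_mem hu ((cT M x).smul_mem _ hTT))]
    have : (((u - t • T x).1, 0) : CVec n) = (u.1, 0) - t • ((T x).1, 0) := by simp
    rw [this, map_sub, map_smul, smul_eq_mul]
    have h2 : Complex.I * (cd (rc ρ) x (u.1, 0) - t * cd (rc ρ) x ((T x).1, 0)) = 0 := by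
      linear_combination (-t) * hT1
    exact (mul_eq_zero.1 h2).resolve_left Complex.I_ne_zero
  have := hcH _ hmem
  rw [map_sub, map_smul, smul_eq_mul, sub_eq_zero] at this
  rw [this]; ring

/-! ### Sections through given vectors -/

/-- The projection of the constant field `v` along the constant field `c` is tangent to the level
sets of `ρ`. If `v` and `c` are both of type `(1,0)`, or both of type `(0,1)`, so is the resulting
field. -/
theorem exists_section_aux (hρ : IsDefiningFunction M p ρ) {c v : CVec n}
    (hc : cd (rc ρ) p c ≠ 0) (hv : cd (rc ρ) p v = 0) :
    ∃ ξ : Cn n → CVec n, SmAt ξ p ∧ ξ p = v ∧ (∀ x, ∃ t : ℂ, ξ x = v - t • c) ∧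
      ∀ᶠ x in 𝓝 p, cd (rc ρ) x (ξ x) = 0 := by
  have hg := hρ.smAt.rc.cd
  have hgc : SmAt (fun x => cd (rc ρ) x c) p := hg.clmC_apply (smAt_const _)
  have hgv : SmAt (fun x => cd (rc ρ) x v) p := hg.clmC_apply (smAt_const _)
  refine ⟨fun x => v - (cd (rc ρ) x v * (cd (rc ρ) x c)⁻¹) • c,
    (smAt_const _).sub ((hgv.mul (hgc.inv hc)).smul (smAt_const _)), by simp [hv],
    fun x => ⟨_, rfl⟩, ?_⟩
  filter_upwards [hgc.continuousAt.eventually_ne hc] with x hx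
  simp [hx]

theorem exists_section_cT (hρ : IsDefiningFunction M p ρ) (hp : p ∈ M) {v : CVec n}
    (hv : v ∈ cT M p) : ∃ ξ, IsSection M p (cT M) ξ ∧ ξ p = v := by
  obtain ⟨a, ha⟩ := exists_cd_ne_zero hρ
  obtain ⟨ξ, hs, h1, -, h3⟩ := exists_section_aux hρ ha ((mem_cT hρ hp).1 hv)
  obtain ⟨U, hU, hpU, hsU, h⟩ := hs.exists_contDiffOn (h3.and hρ.eventually)
  exact ⟨ξ, ⟨U, hU, hpU, hsU, fun x hx => (mem_cT (h x hx.1).2 hx.2).2 (h x hx.1).1⟩, h1⟩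

theorem exists_section_H10 (hρ : IsDefiningFunction M p ρ) (hp : p ∈ M) {v : CVec n}
    (hv : v ∈ H10 M p) : ∃ ξ, IsSection M p (H10 M) ξ ∧ ξ p = v := by
  obtain ⟨a, ha⟩ := exists_cd_ne_zero hρ
  rw [mem_H10 hρ hp] at hv
  have hv2 : v = (v.1, 0) := by rw [← hv.1]
  obtain ⟨ξ, hs, h1, h2, h3⟩ := exists_section_aux hρ ha (v := v) (by rw [hv2]; exact hv.2)
  obtain ⟨U, hU, hpU, hsU, h⟩ := hs.exists_contDiffOn (h3.and hρ.eventually)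
  refine ⟨ξ, ⟨U, hU, hpU, hsU, fun x hx => (mem_H10 (h x hx.1).2 hx.2).2 ?_⟩, h1⟩
  have hx2 : (ξ x).2 = 0 := by
    obtain ⟨t, ht⟩ := h2 x
    simp [ht, hv.1]
  exact ⟨hx2, by rw [← hx2]; exact (h x hx.1).1⟩

theorem exists_section_H01 (hρ : IsDefiningFunction M p ρ) (hp : p ∈ M) {v : CVec n}
    (hv : v ∈ H01 M p) : ∃ ξ, IsSection M p (H01 M) ξ ∧ ξ p = v := by
  obtain ⟨a, ha⟩ := exists_cd_ne_zero hρ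
  have hb : cd (rc ρ) p (0, star a) ≠ 0 := by
    have := cd_rc_conjVec hρ.smAt.differentiableAt (a, 0)
    have h3 : ((0, star a) : CVec n) = conjVec n (a, 0) := by simp [conjVec]
    rw [h3, this]
    simpa using ha
  rw [mem_H01 hρ hp] at hv
  have hv2 : v = (0, v.2) := by rw [← hv.1]
  obtain ⟨ξ, hs, h1, h2, h3⟩ := exists_section_aux hρ hb (v := v) (by rw [hv2]; exact hv.2)
  obtain ⟨U, hU, hpU, hsU, h⟩ := hs.exists_contDiffOn (h3.and hρ.eventually)
  refine ⟨ξ, ⟨U, hU, hpU, hsU, fun x hx => (mem_H01 (h x hx.1).2 hx.2).2 ?_⟩, h1⟩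
  have hx2 : (ξ x).1 = 0 := by
    obtain ⟨t, ht⟩ := h2 x
    simp [ht, hv.1]
  exact ⟨hx2, by rw [← hx2]; exact (h x hx.1).1⟩

theorem IsSection.add {V : Cn n → Submodule ℂ (CVec n)} {ξ η : Cn n → CVec n}
    (h : IsSection M p V ξ) (h' : IsSection M p V η) : IsSection M p V (fun x => ξ x + η x) := by
  obtain ⟨U, hU, hp, hs, hc⟩ := h
  obtain ⟨U', hU', hp', hs', hc'⟩ := h'
  exact ⟨U ∩ U', hU.inter hU', ⟨hp, hp'⟩,
    (hs.mono Set.inter_subset_left).add (hs'.mono Set.inter_subset_right),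
    fun x hx => (V x).add_mem (hc x ⟨hx.1.1, hx.2⟩) (hc' x ⟨hx.1.2, hx.2⟩)⟩

theorem exists_section_cH (hρ : IsDefiningFunction M p ρ) (hp : p ∈ M) {v : CVec n}
    (hv : v ∈ cH M p) : ∃ ξ, IsSection M p (cH M) ξ ∧ ξ p = v := by
  obtain ⟨y, hy, z, hz, rfl⟩ := Submodule.mem_sup.1 hv
  obtain ⟨ξ, hξ, rfl⟩ := exists_section_H10 hρ hp hy
  obtain ⟨η, hη, rfl⟩ := exists_section_H01 hρ hp hz
  exact ⟨_, (hξ.mono fun _ => H10_le_cH).add (hη.mono fun _ => H01_le_cH), rfl⟩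

end

/-! ### Brackets and Lie derivatives of contact forms -/

section

variable {n : ℕ} {M : Set (Cn n)} {p : Cn n} {ρ : Cn n → ℝ}

/-- The alternating two-form `∂∂̄ρ = i d(i ∂ρ)`: the complex Hessian of `ρ` in the `(1,0)` part of
one and the `(0,1)` part of the other argument, antisymmetrised. -/
def leviAlt (ρ : Cn n → ℝ) (x : Cn n) (v w : CVec n) : ℂ :=
  cd (cd (rc ρ)) x (v.1, 0) (0, w.2) - cd (cd (rc ρ)) x (w.1, 0) (0, v.2)

protected theorem SmAt.leviAlt (h : SmAt ρ p) {ξ η : Cn n → CVec n} (hξ : SmAt ξ p)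
    (hη : SmAt η p) :
    SmAt (fun x => leviAlt ρ x (ξ x) (η x)) p := by
  have hH := h.rc.cd.cd
  have key : ∀ {ξ η : Cn n → CVec n}, SmAt ξ p → SmAt η p →
      SmAt (fun x => cd (cd (rc ρ)) x ((ξ x).1, 0) (0, (η x).2)) p := fun h1 h2 =>
    SmAt.clmC_apply (hH.clmC_apply (h1.clmC (P10 n))) (h2.clmC (P01 n))
  exact (key hξ hη).sub (key hη hξ)

/-- The derivative of the condition `⟨dρ, ξ⟩ = 0`, which holds along `M`, in tangential directions.
-/
theorem IsSection.tangency {ξ : Cn n → CVec n} (hρ : IsDefiningFunction M p ρ)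
    (hξ : IsSection M p (cT M) ξ) :
    ∀ᶠ x in 𝓝[M] p, ∀ v ∈ cT M x,
      cd (cd (rc ρ)) x v (ξ x) + cd (rc ρ) x (cd ξ x v) = 0 := by
  have hg := hρ.smAt.rc.cd
  have h0 : ∀ᶠ x in 𝓝[M] p, cd (rc ρ) x (ξ x) = 0 := by
    filter_upwards [hξ.eventually_mem, eventually_nhdsWithin_defining hρ] with x hx hd
    exact (mem_cT hd.2 hd.1).1 hx
  filter_upwards [eventually_cd_eq_zero hρ (hg.clmC_apply hξ.smAt) h0,
    hg.eventually.filter_mono nhdsWithin_le_nhds,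
    hξ.smAt.eventually.filter_mono nhdsWithin_le_nhds] with x hx h1 h2 v hv
  rw [← cd_clm_apply h1.differentiableAt h2.differentiableAt]
  exact hx v hv

/-- The bracket of two tangential vector fields is tangential. -/
theorem IsSection.bracket_mem_cT {ξ η : Cn n → CVec n} (hρ : IsDefiningFunction M p ρ)
    (hξ : IsSection M p (cT M) ξ) (hη : IsSection M p (cT M) η) :
    ∀ᶠ x in 𝓝[M] p, bracket ξ η x ∈ cT M x := by
  filter_upwards [hξ.tangency hρ, hη.tangency hρ, hξ.eventually_mem, hη.eventually_mem,
    eventually_nhdsWithin_defining hρ] with x h1 h2 h3 h4 hd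
  rw [mem_cT hd.2 hd.1, bracket_apply, map_sub]
  have hs := cd_cd_symm hd.2.smAt.rc.contDiffAt (ξ x) (η x)
  linear_combination h2 _ h3 - h1 _ h4 - hs

/-- The derivative of the condition `⟨∂ρ, ξ⟩ = 0`, which holds along `M` for sections of `ℂH`, in
tangential directions. -/
theorem IsSection.tangency10 {ξ : Cn n → CVec n} (hρ : IsDefiningFunction M p ρ)
    (hξ : IsSection M p (cH M) ξ) :
    ∀ᶠ x in 𝓝[M] p, ∀ v ∈ cT M x,
      cd (cd (rc ρ)) x v ((ξ x).1, 0) + cd (rc ρ) x ((cd ξ x v).1, 0) = 0 := by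
  have hg := hρ.smAt.rc.cd
  have hξ10 : SmAt (fun x => P10 n (ξ x)) p := hξ.smAt.clmC (P10 n)
  have h0 : ∀ᶠ x in 𝓝[M] p, cd (rc ρ) x (P10 n (ξ x)) = 0 := by
    filter_upwards [hξ.eventually_mem, eventually_nhdsWithin_defining hρ] with x hx hd
    exact ((mem_cH hd.2 hd.1).1 hx).1
  filter_upwards [eventually_cd_eq_zero hρ (hg.clmC_apply hξ10) h0,
    hg.eventually.filter_mono nhdsWithin_le_nhds, hξ10.eventually.filter_mono nhdsWithin_le_nhds,
    hξ.smAt.eventually.filter_mono nhdsWithin_le_nhds] with x hx h1 h2 h3 v hv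
  have := hx v hv
  rw [cd_clm_apply h1.differentiableAt h2.differentiableAt, cd_clm_comp _ h3.differentiableAt]
    at this
  exact this

/-- The Levi form measures the transverse component of brackets. -/
theorem IsSection.cd_bracket {ξ η : Cn n → CVec n} (hρ : IsDefiningFunction M p ρ)
    (hξ : IsSection M p (cH M) ξ) (hη : IsSection M p (cH M) η) :
    ∀ᶠ x in 𝓝[M] p, bracket ξ η x ∈ cT M x ∧
      cd (rc ρ) x ((bracket ξ η x).1, 0) = leviAlt ρ x (ξ x) (η x) := by
  have sub : ∀ {ζ}, IsSection M p (cH M) ζ → ∀ᶠ x in 𝓝[M] p, ζ x ∈ cT M x := fun h => by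
    filter_upwards [h.eventually_mem, eventually_nhdsWithin_defining hρ] with x hx hd
    exact cH_le_cT hd.2 hd.1 hx
  have toT : ∀ {ζ}, IsSection M p (cH M) ζ → IsSection M p (cT M) ζ := fun h => by
    obtain ⟨U, hU, hp, hs, hc⟩ := h
    obtain ⟨V, hV, hVo, hpV⟩ := eventually_nhds_iff.1 hρ.eventually
    exact ⟨U ∩ V, hU.inter hVo, ⟨hp, hpV⟩, hs.mono Set.inter_subset_left,
      fun x hx => cH_le_cT (hV x hx.1.2) hx.2 (hc x ⟨hx.1.1, hx.2⟩)⟩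
  filter_upwards [(toT hξ).bracket_mem_cT hρ (toT hη), hξ.tangency10 hρ, hη.tangency10 hρ,
    sub hξ, sub hη, eventually_nhdsWithin_defining hρ] with x hb h1 h2 h3 h4 hd
  refine ⟨hb, ?_⟩
  have e : (((bracket ξ η x).1, 0) : CVec n) =
      ((cd η x (ξ x)).1, 0) - ((cd ξ x (η x)).1, 0) := by
    simp [bracket_apply]
  have hs := fun v w => cd_cd_symm hd.2.smAt.rc.contDiffAt v w
  have a1 := h2 _ h3
  have a2 := h1 _ h4
  rw [← P10_add_P01 (ξ x), map_add, add_apply, P10_add_P01] at a1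
  rw [← P10_add_P01 (η x), map_add, add_apply, P10_add_P01] at a2
  simp only [P10_apply, P01_apply] at a1 a2
  rw [e, map_sub, leviAlt]
  linear_combination a1 - a2 - hs ((ξ x).1, 0) ((η x).1, 0) - hs ((ξ x).1, 0) (0, (η x).2) +
    hs ((η x).1, 0) (0, (ξ x).2)

/-- The pairing of the contact form `f · i ∂ρ` with a bracket. -/
theorem pairing_bracket {θ : Cn n → Cn n →L[ℝ] ℂ} {f : Cn n → ℂ} {ξ η : Cn n → CVec n}
    (hρ : IsDefiningFunction M p ρ)
    (hf : ∀ᶠ x in 𝓝[M] p, ∀ u ∈ cT M x,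
      cExt (θ x) u = f x * (Complex.I * cd (rc ρ) x (u.1, 0)))
    (hξ : IsSection M p (cH M) ξ) (hη : IsSection M p (cH M) η) :
    ∀ᶠ x in 𝓝[M] p, pairing θ (bracket ξ η) x =
      f x * (Complex.I * leviAlt ρ x (ξ x) (η x)) := by
  filter_upwards [hξ.cd_bracket hρ hη, hf] with x h1 h2
  rw [← h1.2]
  exact h2 _ h1.1

theorem cd_mul_of_eq_zero {f g : Cn n → ℂ} {x : Cn n} (hf : SmAt f x)
    (hg : SmAt g x) (h0 : g x = 0) (c : ℂ) (v : CVec n) :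
    cd (fun y => f y * (c * g y)) x v = f x * (c * cd g x v) := by
  rw [cd_mul hf.differentiableAt ((smAt_const c).mul hg).differentiableAt,
    cd_mul (differentiableAt_const c) hg.differentiableAt, h0, cd_const]
  simp

/-- The derivative of the pairing of a contact form with a bracket. Where the Levi form vanishes,
the factor `f` relating the contact form to `i ∂ρ` is not differentiated. -/
theorem der_pairing_bracket {θ : Cn n → Cn n →L[ℝ] ℂ} {f : Cn n → ℂ} {ξ η : Cn n → CVec n}
    (hρ : IsDefiningFunction M p ρ) (hp : p ∈ M) (hθ : SmAt θ p) (hfs : SmAt f p)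
    (hf : ∀ᶠ x in 𝓝[M] p, ∀ u ∈ cT M x,
      cExt (θ x) u = f x * (Complex.I * cd (rc ρ) x (u.1, 0)))
    (hξ : IsSection M p (cH M) ξ) (hη : IsSection M p (cH M) η)
    (h0 : leviAlt ρ p (ξ p) (η p) = 0) {v : CVec n} (hv : v ∈ cT M p) :
    cd (pairing θ (bracket ξ η)) p v =
      f p * (Complex.I * cd (fun x => leviAlt ρ x (ξ x) (η x)) p v) := by
  have hl := hρ.smAt.leviAlt hξ.smAt hη.smAt
  rw [cd_eq_of_mem_cT hρ hp (hθ.pairing (hξ.smAt.bracket hη.smAt))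
    (hfs.mul ((smAt_const Complex.I).mul hl)) (pairing_bracket hρ hf hξ hη) hv]
  exact cd_mul_of_eq_zero hfs hl h0 _ _

/-- For sections of `ℂH`, `⟨𝒯_ξ θ, η⟩ = dθ(ξ, η) = -⟨θ, [ξ, η]⟩` along `M`. -/
theorem pairing_lieD {θ : Cn n → Cn n →L[ℝ] ℂ} {f : Cn n → ℂ} {ξ η : Cn n → CVec n}
    (hρ : IsDefiningFunction M p ρ) (hθ : IsContactForm M p θ)
    (hf : ∀ᶠ x in 𝓝[M] p, ∀ u ∈ cT M x,
      cExt (θ x) u = f x * (Complex.I * cd (rc ρ) x (u.1, 0)))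
    (hξ : IsSection M p (cH M) ξ) (hη : IsSection M p (cH M) η) :
    ∀ᶠ x in 𝓝[M] p, pairing (lieD ξ θ) η x =
      f x * (-Complex.I * leviAlt ρ x (ξ x) (η x)) := by
  have h0 : ∀ᶠ x in 𝓝[M] p, pairing θ η x = 0 := by
    filter_upwards [hθ.eventually_cH, hη.eventually_mem] with x h1 h2 using h1 _ h2
  filter_upwards [eventually_nhdsWithin_defining hρ, pairing_bracket hρ hf hξ hη,
    eventually_cd_eq_zero hρ (hθ.smAt.pairing hη.smAt) h0, hξ.eventually_mem,
    hθ.smAt.eventually.filter_mono nhdsWithin_le_nhds,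
    hξ.smAt.eventually.filter_mono nhdsWithin_le_nhds,
    hη.smAt.eventually.filter_mono nhdsWithin_le_nhds] with x hd h1 h2 h3 h4 h5 h6
  have := cExt_lieD_eq h4 h5 h6
  rw [pairing, this, h1, h2 _ (cH_le_cT hd.2 hd.1 h3)]
  ring

/-- Two successive Lie derivatives of a contact form. -/
theorem cExt_lieD_lieD_contact {θ : Cn n → Cn n →L[ℝ] ℂ} {f : Cn n → ℂ}
    {ξ3 ξ2 ξ1 : Cn n → CVec n} (hρ : IsDefiningFunction M p ρ) (hp : p ∈ M)
    (hθ : IsContactForm M p θ) (hfs : SmAt f p)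
    (hf : ∀ᶠ x in 𝓝[M] p, ∀ u ∈ cT M x,
      cExt (θ x) u = f x * (Complex.I * cd (rc ρ) x (u.1, 0)))
    (h3 : IsSection M p (cH M) ξ3) (h2 : IsSection M p (cH M) ξ2) (h1 : IsSection M p (cH M) ξ1)
    (h31 : leviAlt ρ p (ξ3 p) (ξ1 p) = 0) (h21 : leviAlt ρ p (ξ2 p) (ξ1 p) = 0) :
    cExt (lieD ξ3 (lieD ξ2 θ) p) (ξ1 p) =
      f p * (-Complex.I * (cd (fun x => leviAlt ρ x (ξ2 x) (ξ1 x)) p (ξ3 p) -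
        leviAlt ρ p (ξ2 p) (bracket ξ3 ξ1 p))) := by
  have hl := hρ.smAt.leviAlt h2.smAt h1.smAt
  have hb := (h3.cd_bracket hρ h1).self_of_nhdsWithin hp
  have hZ : bracket ξ3 ξ1 p ∈ cH M p :=
    (mem_cH_of_mem_cT hρ hp hb.1).2 (hb.2.trans h31)
  obtain ⟨ζ, hζ, hζp⟩ := exists_section_cH hρ hp hZ
  have e1 := (pairing_lieD hρ hθ hf h2 hζ).self_of_nhdsWithin hp
  have hv : ξ3 p ∈ cT M p := cH_le_cT hρ hp (h3.eventually_mem.self_of_nhdsWithin hp)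
  rw [cExt_lieD_lieD hθ.smAt h3.smAt h2.smAt h1.smAt,
    cd_eq_of_mem_cT hρ hp ((hθ.smAt.lieD h2.smAt).pairing h1.smAt)
      (hfs.mul ((smAt_const (-Complex.I)).mul hl)) (pairing_lieD hρ hθ hf h2 h1) hv,
    cd_mul_of_eq_zero hfs hl h21]
  rw [pairing, hζp] at e1
  rw [e1]
  ring

/-! ### The complex normal space and the Levi form -/

/-- The functional on `ℂT_p` given by the contact form `i ∂ρ`. -/
def thetaT (M : Set (Cn n)) (p : Cn n) (ρ : Cn n → ℝ) : cT M p →ₗ[ℂ] ℂ :=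
  (Complex.I • ((cd (rc ρ) p : CVec n →ₗ[ℂ] ℂ).comp (P10 n : CVec n →ₗ[ℂ] CVec n))).comp
    (cT M p).subtype

theorem thetaT_apply (u : cT M p) :
    thetaT M p ρ u = Complex.I * cd (rc ρ) p ((u : CVec n).1, 0) := rfl

theorem thetaT_eq_zero_iff (hρ : IsDefiningFunction M p ρ) (hp : p ∈ M) (u : cT M p) :
    thetaT M p ρ u = 0 ↔ (u : CVec n) ∈ cH M p := by
  rw [mem_cH_of_mem_cT hρ hp u.2, thetaT_apply]
  simp

theorem thetaT_surjective (hρ : IsDefiningFunction M p ρ) (hp : p ∈ M) :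
    Function.Surjective (thetaT M p ρ) := by
  obtain ⟨a, ha⟩ := exists_cd_ne_zero hρ
  have hb : cd (rc ρ) p (0, star a) ≠ 0 := by
    have := cd_rc_conjVec hρ.smAt.differentiableAt (a, 0)
    have h3 : ((0, star a) : CVec n) = conjVec n (a, 0) := by simp [conjVec]
    rw [h3, this]
    simpa using ha
  intro c
  set t := c * (-Complex.I * (cd (rc ρ) p (a, 0))⁻¹) with ht
  set s := -(t * cd (rc ρ) p (a, 0)) * (cd (rc ρ) p (0, star a))⁻¹ with hs
  refine ⟨⟨t • ((a, 0) : CVec n) + s • ((0, star a) : CVec n), ?_⟩, ?_⟩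
  · rw [mem_cT hρ hp, map_add, map_smul, map_smul, hs]
    simp only [smul_eq_mul]
    field_simp
    ring
  · rw [thetaT_apply]
    have : (((t • ((a, 0) : CVec n) + s • ((0, star a) : CVec n)).1, 0) : CVec n) =
      t • ((a, 0) : CVec n) := by simp
    rw [this, map_smul, smul_eq_mul, ht]
    field_simp
    linear_combination (-c) * Complex.I_sq

/-- The contact form `i ∂ρ` as an isomorphism of `ℂQ_p` with `ℂ`. -/
def thetaQ (hρ : IsDefiningFunction M p ρ) (hp : p ∈ M) : cQ M p ≃ₗ[ℂ] ℂ :=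
  LinearEquiv.ofBijective
    (((cH M p).submoduleOf (cT M p)).liftQ (thetaT M p ρ) (fun u hu => by
      rw [LinearMap.mem_ker, thetaT_eq_zero_iff hρ hp]; exact hu)) (by
    constructor
    · rw [← LinearMap.ker_eq_bot, Submodule.ker_liftQ_eq_bot']
      ext u
      rw [LinearMap.mem_ker, thetaT_eq_zero_iff hρ hp]; rfl
    · intro c
      obtain ⟨u, hu⟩ := thetaT_surjective hρ hp c
      exact ⟨toQ M p u, hu⟩)

@[simp]
theorem thetaQ_toQ (hρ : IsDefiningFunction M p ρ) (hp : p ∈ M) (u : cT M p) :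
    thetaQ hρ hp (toQ M p u) = Complex.I * cd (rc ρ) p ((u : CVec n).1, 0) := rfl

theorem eq_toQ_iff (hρ : IsDefiningFunction M p ρ) (hp : p ∈ M) (t : cQ M p) (u : cT M p) :
    t = toQ M p u ↔ thetaQ hρ hp t = Complex.I * cd (rc ρ) p ((u : CVec n).1, 0) := by
  rw [← thetaQ_toQ hρ hp, (thetaQ hρ hp).injective.eq_iff]

/-- The pairing of a class in `ℂQ_p` with a contact form that is `f` times `i ∂ρ`. -/
theorem pairsTo_iff (hρ : IsDefiningFunction M p ρ) (hp : p ∈ M) {θ : Cn n → Cn n →L[ℝ] ℂ}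
    {f : Cn n → ℂ} (hf : ∀ᶠ x in 𝓝[M] p, ∀ u ∈ cT M x,
      cExt (θ x) u = f x * (Complex.I * cd (rc ρ) x (u.1, 0))) (t : cQ M p) (c : ℂ) :
    PairsTo M p θ t c ↔ f p * thetaQ hρ hp t = c := by
  have hfp := hf.self_of_nhdsWithin hp
  obtain ⟨u, rfl⟩ : ∃ u, toQ M p u = t := Submodule.mkQ_surjective _ t
  constructor
  · intro h
    rw [← h u rfl, hfp _ u.2]; rfl
  · intro h u' hu'
    rw [hfp _ u'.2, ← h, ← hu']; rfl

/-- The contact form `i ∂ρ` is itself with the factor one. -/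
theorem theta0_factor : ∀ᶠ x in 𝓝[M] p, ∀ u ∈ cT M x,
      cExt (theta0 ρ x) u = (fun _ => (1 : ℂ)) x * (Complex.I * cd (rc ρ) x (u.1, 0)) :=
  Filter.Eventually.of_forall fun x u _ => by rw [cExt_theta0, one_mul]

theorem leviAlt_of_H10_H01 {x : Cn n} {v w : CVec n} (hv : v.2 = 0) :
    leviAlt ρ x v w = cd (cd (rc ρ)) x (v.1, 0) (0, w.2) := by
  have h0 : ((0, 0) : CVec n) = 0 := rfl
  rw [leviAlt, hv, h0, map_zero, sub_zero]

/-- A tensor is the Levi form if and only if `i ∂ρ` pairs with it to minus the complex Hessian. -/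
theorem isLeviForm_iff (hρ : IsDefiningFunction M p ρ) (hp : p ∈ M)
    (τ : H10 M p →ₗ[ℂ] H01 M p →ₗ[ℂ] cQ M p) :
    IsLeviForm M p τ ↔ ∀ (v : H10 M p) (w : H01 M p),
      thetaQ hρ hp (τ v w) = -cd (cd (rc ρ)) p (v : CVec n) (w : CVec n) := by
  have hval : ∀ (v : H10 M p) (w : H01 M p),
      leviAlt ρ p v w = cd (cd (rc ρ)) p (v : CVec n) (w : CVec n) := by
    intro v w
    have hv := ((mem_H10 hρ hp).1 v.2).1
    have hw := ((mem_H01 hρ hp).1 w.2).1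
    rw [leviAlt_of_H10_H01 hv]
    have e1 : (((v : CVec n).1, 0) : CVec n) = v := by rw [← hv]
    have e2 : ((0, (w : CVec n).2) : CVec n) = w := by rw [← hw]
    rw [e1, e2]
  constructor
  · intro h v w
    obtain ⟨ξ, hξ, hξp⟩ := exists_section_H10 hρ hp v.2
    obtain ⟨η, hη, hηp⟩ := exists_section_H01 hρ hp w.2
    have := h (theta0 ρ) ξ η (isContactForm_theta0 hρ) hξ hη v w hξp hηp
    rw [pairsTo_iff hρ hp theta0_factor, (pairing_bracket hρ theta0_factor
      (hξ.mono fun _ => H10_le_cH) (hη.mono fun _ => H01_le_cH)).self_of_nhdsWithin hp,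
      hξp, hηp, hval] at this
    linear_combination this + cd (cd (rc ρ)) p (v : CVec n) (w : CVec n) * Complex.I_sq
  · intro h θ ξ η hθ hξ hη v w hξp hηp
    obtain ⟨f, hfs, hf⟩ := hθ.exists_factor hρ
    rw [pairsTo_iff hρ hp hf, (pairing_bracket hρ hf
      (hξ.mono fun _ => H10_le_cH) (hη.mono fun _ => H01_le_cH)).self_of_nhdsWithin hp,
      hξp, hηp, hval, h]
    linear_combination (-f p * cd (cd (rc ρ)) p (v : CVec n) (w : CVec n)) * Complex.I_sq

/-- The restriction of a bilinear form to subspaces, with values in a given space. -/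
def restr2 {Q : Type*} [AddCommGroup Q] [Module ℂ Q] (B : CVec n →L[ℂ] CVec n →L[ℂ] ℂ)
    (S1 S2 : Submodule ℂ (CVec n)) (ι : ℂ →ₗ[ℂ] Q) : S1 →ₗ[ℂ] S2 →ₗ[ℂ] Q :=
  LinearMap.mk₂ ℂ (fun v w => ι (B v w)) (by intros; simp)
    (fun c v w => by simp only [Submodule.coe_smul, map_smul, smul_apply])
    (by intros; simp) (fun c v w => by simp only [Submodule.coe_smul, map_smul])

theorem existsUnique_isLeviForm (hρ : IsDefiningFunction M p ρ) (hp : p ∈ M) :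
    ∃! τ, IsLeviForm M p τ := by
  refine ⟨restr2 (-cd (cd (rc ρ)) p) _ _ (thetaQ hρ hp).symm, ?_, ?_⟩
  · simp only
    rw [isLeviForm_iff hρ hp]
    intro v w
    simp [restr2]
  · intro τ hτ
    rw [isLeviForm_iff hρ hp] at hτ
    ext v w
    apply (thetaQ hρ hp).injective
    rw [hτ]
    simp [restr2]

theorem thetaQ_leviForm (hρ : IsDefiningFunction M p ρ) (hp : p ∈ M) (v : H10 M p) (w : H01 M p) :
    thetaQ hρ hp (leviForm M p v w) = -cd (cd (rc ρ)) p (v : CVec n) (w : CVec n) := by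
  have h := (existsUnique_isLeviForm hρ hp).exists
  have : IsLeviForm M p (leviForm M p) := by
    rw [leviForm, dif_pos h]; exact h.choose_spec
  exact (isLeviForm_iff hρ hp _).1 this v w

theorem mem_K10 (hρ : IsDefiningFunction M p ρ) (hp : p ∈ M) {v : CVec n} :
    v ∈ K10 M p ↔ v ∈ H10 M p ∧ ∀ w ∈ H01 M p, cd (cd (rc ρ)) p v w = 0 := by
  simp only [K10, Submodule.mem_map, LinearMap.mem_ker, Submodule.subtype_apply]
  constructor
  · rintro ⟨v, hv, rfl⟩
    refine ⟨v.2, fun w hw => ?_⟩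
    have := thetaQ_leviForm hρ hp v ⟨w, hw⟩
    rw [hv] at this
    simpa using this.symm
  · rintro ⟨hv, h⟩
    refine ⟨⟨v, hv⟩, ?_, rfl⟩
    ext w
    apply (thetaQ hρ hp).injective
    rw [thetaQ_leviForm, h _ w.2]
    simp

theorem leviGraph_iff (hρ : IsDefiningFunction M p ρ) (hp : p ∈ M) {v2 v1 u : CVec n} :
    LeviGraph M p v2 v1 u ↔ v2 ∈ H10 M p ∧ v1 ∈ H01 M p ∧ u ∈ cT M p ∧
      Complex.I * cd (rc ρ) p (u.1, 0) = -cd (cd (rc ρ)) p v2 v1 := by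
  simp only [LeviGraph, eq_toQ_iff hρ hp, thetaQ_leviForm]
  constructor
  · rintro ⟨h2, h1, h, e⟩; exact ⟨h2, h1, h, e.symm⟩
  · rintro ⟨h2, h1, h, e⟩; exact ⟨h2, h1, h, e.symm⟩

end

/-! ### Third order models of a defining function -/

section

variable {n : ℕ} {M : Set (Cn n)} {p : Cn n} {ρ : Cn n → ℝ}

theorem cd_star_vec {h : Cn n → Cn n} {x : Cn n} (hh : DifferentiableAt ℝ h x) (v : CVec n) :
    cd (fun y => star (h y)) x v = star (cd h x (conjVec n v)) := by
  have h1 : HasFDerivAt (fun y => star (h y)) ((starCn n).comp (fderiv ℝ h x)) x :=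
    (starCn n).hasFDerivAt.comp x hh.hasFDerivAt
  rw [cd_apply, h1.fderiv, cd_apply]
  simp [cExt, conjVec]
  module

/-- `ρ` agrees to third order at `p` with `R ∘ Ψ`, where `Ψ` is a system of local holomorphic
coordinates tangent to the identity. -/
structure AgreesWith (p : Cn n) (ρ : Cn n → ℝ) (Ψ : Cn n → Cn n) (R : Cn n → ℝ) : Prop where
  analytic : AnalyticAt ℂ Ψ p
  map_eq : Ψ p = 0
  fderiv_eq : fderiv ℂ Ψ p = ContinuousLinearMap.id ℂ (Cn n)
  smooth : ContDiff ℝ ∞ R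
  close : (fun x => ρ x - R (Ψ x)) =O[𝓝 p] fun x => ‖x - p‖ ^ 4

/-- A third order model `R ∘ Ψ` of `ρ` such that the complex Hessian of `R` at the origin
annihilates the Levi kernel of `M` also in the transverse directions. -/
structure HasModel (M : Set (Cn n)) (p : Cn n) (ρ : Cn n → ℝ) (Ψ : Cn n → Cn n)
    (R : Cn n → ℝ) : Prop extends AgreesWith p ρ Ψ R where
  ker10 : ∀ v ∈ K10 M p, ∀ b, cd (cd (rc R)) 0 v (0, b) = 0
  ker01 : ∀ v ∈ K01 M p, ∀ a, cd (cd (rc R)) 0 (a, 0) v = 0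

theorem push_id (v : CVec n) : push (ContinuousLinearMap.id ℂ (Cn n)) v = v := by simp [push]

theorem smAt_comp_holomorphic {F : Type*} [NormedAddCommGroup F] [NormedSpace ℝ F]
    {f : Cn n → F} {Ψ : Cn n → Cn n} (hf : ContDiff ℝ ∞ f)
    (hΨ : AnalyticAt ℂ Ψ p) : SmAt (fun x => f (Ψ x)) p :=
  SmAt.comp hf.smAt hΨ.smAt

/-- The mixed complex Hessian of a composition with a holomorphic map. -/
theorem cd_cd_comp_holomorphic {f : Cn n → ℂ} {Ψ : Cn n → Cn n} {x : Cn n}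
    (hf : SmAt f (Ψ x)) (hΨ : AnalyticAt ℂ Ψ x) (a b : Cn n) :
    cd (cd fun y => f (Ψ y)) x (a, 0) (0, b) =
      cd (cd f) (Ψ x) (push (fderiv ℂ Ψ x) (a, 0)) (push (fderiv ℂ Ψ x) (0, b)) := by
  have hc : SmAt (fun y => f (Ψ y)) x := SmAt.comp hf hΨ.smAt
  rw [← cd_clm_apply_const hc.cd.differentiableAt]
  have e : (fun y => cd (fun y => f (Ψ y)) y (0, b)) =ᶠ[𝓝 x]
      fun y => cd f (Ψ y) (push (fderiv ℂ Ψ y) (0, b)) := by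
    filter_upwards [hΨ.smAt.continuousAt.eventually hf.eventually, hΨ.eventually_analyticAt]
      with y h1 h2
    exact cd_comp_holomorphic h1.differentiableAt h2.differentiableAt _
  have hA : SmAt (fun y => cd f (Ψ y)) x := SmAt.comp hf.cd hΨ.smAt
  have hJ := smAt_push_fderiv hΨ (smAt_const (E := Cn n) ((0, b) : CVec n) (p := x))
  rw [cd_congr e, cd_clm_apply hA.differentiableAt hJ.differentiableAt,
    cd_comp_holomorphic hf.cd.differentiableAt hΨ.differentiableAt]
  have hD : AnalyticAt ℂ (fun y => fderiv ℂ Ψ y (star b)) x :=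
    ((ContinuousLinearMap.apply ℂ (Cn n) (star b)).analyticAt _).comp hΨ.fderiv
  have h0 : cd (fun y => push (fderiv ℂ Ψ y) (0, b)) x (a, 0) = 0 := by
    have e1 : (fun y => push (fderiv ℂ Ψ y) ((0, b) : CVec n)) =
        fun y => ContinuousLinearMap.inr ℂ (Cn n) (Cn n) (star (fderiv ℂ Ψ y (star b))) := by
      funext y; simp [push]
    have hs : SmAt (fun y => star (fderiv ℂ Ψ y (star b))) x := hD.smAt.clm (starCn n)
    rw [e1, cd_clm_comp _ hs.differentiableAt, ContinuousLinearMap.comp_apply,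
      cd_star_vec hD.smAt.differentiableAt, cd_of_holomorphic hD.differentiableAt]
    simp [conjVec]
  rw [h0, map_zero, add_zero]

/-- The remainder of a third order model is flat to order three. -/
theorem AgreesWith.remainder {Ψ : Cn n → Cn n} {R : Cn n → ℝ} (hρ : SmAt ρ p)
    (h : AgreesWith p ρ Ψ R) : ∃ E : Cn n → ℂ, SmAt E p ∧ cd E p = 0 ∧ cd (cd E) p = 0 ∧
      cd (cd (cd E)) p = 0 ∧ SmAt (fun y => rc R (Ψ y)) p ∧
      rc ρ = fun x => rc R (Ψ x) + E x := by
  have hR : SmAt (fun y => rc R (Ψ y)) p :=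
    smAt_comp_holomorphic (Complex.ofRealCLM.contDiff.comp h.smooth) h.analytic
  have hE : SmAt (fun x => rc ρ x - rc R (Ψ x)) p := hρ.rc.sub hR
  have hO : (fun x => rc ρ x - rc R (Ψ x)) =O[𝓝 p] fun x => ‖x - p‖ ^ 4 := by
    refine Asymptotics.IsBigO.trans (Asymptotics.IsBigO.of_bound 1 ?_) h.close
    refine Filter.Eventually.of_forall fun x => ?_
    simp only [rc]
    rw [← Complex.ofReal_sub, Complex.norm_real, one_mul]
  obtain ⟨h1, h2, h3⟩ := hE.cd_eq_zero_of_isBigO hO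
  exact ⟨_, hE, h1, h2, h3, hR, by funext x; ring⟩

theorem smAt_rc_of_contDiff {R : Cn n → ℝ} (h : ContDiff ℝ ∞ R) (x : Cn n) : SmAt (rc R) x :=
  SmAt.rc h.smAt

theorem AgreesWith.cd_eq {Ψ : Cn n → Cn n} {R : Cn n → ℝ} (hρ : SmAt ρ p)
    (h : AgreesWith p ρ Ψ R) (v : CVec n) : cd (rc ρ) p v = cd (rc R) 0 v := by
  obtain ⟨E, hE, h1, h2, h3, hR, e⟩ := h.remainder hρ
  rw [e, cd_add hR.differentiableAt hE.differentiableAt, h1, add_zero,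
    cd_comp_holomorphic (smAt_rc_of_contDiff h.smooth _).differentiableAt
      h.analytic.differentiableAt, h.map_eq, h.fderiv_eq, push_id]

theorem AgreesWith.cd_cd_eventually {Ψ : Cn n → Cn n} {R : Cn n → ℝ}
    (hρ : IsDefiningFunction M p ρ) (h : AgreesWith p ρ Ψ R) :
    ∃ E : Cn n → ℂ, SmAt E p ∧ cd (cd E) p = 0 ∧
      cd (cd (cd E)) p = 0 ∧ ∀ᶠ x in 𝓝 p, ∀ a b : Cn n, cd (cd (rc ρ)) x (a, 0) (0, b) =
        cd (cd (rc R)) (Ψ x) (push (fderiv ℂ Ψ x) (a, 0)) (push (fderiv ℂ Ψ x) (0, b)) +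
          cd (cd E) x (a, 0) (0, b) := by
  obtain ⟨E, hE, h1, h2, h3, hR, e⟩ := h.remainder hρ.smAt
  refine ⟨E, hE, h2, h3, ?_⟩
  filter_upwards [hE.eventually.eventually_nhds, hR.eventually.eventually_nhds,
    h.analytic.eventually_analyticAt] with x hx hRx ha a b
  have e1 : cd (rc ρ) =ᶠ[𝓝 x] fun y => cd (fun y => rc R (Ψ y)) y + cd E y := by
    filter_upwards [hx, hRx] with y hy hRy
    rw [e, cd_add hRy.differentiableAt hy.differentiableAt]
  rw [cd_congr e1, cd_add hRx.self_of_nhds.cd.differentiableAt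
    hx.self_of_nhds.cd.differentiableAt, add_apply, add_apply,
    cd_cd_comp_holomorphic (smAt_rc_of_contDiff h.smooth _) ha]

theorem AgreesWith.cd_cd_eq {Ψ : Cn n → Cn n} {R : Cn n → ℝ} (hρ : IsDefiningFunction M p ρ)
    (h : AgreesWith p ρ Ψ R) (a b : Cn n) :
    cd (cd (rc ρ)) p (a, 0) (0, b) = cd (cd (rc R)) 0 (a, 0) (0, b) := by
  obtain ⟨E, hE, h2, h3, he⟩ := h.cd_cd_eventually hρ
  rw [he.self_of_nhds, h2, h.map_eq, h.fderiv_eq, push_id, push_id]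
  simp

/-- The derivative of the Levi form of two vector fields, in terms of the model. The vectors `w` and
`w'` come from differentiating the fields transported by `Ψ`; along a `(1,0)` vector `v` the second
derivative of the holomorphic map `Ψ` does not contribute to the `(0,1)` part `w'`. -/
theorem AgreesWith.cd_hessian {Ψ : Cn n → Cn n} {R : Cn n → ℝ} (hρ : IsDefiningFunction M p ρ)
    (h : AgreesWith p ρ Ψ R) {ξ η : Cn n → CVec n} (hξ : SmAt ξ p) (hη : SmAt η p) (v : CVec n) :
    ∃ w w' : Cn n, (v.2 = 0 → w' = (cd η p v).2) ∧
      cd (fun x => cd (cd (rc ρ)) x ((ξ x).1, 0) (0, (η x).2)) p v =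
        cd (cd (cd (rc R))) 0 v ((ξ p).1, 0) (0, (η p).2) +
        cd (cd (rc R)) 0 (w, 0) (0, (η p).2) + cd (cd (rc R)) 0 ((ξ p).1, 0) (0, w') := by
  obtain ⟨E, hE, h2, h3, he⟩ := h.cd_cd_eventually hρ
  have hRs := fun x => smAt_rc_of_contDiff h.smooth x
  have hα1 : SmAt (fun x => fderiv ℂ Ψ x (ξ x).1) p :=
    h.analytic.fderiv.smAt.clmC_apply hξ.fst
  have hβ0 : SmAt (fun x => fderiv ℂ Ψ x (star (η x).2)) p :=
    h.analytic.fderiv.smAt.clmC_apply (hη.snd.clm (starCn n))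
  have hβ1 : SmAt (fun x => star (fderiv ℂ Ψ x (star (η x).2))) p := hβ0.clm (starCn n)
  refine ⟨cd (fun x => fderiv ℂ Ψ x (ξ x).1) p v,
    cd (fun x => star (fderiv ℂ Ψ x (star (η x).2))) p v, ?_, ?_⟩
  · intro hv
    have hs2 : SmAt (fun x => star (η x).2) p := hη.snd.clm (starCn n)
    have hd : DifferentiableAt ℂ (fderiv ℂ Ψ) p := h.analytic.fderiv.differentiableAt
    rw [cd_star_vec hβ0.differentiableAt, cd_clm_apply h.analytic.fderiv.smAt.differentiableAt
      hs2.differentiableAt, cd_of_holomorphic hd, h.fderiv_eq,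
      cd_star_vec hη.snd.differentiableAt]
    have e1 : cd (fun x => (η x).2) p v = (cd η p v).2 := by
      have := cd_clm_comp (ContinuousLinearMap.snd ℂ (Cn n) (Cn n)) hη.differentiableAt
      exact congrArg (fun A => A v) this
    simp [hv, e1]
  · have e1 : (fun x => cd (cd (rc ρ)) x ((ξ x).1, 0) (0, (η x).2)) =ᶠ[𝓝 p] fun x =>
        cd (cd (rc R)) (Ψ x) (ContinuousLinearMap.inl ℂ (Cn n) (Cn n) (fderiv ℂ Ψ x (ξ x).1))
          (ContinuousLinearMap.inr ℂ (Cn n) (Cn n) (star (fderiv ℂ Ψ x (star (η x).2)))) +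
        cd (cd E) x (P10 n (ξ x)) (P01 n (η x)) := by
      filter_upwards [he] with x hx
      rw [hx]
      simp [push]
    have hA : SmAt (fun x => cd (cd (rc R)) (Ψ x)) p := SmAt.comp (hRs _).cd.cd h.analytic.smAt
    have hAα := hA.clmC_apply (hα1.clmC (ContinuousLinearMap.inl ℂ (Cn n) (Cn n)))
    have hB := hE.cd.cd.clmC_apply (hξ.clmC (P10 n))
    rw [cd_congr e1, cd_add (hAα.clmC_apply (hβ1.clmC
        (ContinuousLinearMap.inr ℂ (Cn n) (Cn n)))).differentiableAt
        (hB.clmC_apply (hη.clmC (P01 n))).differentiableAt, add_apply,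
      cd_clm_apply hAα.differentiableAt
        (hβ1.clmC (ContinuousLinearMap.inr ℂ (Cn n) (Cn n))).differentiableAt,
      cd_clm_apply hA.differentiableAt
        (hα1.clmC (ContinuousLinearMap.inl ℂ (Cn n) (Cn n))).differentiableAt,
      cd_clm_apply hB.differentiableAt (hη.clmC (P01 n)).differentiableAt,
      cd_clm_apply hE.cd.cd.differentiableAt (hξ.clmC (P10 n)).differentiableAt, h2, h3,
      cd_clm_comp _ hα1.differentiableAt, cd_clm_comp _ hβ1.differentiableAt,
      cd_comp_holomorphic (hRs _).cd.cd.differentiableAt h.analytic.differentiableAt,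
      h.map_eq, h.fderiv_eq, push_id]
    simp

end

/-! ### The cubic tensors in terms of a model -/

section

variable {n : ℕ} {M : Set (Cn n)} {p : Cn n} {ρ : Cn n → ℝ} {Ψ : Cn n → Cn n} {R : Cn n → ℝ}

theorem mem_K01 {v : CVec n} : v ∈ K01 M p ↔ conjVec n v ∈ K10 M p := Iff.rfl

theorem K10_le_H10 : K10 M p ≤ H10 M p := by
  rintro v ⟨w, -, rfl⟩; exact w.2

theorem K01_le_H01 : K01 M p ≤ H01 M p := fun _ hv => K10_le_H10 (M := M) hv

theorem mem_cK {v : CVec n} : v ∈ cK M p ↔ ((v.1, 0) : CVec n) ∈ K10 M p ∧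
    ((0, v.2) : CVec n) ∈ K01 M p := by
  constructor
  · intro hv
    obtain ⟨y, hy, z, hz, rfl⟩ := Submodule.mem_sup.1 hv
    have hy2 : y.2 = 0 := (K10_le_H10 hy).2
    have hz1 : z.1 = 0 := by
      have : star z.1 = 0 := (K10_le_H10 (mem_K01.1 hz)).2
      simpa using this
    have e1 : (((y + z).1, 0) : CVec n) = y := by ext <;> simp [hy2, hz1]
    have e2 : ((0, (y + z).2) : CVec n) = z := by ext <;> simp [hy2, hz1]
    rw [e1, e2]; exact ⟨hy, hz⟩
  · rintro ⟨h1, h2⟩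
    exact Submodule.mem_sup.2 ⟨_, h1, _, h2, by simp⟩

theorem K10_le_cK : K10 M p ≤ cK M p := le_sup_left
theorem K01_le_cK : K01 M p ≤ cK M p := le_sup_right

theorem cK_le_cH : cK M p ≤ cH M p := sup_le_sup K10_le_H10 K01_le_H01

theorem snd_eq_zero_of_mem_H10 {v : CVec n} (h : v ∈ H10 M p) : v.2 = 0 := h.2

theorem fst_eq_zero_of_mem_H01 {v : CVec n} (h : v ∈ H01 M p) : v.1 = 0 := by
  have : star v.1 = 0 := h.2
  simpa using this

theorem eq_of_mem_H10 {v : CVec n} (h : v ∈ H10 M p) : ((v.1, 0) : CVec n) = v := by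
  rw [← snd_eq_zero_of_mem_H10 h]

theorem eq_of_mem_H01 {v : CVec n} (h : v ∈ H01 M p) : ((0, v.2) : CVec n) = v := by
  rw [← fst_eq_zero_of_mem_H01 h]

namespace HasModel

theorem leviAlt_eq (hρ : IsDefiningFunction M p ρ) (h : HasModel M p ρ Ψ R) (v w : CVec n) :
    leviAlt ρ p v w = cd (cd (rc R)) 0 (v.1, 0) (0, w.2) - cd (cd (rc R)) 0 (w.1, 0) (0, v.2) := by
  rw [leviAlt, h.cd_cd_eq hρ, h.cd_cd_eq hρ]

theorem leviAlt_eq_zero_left (hρ : IsDefiningFunction M p ρ) (h : HasModel M p ρ Ψ R)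
    {v : CVec n} (hv : v ∈ cK M p) (w : CVec n) : leviAlt ρ p v w = 0 := by
  rw [mem_cK] at hv
  rw [h.leviAlt_eq hρ, h.ker10 _ hv.1, h.ker01 _ hv.2, sub_zero]

theorem leviAlt_eq_zero_right (hρ : IsDefiningFunction M p ρ) (h : HasModel M p ρ Ψ R)
    {v : CVec n} (hv : v ∈ cK M p) (w : CVec n) : leviAlt ρ p w v = 0 := by
  rw [mem_cK] at hv
  rw [h.leviAlt_eq hρ, h.ker10 _ hv.1, h.ker01 _ hv.2, sub_zero]

theorem smAt_hessian (hρ : SmAt ρ p) {ξ η : Cn n → CVec n} (hξ : SmAt ξ p) (hη : SmAt η p) :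
    SmAt (fun x => cd (cd (rc ρ)) x ((ξ x).1, 0) (0, (η x).2)) p :=
  SmAt.clmC_apply (hρ.rc.cd.cd.clmC_apply (hξ.clmC (P10 n))) (hη.clmC (P01 n))

/-- The derivative of the Levi form of two fields whose values at `p` lie in `ℂK_p` is a third
derivative of the model: the derivatives of the fields only enter through the Hessian of the model,
which annihilates the Levi kernel. -/
theorem cd_leviAlt (hρ : IsDefiningFunction M p ρ) (h : HasModel M p ρ Ψ R) {ξ η : Cn n → CVec n}
    (hξ : SmAt ξ p) (hη : SmAt η p) (hξK : ξ p ∈ cK M p) (hηK : η p ∈ cK M p) (v : CVec n) :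
    cd (fun x => leviAlt ρ x (ξ x) (η x)) p v =
      cd (cd (cd (rc R))) 0 v ((ξ p).1, 0) (0, (η p).2) -
        cd (cd (cd (rc R))) 0 v ((η p).1, 0) (0, (ξ p).2) := by
  rw [mem_cK] at hξK hηK
  have hs := cd_sub (smAt_hessian hρ.smAt hξ hη).differentiableAt
    (smAt_hessian hρ.smAt hη hξ).differentiableAt
  obtain ⟨w, w', -, e⟩ := h.cd_hessian hρ hξ hη v
  obtain ⟨z, z', -, e'⟩ := h.cd_hessian hρ hη hξ v
  refine (congrArg (fun A => A v) hs).trans ?_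
  rw [sub_apply, e, e', h.ker01 _ hηK.2, h.ker10 _ hξK.1, h.ker01 _ hξK.2, h.ker10 _ hηK.1]
  ring

/-- The expression in the double Lie derivative of a contact form when only `ξ1 p` lies in the Levi
kernel: the term with the `(0,1)` part of the derivative of `ξ1` is cancelled by the bracket. -/
theorem cd_leviAlt_sub (hρ : IsDefiningFunction M p ρ) (hp : p ∈ M) (h : HasModel M p ρ Ψ R)
    {ξ3 ξ2 ξ1 : Cn n → CVec n}
    (h3 : IsSection M p (H10 M) ξ3) (h2 : IsSection M p (H10 M) ξ2) (h1 : IsSection M p (H01 M) ξ1)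
    (hK : ξ1 p ∈ K01 M p) :
    cd (fun x => leviAlt ρ x (ξ2 x) (ξ1 x)) p (ξ3 p) - leviAlt ρ p (ξ2 p) (bracket ξ3 ξ1 p) =
      cd (cd (cd (rc R))) 0 (ξ3 p) (ξ2 p) (ξ1 p) := by
  have m3 := h3.eventually_mem.self_of_nhdsWithin hp
  have m2 := h2.eventually_mem.self_of_nhdsWithin hp
  have m1 := h1.eventually_mem.self_of_nhdsWithin hp
  have hs := cd_sub (smAt_hessian hρ.smAt h2.smAt h1.smAt).differentiableAt
    (smAt_hessian hρ.smAt h1.smAt h2.smAt).differentiableAt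
  obtain ⟨w, w', hw, e⟩ := h.cd_hessian hρ h2.smAt h1.smAt (ξ3 p)
  obtain ⟨z, z', -, e'⟩ := h.cd_hessian hρ h1.smAt h2.smAt (ξ3 p)
  have hcd : cd (fun x => leviAlt ρ x (ξ2 x) (ξ1 x)) p (ξ3 p) = _ := congrArg (fun A => A (ξ3 p)) hs
  -- the `(0,1)` part of `ξ3` vanishes along `M`
  have h0 : (cd ξ3 p (ξ1 p)).2 = 0 := by
    funext i
    let L : CVec n →L[ℂ] ℂ := (ContinuousLinearMap.proj i).comp
      (ContinuousLinearMap.snd ℂ (Cn n) (Cn n))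
    have hL := cd_eq_zero_of_mem_cT hρ hp (h3.smAt.clmC L) (by
      filter_upwards [h3.eventually_mem] with x hx
      simp [L, snd_eq_zero_of_mem_H10 hx])
      (cH_le_cT hρ hp (H01_le_cH m1))
    rw [cd_clm_comp L h3.smAt.differentiableAt] at hL
    exact hL
  have hZ : (bracket ξ3 ξ1 p).2 = w' := by
    rw [hw (snd_eq_zero_of_mem_H10 m3), bracket_apply, Prod.snd_sub, h0, sub_zero]
  have z0 : ((0, 0) : CVec n) = 0 := rfl
  rw [hcd, sub_apply, e, e', h.leviAlt_eq hρ, hZ, snd_eq_zero_of_mem_H10 m2,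
    fst_eq_zero_of_mem_H01 m1, eq_of_mem_H10 m2, eq_of_mem_H01 m1, h.ker01 _ hK, z0]
  simp

/-- A tensor is `τ³_p` if and only if `i ∂ρ` pairs with it to minus the third derivative of the
model. -/
theorem isTau3_iff (hρ : IsDefiningFunction M p ρ) (hp : p ∈ M) (h : HasModel M p ρ Ψ R)
    (τ : cT M p →ₗ[ℂ] K10 M p →ₗ[ℂ] K01 M p →ₗ[ℂ] cQ M p) :
    IsTau3 M p τ ↔ ∀ (v3 : cT M p) (v2 : K10 M p) (v1 : K01 M p),
      thetaQ hρ hp (τ v3 v2 v1) =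
        -cd (cd (cd (rc R))) 0 (v3 : CVec n) (v2 : CVec n) (v1 : CVec n) := by
  have hval : ∀ (θ : Cn n → Cn n →L[ℝ] ℂ) (f : Cn n → ℂ) (L3 L2 L1 : Cn n → CVec n),
      IsContactForm M p θ → SmAt f p → (∀ᶠ x in 𝓝[M] p, ∀ u ∈ cT M x,
      cExt (θ x) u = f x * (Complex.I * cd (rc ρ) x (u.1, 0))) →
      IsSection M p (H10 M) L2 → IsSection M p (H01 M) L1 →
      ∀ (v3 : cT M p) (v2 : K10 M p) (v1 : K01 M p), L3 p = v3 → L2 p = v2 → L1 p = v1 →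
      Complex.I * der L3 (pairing θ (bracket L2 L1)) p =
        f p * -cd (cd (cd (rc R))) 0 (v3 : CVec n) (v2 : CVec n) (v1 : CVec n) := by
    intro θ f L3 L2 L1 hθ hfs hf h2 h1 v3 v2 v1 e3 e2 e1
    have k2 : L2 p ∈ cK M p := by rw [e2]; exact K10_le_cK v2.2
    have k1 : L1 p ∈ cK M p := by rw [e1]; exact K01_le_cK v1.2
    have hd := der_pairing_bracket hρ hp hθ.smAt hfs hf (h2.mono fun _ => H10_le_cH)
      (h1.mono fun _ => H01_le_cH) (h.leviAlt_eq_zero_left hρ k2 _) v3.2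
    have hder : der L3 (pairing θ (bracket L2 L1)) p =
        cd (pairing θ (bracket L2 L1)) p (L3 p) := rfl
    rw [hder, e3, hd, h.cd_leviAlt hρ h2.smAt h1.smAt k2 k1, e2, e1,
      eq_of_mem_H10 (K10_le_H10 v2.2), eq_of_mem_H01 (K01_le_H01 v1.2),
      snd_eq_zero_of_mem_H10 (K10_le_H10 v2.2)]
    have z0 : ((0, 0) : CVec n) = 0 := rfl
    rw [z0, map_zero]
    linear_combination (f p * cd (cd (cd (rc R))) 0 (v3 : CVec n) (v2 : CVec n) (v1 : CVec n)) *
      Complex.I_sq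
  constructor
  · intro ht v3 v2 v1
    obtain ⟨L3, h3, e3⟩ := exists_section_cT hρ hp v3.2
    obtain ⟨L2, h2, e2⟩ := exists_section_H10 hρ hp (K10_le_H10 v2.2)
    obtain ⟨L1, h1, e1⟩ := exists_section_H01 hρ hp (K01_le_H01 v1.2)
    have hth := isContactForm_theta0 hρ
    have := ht (theta0 ρ) L3 L2 L1 hth h3 h2 h1 v3 v2 v1 e3 e2 e1
    rw [pairsTo_iff hρ hp theta0_factor, hval _ _ L3 L2 L1 hth (smAt_const _) theta0_factor
      h2 h1 v3 v2 v1 e3 e2 e1] at this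
    simpa using this
  · intro ht θ L3 L2 L1 hθ h3 h2 h1 v3 v2 v1 e3 e2 e1
    obtain ⟨f, hfs, hf⟩ := hθ.exists_factor hρ
    rw [pairsTo_iff hρ hp hf, hval _ _ L3 L2 L1 hθ hfs hf h2 h1 v3 v2 v1 e3 e2 e1, ht]

/-- A tensor is `τ²¹_p` if and only if `i ∂ρ` pairs with it to `-i` times the third derivative of
the model. -/
theorem isTau21_iff (hρ : IsDefiningFunction M p ρ) (hp : p ∈ M) (h : HasModel M p ρ Ψ R)
    (τ : H10 M p →ₗ[ℂ] H10 M p →ₗ[ℂ] K01 M p →ₗ[ℂ] cQ M p) :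
    IsTau21 M p τ ↔ ∀ (v3 v2 : H10 M p) (v1 : K01 M p),
      thetaQ hρ hp (τ v3 v2 v1) =
        -Complex.I * cd (cd (cd (rc R))) 0 (v3 : CVec n) (v2 : CVec n) (v1 : CVec n) := by
  have hval : ∀ (θ : Cn n → Cn n →L[ℝ] ℂ) (f : Cn n → ℂ) (L3 L2 : Cn n → CVec n),
      IsContactForm M p θ → SmAt f p → (∀ᶠ x in 𝓝[M] p, ∀ u ∈ cT M x,
      cExt (θ x) u = f x * (Complex.I * cd (rc ρ) x (u.1, 0))) →
      IsSection M p (H10 M) L3 → IsSection M p (H10 M) L2 →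
      ∀ (v3 v2 : H10 M p) (v1 : K01 M p), L3 p = v3 → L2 p = v2 →
      cExt (lieD L3 (lieD L2 θ) p) (v1 : CVec n) = f p *
        (-Complex.I * cd (cd (cd (rc R))) 0 (v3 : CVec n) (v2 : CVec n) (v1 : CVec n)) := by
    intro θ f L3 L2 hθ hfs hf h3 h2 v3 v2 v1 e3 e2
    obtain ⟨L1, h1, e1⟩ := exists_section_H01 hρ hp (K01_le_H01 v1.2)
    have k1 : L1 p ∈ cK M p := by rw [e1]; exact K01_le_cK v1.2
    rw [← e1, cExt_lieD_lieD_contact hρ hp hθ hfs hf (h3.mono fun _ => H10_le_cH)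
      (h2.mono fun _ => H10_le_cH) (h1.mono fun _ => H01_le_cH)
      (h.leviAlt_eq_zero_right hρ k1 _) (h.leviAlt_eq_zero_right hρ k1 _),
      h.cd_leviAlt_sub hρ hp h3 h2 h1 (by rw [e1]; exact v1.2), e3, e2]
  constructor
  · intro ht v3 v2 v1
    obtain ⟨L3, h3, e3⟩ := exists_section_H10 hρ hp v3.2
    obtain ⟨L2, h2, e2⟩ := exists_section_H10 hρ hp v2.2
    have hth := isContactForm_theta0 hρ
    have := ht (theta0 ρ) L3 L2 hth h3 h2 v3 v2 v1 e3 e2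
    rw [pairsTo_iff hρ hp theta0_factor, hval _ _ L3 L2 hth (smAt_const _) theta0_factor
      h3 h2 v3 v2 v1 e3 e2] at this
    simpa using this
  · intro ht θ L3 L2 hθ h3 h2 v3 v2 v1 e3 e2
    obtain ⟨f, hfs, hf⟩ := hθ.exists_factor hρ
    rw [pairsTo_iff hρ hp hf, hval _ _ L3 L2 hθ hfs hf h3 h2 v3 v2 v1 e3 e2, ht]

/-- The analogue for Ebenfelt's tensor on `ℂH_p × ℂK_p × ℂK_p`, where the model enters through the
alternating form `∂∂̄R`. -/
theorem isTau21Ext_iff (hρ : IsDefiningFunction M p ρ) (hp : p ∈ M) (h : HasModel M p ρ Ψ R)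
    (τ : cH M p →ₗ[ℂ] cK M p →ₗ[ℂ] cK M p →ₗ[ℂ] cQ M p) :
    IsTau21Ext M p τ ↔ ∀ (v3 : cH M p) (v2 v1 : cK M p),
      thetaQ hρ hp (τ v3 v2 v1) =
        -Complex.I * (cd (cd (cd (rc R))) 0 (v3 : CVec n) ((v2 : CVec n).1, 0) (0, (v1 : CVec n).2) -
          cd (cd (cd (rc R))) 0 (v3 : CVec n) ((v1 : CVec n).1, 0) (0, (v2 : CVec n).2)) := by
  have hval : ∀ (θ : Cn n → Cn n →L[ℝ] ℂ) (f : Cn n → ℂ) (L3 L2 : Cn n → CVec n),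
      IsContactForm M p θ → SmAt f p → (∀ᶠ x in 𝓝[M] p, ∀ u ∈ cT M x,
      cExt (θ x) u = f x * (Complex.I * cd (rc ρ) x (u.1, 0))) →
      IsSection M p (cH M) L3 → IsSection M p (cH M) L2 →
      ∀ (v3 : cH M p) (v2 v1 : cK M p), L3 p = v3 → L2 p = v2 →
      cExt (lieD L3 (lieD L2 θ) p) (v1 : CVec n) = f p * (-Complex.I *
        (cd (cd (cd (rc R))) 0 (v3 : CVec n) ((v2 : CVec n).1, 0) (0, (v1 : CVec n).2) -
          cd (cd (cd (rc R))) 0 (v3 : CVec n) ((v1 : CVec n).1, 0) (0, (v2 : CVec n).2))) := by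
    intro θ f L3 L2 hθ hfs hf h3 h2 v3 v2 v1 e3 e2
    obtain ⟨L1, h1, e1⟩ := exists_section_cH hρ hp (cK_le_cH v1.2)
    have k1 : L1 p ∈ cK M p := by rw [e1]; exact v1.2
    have k2 : L2 p ∈ cK M p := by rw [e2]; exact v2.2
    rw [← e1, cExt_lieD_lieD_contact hρ hp hθ hfs hf h3 h2 h1
      (h.leviAlt_eq_zero_right hρ k1 _) (h.leviAlt_eq_zero_right hρ k1 _),
      h.leviAlt_eq_zero_left hρ k2, h.cd_leviAlt hρ h2.smAt h1.smAt k2 k1, sub_zero, e3, e2]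
  constructor
  · intro ht v3 v2 v1
    obtain ⟨L3, h3, e3⟩ := exists_section_cH hρ hp v3.2
    obtain ⟨L2, h2, e2⟩ := exists_section_cH hρ hp (cK_le_cH v2.2)
    have hth := isContactForm_theta0 hρ
    have := ht (theta0 ρ) L3 L2 hth h3 h2 v3 v2 v1 e3 e2
    rw [pairsTo_iff hρ hp theta0_factor, hval _ _ L3 L2 hth (smAt_const _) theta0_factor
      h3 h2 v3 v2 v1 e3 e2] at this
    simpa using this
  · intro ht θ L3 L2 hθ h3 h2 v3 v2 v1 e3 e2
    obtain ⟨f, hfs, hf⟩ := hθ.exists_factor hρ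
    rw [pairsTo_iff hρ hp hf, hval _ _ L3 L2 hθ hfs hf h3 h2 v3 v2 v1 e3 e2, ht]

end HasModel

/-- The trilinear map `(u, v, w) ↦ ι (T (A u) (B v) (C w))` on given subspaces. -/
def restr3 {Q : Type*} [AddCommGroup Q] [Module ℂ Q]
    (T : CVec n →L[ℂ] CVec n →L[ℂ] CVec n →L[ℂ] ℂ) (A B C : CVec n →L[ℂ] CVec n)
    (S1 S2 S3 : Submodule ℂ (CVec n)) (ι : ℂ →ₗ[ℂ] Q) : S1 →ₗ[ℂ] S2 →ₗ[ℂ] S3 →ₗ[ℂ] Q where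
  toFun u := LinearMap.mk₂ ℂ (fun v w => ι (T (A u) (B v) (C w))) (by intros; simp)
    (fun c v w => by simp only [Submodule.coe_smul, map_smul, smul_apply])
    (by intros; simp) (fun c v w => by simp only [Submodule.coe_smul, map_smul])
  map_add' u u' := by ext v w; simp
  map_smul' c u := by
    ext v w
    simp only [LinearMap.mk₂_apply, Submodule.coe_smul, map_smul, smul_apply, LinearMap.smul_apply,
      RingHom.id_apply]

@[simp]
theorem restr3_apply {Q : Type*} [AddCommGroup Q] [Module ℂ Q]
    (T : CVec n →L[ℂ] CVec n →L[ℂ] CVec n →L[ℂ] ℂ) (A B C : CVec n →L[ℂ] CVec n)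
    (S1 S2 S3 : Submodule ℂ (CVec n)) (ι : ℂ →ₗ[ℂ] Q) (u : S1) (v : S2) (w : S3) :
    restr3 T A B C S1 S2 S3 ι u v w = ι (T (A u) (B v) (C w)) := rfl

namespace HasModel

theorem existsUnique_isTau3 (hρ : IsDefiningFunction M p ρ) (hp : p ∈ M)
    (h : HasModel M p ρ Ψ R) : ∃! τ, IsTau3 M p τ := by
  let i := ContinuousLinearMap.id ℂ (CVec n)
  refine ⟨restr3 (cd (cd (cd (rc R))) 0) i i i _ _ _ (-(thetaQ hρ hp).symm.toLinearMap), ?_, ?_⟩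
  · simp only
    rw [h.isTau3_iff hρ hp]
    intro v3 v2 v1
    simp [i]
  · intro τ hτ
    rw [h.isTau3_iff hρ hp] at hτ
    ext v3 v2 v1
    apply (thetaQ hρ hp).injective
    rw [hτ]
    simp [i]

theorem existsUnique_isTau21 (hρ : IsDefiningFunction M p ρ) (hp : p ∈ M)
    (h : HasModel M p ρ Ψ R) : ∃! τ, IsTau21 M p τ := by
  let i := ContinuousLinearMap.id ℂ (CVec n)
  refine ⟨restr3 (cd (cd (cd (rc R))) 0) i i i _ _ _
    ((-Complex.I) • (thetaQ hρ hp).symm.toLinearMap), ?_, ?_⟩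
  · simp only
    rw [h.isTau21_iff hρ hp]
    intro v3 v2 v1
    simp [i]
  · intro τ hτ
    rw [h.isTau21_iff hρ hp] at hτ
    ext v3 v2 v1
    apply (thetaQ hρ hp).injective
    rw [hτ]
    simp [i]

theorem existsUnique_isTau21Ext (hρ : IsDefiningFunction M p ρ) (hp : p ∈ M)
    (h : HasModel M p ρ Ψ R) : ∃! τ, IsTau21Ext M p τ := by
  let i := ContinuousLinearMap.id ℂ (CVec n)
  let τ₀ : ℂ → (cH M p →ₗ[ℂ] cK M p →ₗ[ℂ] cK M p →ₗ[ℂ] cQ M p) := fun c =>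
    restr3 (cd (cd (cd (rc R))) 0) i (P10 n) (P01 n) _ _ _ (c • (thetaQ hρ hp).symm.toLinearMap)
  refine ⟨τ₀ (-Complex.I) + LinearMap.lflip.toLinearMap ∘ₗ τ₀ Complex.I, ?_, ?_⟩
  · simp only
    rw [h.isTau21Ext_iff hρ hp]
    intro v3 v2 v1
    simp [i, τ₀]
    ring
  · intro τ hτ
    rw [h.isTau21Ext_iff hρ hp] at hτ
    ext v3 v2 v1
    apply (thetaQ hρ hp).injective
    rw [hτ]
    simp [i, τ₀]
    ring

theorem tau3Graph_iff (hρ : IsDefiningFunction M p ρ) (hp : p ∈ M) (h : HasModel M p ρ Ψ R)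
    {v3 v2 v1 u : CVec n} : Tau3Graph M p v3 v2 v1 u ↔
      v3 ∈ cT M p ∧ v2 ∈ K10 M p ∧ v1 ∈ K01 M p ∧ u ∈ cT M p ∧
      Complex.I * cd (rc ρ) p (u.1, 0) = -cd (cd (cd (rc R))) 0 v3 v2 v1 := by
  have hex := (h.existsUnique_isTau3 hρ hp).exists
  have ht : IsTau3 M p (tau3 M p) := by
    rw [tau3, dif_pos hex]; exact hex.choose_spec
  rw [h.isTau3_iff hρ hp] at ht
  simp only [Tau3Graph, eq_toQ_iff hρ hp, ht]
  constructor
  · rintro ⟨h3, h2, h1, h, e⟩; exact ⟨h3, h2, h1, h, e.symm⟩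
  · rintro ⟨h3, h2, h1, h, e⟩; exact ⟨h3, h2, h1, h, e.symm⟩

theorem tau21Graph_iff (hρ : IsDefiningFunction M p ρ) (hp : p ∈ M) (h : HasModel M p ρ Ψ R)
    {v3 v2 v1 u : CVec n} : Tau21Graph M p v3 v2 v1 u ↔
      v3 ∈ H10 M p ∧ v2 ∈ H10 M p ∧ v1 ∈ K01 M p ∧ u ∈ cT M p ∧
      Complex.I * cd (rc ρ) p (u.1, 0) = -Complex.I * cd (cd (cd (rc R))) 0 v3 v2 v1 := by
  have hex := (h.existsUnique_isTau21 hρ hp).exists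
  have ht : IsTau21 M p (tau21 M p) := by
    rw [tau21, dif_pos hex]; exact hex.choose_spec
  rw [h.isTau21_iff hρ hp] at ht
  simp only [Tau21Graph, eq_toQ_iff hρ hp, ht]
  constructor
  · rintro ⟨h3, h2, h1, h, e⟩; exact ⟨h3, h2, h1, h, e.symm⟩
  · rintro ⟨h3, h2, h1, h, e⟩; exact ⟨h3, h2, h1, h, e.symm⟩

theorem tau21ExtGraph_iff (hρ : IsDefiningFunction M p ρ) (hp : p ∈ M) (h : HasModel M p ρ Ψ R)
    {v3 v2 v1 u : CVec n} : Tau21ExtGraph M p v3 v2 v1 u ↔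
      v3 ∈ cH M p ∧ v2 ∈ cK M p ∧ v1 ∈ cK M p ∧ u ∈ cT M p ∧
      Complex.I * cd (rc ρ) p (u.1, 0) =
        -Complex.I * (cd (cd (cd (rc R))) 0 v3 (v2.1, 0) (0, v1.2) -
          cd (cd (cd (rc R))) 0 v3 (v1.1, 0) (0, v2.2)) := by
  have hex := (h.existsUnique_isTau21Ext hρ hp).exists
  have ht : IsTau21Ext M p (tau21Ext M p) := by
    rw [tau21Ext, dif_pos hex]; exact hex.choose_spec
  rw [h.isTau21Ext_iff hρ hp] at ht
  simp only [Tau21ExtGraph, eq_toQ_iff hρ hp, ht]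
  constructor
  · rintro ⟨h3, h2, h1, h, e⟩; exact ⟨h3, h2, h1, h, e.symm⟩
  · rintro ⟨h3, h2, h1, h, e⟩; exact ⟨h3, h2, h1, h, e.symm⟩

/-- The two cubic tensors agree up to the constant `i` on their common domain. -/
theorem agreement (hρ : IsDefiningFunction M p ρ) (hp : p ∈ M) (h : HasModel M p ρ Ψ R)
    {v3 v2 v1 u : CVec n} (ht : Tau3Graph M p v3 v2 v1 u) :
    (v3 ∈ cH M p → Tau21ExtGraph M p v3 v2 v1 (Complex.I • u)) ∧
      (v3 ∈ H10 M p → Tau21Graph M p v3 v2 v1 (Complex.I • u)) := by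
  rw [h.tau3Graph_iff hρ hp] at ht
  rw [h.tau21Graph_iff hρ hp, h.tau21ExtGraph_iff hρ hp]
  obtain ⟨h3, h2, h1, hu, e⟩ := ht
  have e0 : (((Complex.I • u).1, 0) : CVec n) = Complex.I • ((u.1, 0) : CVec n) := by simp
  have z0 : ((0, 0) : CVec n) = 0 := rfl
  refine ⟨fun hv => ⟨hv, K10_le_cK h2, K01_le_cK h1, (cT M p).smul_mem _ hu, ?_⟩,
    fun hv => ⟨hv, K10_le_H10 h2, h1, (cT M p).smul_mem _ hu, ?_⟩⟩
  · rw [e0, map_smul, smul_eq_mul, e, eq_of_mem_H10 (K10_le_H10 h2),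
      eq_of_mem_H01 (K01_le_H01 h1), fst_eq_zero_of_mem_H01 (K01_le_H01 h1), z0, map_zero]
    simp
  · rw [e0, map_smul, smul_eq_mul, e]
    ring

end HasModel

end

/-! ### Third order jets -/

section

variable {n : ℕ}

/-- `f` is smooth on `ℂⁿ`, and its value and its first three complexified derivatives at the
origin are `c`, `d1`, `d2` and `d3`. -/
structure HasJet (f : Cn n → ℂ) (c : ℂ) (d1 : CVec n → ℂ) (d2 : CVec n → CVec n → ℂ)
    (d3 : CVec n → CVec n → CVec n → ℂ) : Prop where
  smooth : ContDiff ℝ ∞ f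
  val : f 0 = c
  first : ∀ v, cd f 0 v = d1 v
  second : ∀ v w, cd (cd f) 0 v w = d2 v w
  third : ∀ v w u, cd (cd (cd f)) 0 v w u = d3 v w u

namespace HasJet

variable {f g : Cn n → ℂ} {c c' : ℂ} {d1 d1' : CVec n → ℂ} {d2 d2' : CVec n → CVec n → ℂ}
  {d3 d3' : CVec n → CVec n → CVec n → ℂ}

theorem of_eq (h : HasJet f c d1 d2 d3) (hc : c = c') (h1 : ∀ v, d1 v = d1' v)
    (h2 : ∀ v w, d2 v w = d2' v w) (h3 : ∀ v w u, d3 v w u = d3' v w u) :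
    HasJet f c' d1' d2' d3' := by
  obtain rfl := hc
  obtain rfl : d1 = d1' := funext h1
  obtain rfl : d2 = d2' := funext₂ h2
  obtain rfl : d3 = d3' := by funext v w u; exact h3 v w u
  exact h

theorem zero : HasJet (fun _ : Cn n => 0) 0 (fun _ => 0) (fun _ _ => 0) (fun _ _ _ => 0) := by
  have h1 : cd (fun _ : Cn n => (0 : ℂ)) = fun _ => 0 := funext fun x => cd_const 0 x
  have h2 : cd (fun _ : Cn n => (0 : CVec n →L[ℂ] ℂ)) = fun _ => 0 := funext fun x => cd_const 0 x
  refine ⟨contDiff_const, rfl, fun v => ?_, fun v w => ?_, fun v w u => ?_⟩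
  · rw [h1]; rfl
  · rw [h1, cd_const]; rfl
  · rw [h1, h2, cd_const]; rfl

theorem add (hf : HasJet f c d1 d2 d3) (hg : HasJet g c' d1' d2' d3') :
    HasJet (fun x => f x + g x) (c + c') (fun v => d1 v + d1' v) (fun v w => d2 v w + d2' v w)
      (fun v w u => d3 v w u + d3' v w u) := by
  have F (x : Cn n) : SmAt f x := hf.smooth.smAt
  have G (x : Cn n) : SmAt g x := hg.smooth.smAt
  have e1 : cd (fun x => f x + g x) = fun x => cd f x + cd g x :=
    funext fun x => cd_add (F x).differentiableAt (G x).differentiableAt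
  have e2 : cd (fun x => cd f x + cd g x) = fun x => cd (cd f) x + cd (cd g) x :=
    funext fun x => cd_add (F x).cd.differentiableAt (G x).cd.differentiableAt
  refine ⟨hf.smooth.add hg.smooth, by rw [hf.val, hg.val], fun v => ?_, fun v w => ?_,
    fun v w u => ?_⟩
  · simp [e1, hf.first, hg.first]
  · simp [e1, e2, hf.second, hg.second]
  · rw [e1, e2, cd_add (F 0).cd.cd.differentiableAt (G 0).cd.cd.differentiableAt]
    simp [hf.third, hg.third]

theorem sum {ι : Type*} (s : Finset ι) {f : ι → Cn n → ℂ} {c : ι → ℂ} {d1 : ι → CVec n → ℂ}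
    {d2 : ι → CVec n → CVec n → ℂ} {d3 : ι → CVec n → CVec n → CVec n → ℂ}
    (h : ∀ i ∈ s, HasJet (f i) (c i) (d1 i) (d2 i) (d3 i)) :
    HasJet (fun x => ∑ i ∈ s, f i x) (∑ i ∈ s, c i) (fun v => ∑ i ∈ s, d1 i v)
      (fun v w => ∑ i ∈ s, d2 i v w) (fun v w u => ∑ i ∈ s, d3 i v w u) := by
  classical
  induction s using Finset.induction_on with
  | empty => simpa using zero
  | insert i s hi ih =>
    simp only [Finset.sum_insert hi]
    exact (h i (Finset.mem_insert_self i s)).add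
      (ih fun j hj => h j (Finset.mem_insert_of_mem hj))

/-- The Leibniz rule for third order jets. -/
theorem mul (hf : HasJet f c d1 d2 d3) (hg : HasJet g c' d1' d2' d3') :
    HasJet (fun x => f x * g x) (c * c') (fun v => c * d1' v + d1 v * c')
      (fun v w => c * d2' v w + d1 v * d1' w + d1 w * d1' v + d2 v w * c')
      (fun v w u => c * d3' v w u + d1 v * d2' w u + d1 w * d2' v u + d1 u * d2' v w
        + d2 v w * d1' u + d2 v u * d1' w + d2 w u * d1' v + d3 v w u * c') := by
  have F (x : Cn n) : SmAt f x := hf.smooth.smAt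
  have G (x : Cn n) : SmAt g x := hg.smooth.smAt
  have H (x : Cn n) : SmAt (fun x => f x * g x) x := (hf.smooth.mul hg.smooth).smAt
  have e1 (u : CVec n) : (fun x => cd (fun x => f x * g x) x u) =
      fun x => f x * cd g x u + cd f x u * g x :=
    funext fun x => by
      rw [cd_mul (F x).differentiableAt (G x).differentiableAt, add_comm]
  have Fu (u : CVec n) (x : Cn n) : SmAt (fun x => cd f x u) x := (F x).cd.clmC_apply (smAt_const u)
  have Gu (u : CVec n) (x : Cn n) : SmAt (fun x => cd g x u) x := (G x).cd.clmC_apply (smAt_const u)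
  have k {f : Cn n → ℂ} (hf : ∀ x, SmAt f x) (w u : CVec n) (x : Cn n) :
      cd (fun x => cd f x u) x w = cd (cd f) x w u :=
    cd_clm_apply_const (hf x).cd.differentiableAt _ _
  have e2 (w u : CVec n) : (fun x => cd (cd fun x => f x * g x) x w u) =
      fun x => (f x * cd (cd g) x w u + cd f x w * cd g x u) +
        (cd f x u * cd g x w + cd (cd f) x w u * g x) :=
    funext fun x => by
      rw [← k H, e1, cd_add ((F x).mul (Gu u x)).differentiableAt
        ((Fu u x).mul (G x)).differentiableAt, add_apply,
        cd_mul (F x).differentiableAt (Gu u x).differentiableAt,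
        cd_mul (Fu u x).differentiableAt (G x).differentiableAt, k F, k G]
      ring
  have Fwu (w u : CVec n) (x : Cn n) : SmAt (fun x => cd (cd f) x w u) x :=
    ((F x).cd.cd.clmC_apply (smAt_const w)).clmC_apply (smAt_const u)
  have Gwu (w u : CVec n) (x : Cn n) : SmAt (fun x => cd (cd g) x w u) x :=
    ((G x).cd.cd.clmC_apply (smAt_const w)).clmC_apply (smAt_const u)
  refine ⟨hf.smooth.mul hg.smooth, by rw [hf.val, hg.val], fun v => ?_, fun v w => ?_,
    fun v w u => ?_⟩
  · rw [congrFun (e1 v) 0, hf.val, hg.val, hf.first, hg.first]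
  · rw [congrFun (e2 v w) 0, hf.val, hg.val, hf.first, hg.first, hf.first, hg.first, hf.second,
      hg.second]
    ring
  · rw [(H 0).cd_cd_cd_apply_const, e2]
    have s1 := (F 0).mul (Gwu w u 0)
    have s2 := (Fu w 0).mul (Gu u 0)
    have s3 := (Fu u 0).mul (Gu w 0)
    have s4 := (Fwu w u 0).mul (G 0)
    rw [cd_add (s1.add s2).differentiableAt (s3.add s4).differentiableAt,
      cd_add s1.differentiableAt s2.differentiableAt,
      cd_add s3.differentiableAt s4.differentiableAt]
    simp only [add_apply]
    rw [cd_mul (F 0).differentiableAt (Gwu w u 0).differentiableAt,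
      cd_mul (Fu w 0).differentiableAt (Gu u 0).differentiableAt,
      cd_mul (Fu u 0).differentiableAt (Gu w 0).differentiableAt,
      cd_mul (Fwu w u 0).differentiableAt (G 0).differentiableAt]
    simp only [k F, k G, ← (F 0).cd_cd_cd_apply_const,
      ← (G 0).cd_cd_cd_apply_const, hf.val, hg.val, hf.first, hg.first, hf.second,
      hg.second, hf.third, hg.third]
    ring

theorem const (c : ℂ) :
    HasJet (fun _ : Cn n => c) c (fun _ => 0) (fun _ _ => 0) (fun _ _ _ => 0) := by
  have h1 : cd (fun _ : Cn n => c) = fun _ => 0 := funext fun x => cd_const c x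
  have h2 : cd (fun _ : Cn n => (0 : CVec n →L[ℂ] ℂ)) = fun _ => 0 := funext fun x => cd_const 0 x
  refine ⟨contDiff_const, rfl, fun v => ?_, fun v w => ?_, fun v w u => ?_⟩
  · rw [h1]; rfl
  · rw [h1, cd_const]; rfl
  · rw [h1, h2, cd_const]; rfl

/-- A function with constant differential. -/
theorem of_cd_eq (hf : ContDiff ℝ ∞ f) (h0 : f 0 = 0) (h : ∀ x v, cd f x v = d1 v) :
    HasJet f 0 d1 (fun _ _ => 0) (fun _ _ _ => 0) := by
  have h1 : cd f = fun _ => cd f 0 := by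
    funext x; ext v <;> simp [h]
  have h2 : cd (fun _ : Cn n => cd f 0) = fun _ => 0 := funext fun x => cd_const _ x
  have h3 : cd (fun _ : Cn n => (0 : CVec n →L[ℂ] CVec n →L[ℂ] ℂ)) = fun _ => 0 :=
    funext fun x => cd_const 0 x
  refine ⟨hf, h0, h 0, fun v w => ?_, fun v w u => ?_⟩
  · rw [h1, h2]; rfl
  · rw [h1, h2, h3]; rfl

theorem clm (L : Cn n →L[ℂ] ℂ) :
    HasJet (fun x => L x) 0 (fun v => L v.1) (fun _ _ => 0) (fun _ _ _ => 0) :=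
  of_cd_eq (L.restrictScalars ℝ).contDiff (map_zero L) fun x v => cd_clm L x v

end HasJet

end

/-! ### Model polynomials and their jets -/

section

variable {n q r : ℕ}

/-- The coefficients of a model polynomial of degree three in the coordinates
`(w, z₂, z₃) ∈ ℂ × ℂ^q × ℂ^r`. In contrast to `CubicData`, the term of the form
`z₃ z̄₃ u` is given by the Hermitian part of an arbitrary matrix `h`. -/
structure ModelData (q r : ℕ) where
  /-- the signs of the quadratic part -/
  sgn : Fin q → ℝ
  sgn_mem : ∀ j, sgn j = 1 ∨ sgn j = -1
  /-- coefficients of `z₂ z₂ z̄₃` -/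
  a : Fin q → Fin q → Fin r → ℂ
  /-- coefficients of `z₂ z₃ z̄₃` -/
  b : Fin q → Fin r → Fin r → ℂ
  /-- coefficients of `z₃ z₃ z̄₃` -/
  c : Fin r → Fin r → Fin r → ℂ
  /-- coefficients of `z₃ z̄₃ u` -/
  h : Fin r → Fin r → ℂ

/-- The quadratic form `∑ ± |z₂ⱼ|²`. -/
def quad (sgn : Fin q → ℝ) (z2 : Fin q → ℂ) : ℝ := ∑ j, sgn j * ‖z2 j‖ ^ 2

/-- The polynomial `φ²¹` with given coefficients. -/
def cub21 (a : Fin q → Fin q → Fin r → ℂ) (b : Fin q → Fin r → Fin r → ℂ)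
    (c : Fin r → Fin r → Fin r → ℂ) (z2 : Fin q → ℂ) (z3 : Fin r → ℂ) : ℂ :=
  (∑ j, ∑ k, ∑ l, a j k l * z2 j * z2 k * star (z3 l)) +
  (∑ j, ∑ k, ∑ l, b j k l * z2 j * z3 k * star (z3 l)) +
  (∑ j, ∑ k, ∑ l, c j k l * z3 j * z3 k * star (z3 l))

/-- The Hermitian form `Re ∑ hⱼₖ zⱼ z̄ₖ` of the Hermitian part of a matrix. -/
def herm (h : Fin r → Fin r → ℂ) (z : Fin r → ℂ) : ℝ :=
  (∑ j, ∑ k, h j k * z j * star (z k)).re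

namespace ModelData

/-- The cubic part of the model polynomial, as a function of `z₂`, `z₃` and `u`. -/
def cubic (J : ModelData q r) (z2 : Fin q → ℂ) (z3 : Fin r → ℂ) (u : ℝ) : ℝ :=
  2 * (cub21 J.a J.b J.c z2 z3).re + herm J.h z3 * u

/-- The model function `-2 Re w + φ² + φ³` with `u = -2 Im w`. -/
def model (J : ModelData q r) (y : ℂ × (Fin q → ℂ) × (Fin r → ℂ)) : ℝ :=
  -2 * y.1.re + quad J.sgn y.2.1 + J.cubic y.2.1 y.2.2 (-2 * y.1.im)

end ModelData

/-- The model data of a cubic normal form, with a diagonal matrix `h`. -/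
def CubicData.toModelData (D : CubicData q r) : ModelData q r where
  sgn := D.sgn
  sgn_mem := D.sgn_mem
  a := D.a
  b := D.b
  c := D.c
  h j k := if j = k then (D.eps j : ℂ) else 0

theorem CubicData.cubic_toModelData (D : CubicData q r) (z2 : Fin q → ℂ) (z3 : Fin r → ℂ) (u : ℝ) :
    D.toModelData.cubic z2 z3 u = D.phi3 z2 z3 u := by
  simp only [ModelData.cubic, CubicData.phi3, CubicData.phi111, herm, toModelData, ite_mul, zero_mul,
    Finset.sum_ite_eq, Finset.mem_univ, if_true, Complex.re_sum, Finset.sum_mul]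
  congr 1
  refine Finset.sum_congr rfl fun j _ => ?_
  rw [mul_assoc, Complex.re_ofReal_mul, Complex.star_def, Complex.mul_conj, Complex.ofReal_re,
    Complex.normSq_eq_norm_sq]

section Jet

namespace HasJet

variable {f g k : Cn n → ℂ} {c : ℂ} {d1 l m s : CVec n → ℂ} {d2 : CVec n → CVec n → ℂ}
  {d3 : CVec n → CVec n → CVec n → ℂ}

protected theorem star (hf : HasJet f c d1 d2 d3) :
    HasJet (fun x => star (f x)) (star c) (fun v => star (d1 (conjVec n v)))
      (fun v w => star (d2 (conjVec n v) (conjVec n w)))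
      (fun v w u => star (d3 (conjVec n v) (conjVec n w) (conjVec n u))) := by
  have F (x : Cn n) : SmAt f x := hf.smooth.smAt
  have H (x : Cn n) : SmAt (fun x => star (f x)) x := (F x).star
  have e {f : Cn n → ℂ} (hf : ∀ x, SmAt f x) (u : CVec n) :
      (fun x => cd (fun x => star (f x)) x u) = fun x => star (cd f x (conjVec n u)) :=
    funext fun x => cd_star (hf x).differentiableAt u
  have Fu (u : CVec n) (x : Cn n) : SmAt (fun x => cd f x u) x := (F x).cd.clmC_apply (smAt_const u)
  have k {f : Cn n → ℂ} (hf : ∀ x, SmAt f x) (w u : CVec n) (x : Cn n) :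
      cd (fun x => cd f x u) x w = cd (cd f) x w u :=
    cd_clm_apply_const (hf x).cd.differentiableAt _ _
  have e2 (w u : CVec n) : (fun x => cd (cd fun x => star (f x)) x w u) =
      fun x => star (cd (cd f) x (conjVec n w) (conjVec n u)) :=
    funext fun x => by
      rw [← k H, e F, congrFun (e (Fu (conjVec n u)) w) x, k F]
  have Fwu (w u : CVec n) (x : Cn n) : SmAt (fun x => cd (cd f) x w u) x :=
    ((F x).cd.cd.clmC_apply (smAt_const w)).clmC_apply (smAt_const u)
  refine ⟨(starL' ℝ : ℂ ≃L[ℝ] ℂ).contDiff.comp hf.smooth, by rw [hf.val], fun v => ?_, fun v w => ?_,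
    fun v w u => ?_⟩
  · rw [congrFun (e F v) 0, hf.first]
  · rw [congrFun (e2 v w) 0, hf.second]
  · rw [(H 0).cd_cd_cd_apply_const, e2, congrFun (e (Fwu (conjVec n w) (conjVec n u)) v) 0,
      ← (F 0).cd_cd_cd_apply_const, hf.third]

/-- The product of two linear functions. -/
theorem mul_linear (hf : HasJet f 0 l (fun _ _ => 0) fun _ _ _ => 0)
    (hg : HasJet g 0 m (fun _ _ => 0) fun _ _ _ => 0) :
    HasJet (fun x => f x * g x) 0 (fun _ => 0) (fun v w => l v * m w + l w * m v)
      (fun _ _ _ => 0) :=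
  (hf.mul hg).of_eq (by simp) (by simp) (by simp) (by simp)

/-- A linear function times a quadratic form. -/
theorem mul_quadratic (hf : HasJet f 0 (fun _ => 0) d2 fun _ _ _ => 0)
    (hg : HasJet g 0 l (fun _ _ => 0) fun _ _ _ => 0) :
    HasJet (fun x => f x * g x) 0 (fun _ => 0) (fun _ _ => 0)
      (fun v w u => d2 v w * l u + d2 v u * l w + d2 w u * l v) :=
  (hf.mul hg).of_eq (by simp) (by simp) (by simp) (by simp)

theorem const_mul (hf : HasJet f c d1 d2 d3) (e : ℂ) :
    HasJet (fun x => e * f x) (e * c) (fun v => e * d1 v) (fun v w => e * d2 v w)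
      (fun v w u => e * d3 v w u) :=
  ((const e).mul hf).of_eq (by simp) (by simp) (by simp) (by simp)

/-- The product of three linear functions. -/
theorem mul_linear₃ (hf : HasJet f 0 l (fun _ _ => 0) fun _ _ _ => 0)
    (hg : HasJet g 0 m (fun _ _ => 0) fun _ _ _ => 0)
    (hk : HasJet k 0 s (fun _ _ => 0) fun _ _ _ => 0) (e : ℂ) :
    HasJet (fun x => e * f x * g x * k x) 0 (fun _ => 0) (fun _ _ => 0)
      (fun v w u => e * ((l v * m w + l w * m v) * s u + (l v * m u + l u * m v) * s w +
        (l w * m u + l u * m w) * s v)) := by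
  have h := ((hf.mul_linear hg).mul_quadratic hk).const_mul e
  simp only [mul_zero] at h
  have e1 : (fun x => e * f x * g x * k x) = fun x => e * (f x * g x * k x) := by
    funext x; ring
  rw [e1]
  exact h

end HasJet

variable (L : Cn n →L[ℂ] ℂ × (Fin q → ℂ) × (Fin r → ℂ))

theorem hasJet_w : HasJet (fun x => (L x).1) 0 (fun v => (L v.1).1) (fun _ _ => 0)
    (fun _ _ _ => 0) :=
  HasJet.clm ((ContinuousLinearMap.fst ℂ ℂ ((Fin q → ℂ) × (Fin r → ℂ))).comp L)

theorem hasJet_z2 (j : Fin q) : HasJet (fun x => (L x).2.1 j) 0 (fun v => (L v.1).2.1 j)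
    (fun _ _ => 0) (fun _ _ _ => 0) :=
  HasJet.clm ((ContinuousLinearMap.proj (R := ℂ) (φ := fun _ : Fin q => ℂ) j).comp
    ((ContinuousLinearMap.fst ℂ _ _).comp ((ContinuousLinearMap.snd ℂ _ _).comp L)))

theorem hasJet_z3 (j : Fin r) : HasJet (fun x => (L x).2.2 j) 0 (fun v => (L v.1).2.2 j)
    (fun _ _ => 0) (fun _ _ _ => 0) :=
  HasJet.clm ((ContinuousLinearMap.proj (R := ℂ) (φ := fun _ : Fin r => ℂ) j).comp
    ((ContinuousLinearMap.snd ℂ _ _).comp ((ContinuousLinearMap.snd ℂ _ _).comp L)))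

theorem HasJet.star_linear {f : Cn n → ℂ} {l : CVec n → ℂ}
    (hf : HasJet f 0 l (fun _ _ => 0) fun _ _ _ => 0) :
    HasJet (fun x => star (f x)) 0 (fun v => star (l (conjVec n v))) (fun _ _ => 0)
      fun _ _ _ => 0 :=
  hf.star.of_eq (by simp) (by simp) (by simp) (by simp)

/-- The jet of `φ²¹`. The directions `(z₂, z₃), (z₂, z₃), z̄₃` recover the values of the
polynomial, because it is quadratic in `(z₂, z₃)` and linear in `z̄₃`. -/
theorem exists_hasJet_cub21 (a : Fin q → Fin q → Fin r → ℂ) (b : Fin q → Fin r → Fin r → ℂ)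
    (c : Fin r → Fin r → Fin r → ℂ) :
    ∃ d3, HasJet (fun x => cub21 a b c (L x).2.1 (L x).2.2) 0 (fun _ => 0) (fun _ _ => 0) d3 ∧
      (∀ X Y z2 z3, (L X).2 = (z2, z3) → (L (star Y)).2 = (0, z3) →
        d3 (X, 0) (X, 0) (0, Y) = 2 * cub21 a b c z2 z3) ∧
      (∀ X Y w, d3 (0, X) (0, Y) w = 0) ∧
      (∀ v w u, (L v.1).2 = 0 → (L (star v.2)).2 = 0 → d3 v w u = 0) := by
  have hs3 (j : Fin r) := (hasJet_z3 L j).star_linear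
  have h1 := HasJet.sum Finset.univ fun j _ => HasJet.sum Finset.univ fun k _ =>
    HasJet.sum Finset.univ fun l _ =>
      (hasJet_z2 L j).mul_linear₃ (hasJet_z2 L k) (hs3 l) (a j k l)
  have h2 := HasJet.sum Finset.univ fun j _ => HasJet.sum Finset.univ fun k _ =>
    HasJet.sum Finset.univ fun l _ =>
      (hasJet_z2 L j).mul_linear₃ (hasJet_z3 L k) (hs3 l) (b j k l)
  have h3 := HasJet.sum Finset.univ fun j _ => HasJet.sum Finset.univ fun k _ =>
    HasJet.sum Finset.univ fun l _ =>
      (hasJet_z3 L j).mul_linear₃ (hasJet_z3 L k) (hs3 l) (c j k l)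
  refine ⟨_, ((h1.add h2).add h3).of_eq (by simp) (by simp) (by simp) fun _ _ _ => rfl, ?_, ?_, ?_⟩
  · intro X Y z2 z3 hX hY
    have e1 : (L X).2.1 = z2 := by rw [hX]
    have e2 : (L X).2.2 = z3 := by rw [hX]
    have e3 : (L (star Y)).2.2 = z3 := by rw [hY]
    simp only [conjVec_fst, star_zero, map_zero, Prod.snd_zero, Prod.fst_zero,
      Pi.zero_apply, e1, e2, e3, cub21, mul_add, Finset.mul_sum]
    refine congr_arg₂ _ (congr_arg₂ _ ?_ ?_) ?_ <;>
    · refine Finset.sum_congr rfl fun j _ => Finset.sum_congr rfl fun k _ =>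
        Finset.sum_congr rfl fun l _ => ?_
      ring
  · intro X Y w
    simp
  · intro v w u hv1 hv2
    simp [hv1, hv2]

/-- The jet of `herm h z₃ · u` with `u = -2 Im w`. The direction `w = i` is a real tangent vector
with `∂u = -2`. -/
theorem exists_hasJet_herm (h : Fin r → Fin r → ℂ) :
    ∃ d3, HasJet (fun x => ((herm h (L x).2.2 * (-2 * (L x).1.im) : ℝ) : ℂ)) 0 (fun _ => 0)
        (fun _ _ => 0) d3 ∧
      (∀ X Y z3, (L X) = (Complex.I, 0, 0) → (L Y) = (0, 0, z3) →
        d3 (X, star X) (Y, 0) (0, star Y) = -2 * herm h z3) ∧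
      (∀ v w u : CVec n, (∀ x ∈ ({v, w, u} : Set (CVec n)), (L x.1).1 = 0 ∧ (L (star x.2)).1 = 0) →
        d3 v w u = 0) := by
  have h1 := HasJet.sum Finset.univ fun j _ => HasJet.sum Finset.univ fun k _ =>
      ((hasJet_z3 L j).mul_linear ((hasJet_z3 L k).star_linear)).const_mul (h j k)
  have h1' := h1.of_eq (c' := 0) (d1' := fun _ => 0) (d3' := fun _ _ _ => 0) (by simp) (by simp)
    (fun _ _ => rfl) (by simp)
  have h2 := h1'.star.of_eq (c' := 0) (d1' := fun _ => 0) (d3' := fun _ _ _ => 0) (by simp) (by simp)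
    (fun _ _ => rfl) (by simp)
  have h3 := ((h1'.add h2).const_mul (1 / 2)).of_eq (c' := 0) (d1' := fun _ => 0)
    (d3' := fun _ _ _ => 0) (by simp) (by simp) (fun _ _ => rfl) (by simp)
  have h4 := ((hasJet_w L).add ((hasJet_w L).star_linear.const_mul (-1))).const_mul Complex.I
  have h5 := h4.of_eq (c' := 0) (d2' := fun _ _ => 0)
    (d3' := fun _ _ _ => 0) (by simp) (fun _ => rfl) (by simp) (by simp)
  have h6 := h3.mul_quadratic h5
  have e : (fun x => ((herm h (L x).2.2 * (-2 * (L x).1.im) : ℝ) : ℂ)) = fun x =>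
      (1 / 2) * ((∑ j, ∑ k, h j k * ((L x).2.2 j * star ((L x).2.2 k))) +
        star (∑ j, ∑ k, h j k * ((L x).2.2 j * star ((L x).2.2 k)))) *
        (Complex.I * ((L x).1 + (-1) * star (L x).1)) := by
    funext x
    simp only [herm, mul_assoc]
    generalize (∑ j, ∑ k, h j k * ((L x).2.2 j * star ((L x).2.2 k))) = S
    rw [Complex.star_def, Complex.add_conj, neg_one_mul, ← sub_eq_add_neg,
      Complex.sub_conj]
    push_cast
    linear_combination (-2 * (S.re : ℂ) * ((L x).1.im : ℂ)) * Complex.I_mul_I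
  refine ⟨_, e ▸ h6, ?_, ?_⟩
  · intro X Y z3 hX hY
    simp only [conjVec_fst, conjVec_snd, star_star, hX, hY, star_zero, map_zero, Prod.fst_zero,
      Prod.snd_zero, Pi.zero_apply, herm, mul_zero, zero_mul, add_zero, zero_add,
      Finset.sum_const_zero]
    have e1 : (∑ x, ∑ y, h x y * (z3 x * star (z3 y))) = ∑ x, ∑ y, h x y * z3 x * star (z3 y) := by
      simp only [mul_assoc]
    rw [e1]
    generalize (∑ x, ∑ y, h x y * z3 x * star (z3 y)) = S
    rw [Complex.star_def, Complex.add_conj, Complex.conj_I]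
    push_cast
    linear_combination (2 * (S.re : ℂ)) * Complex.I_mul_I
  · intro v w u hx
    obtain ⟨a1, a2⟩ := hx v (by simp)
    obtain ⟨b1, b2⟩ := hx w (by simp)
    obtain ⟨c1, c2⟩ := hx u (by simp)
    simp only [conjVec_fst, conjVec_snd, a1, a2, b1, b2, c1, c2]
    simp

theorem hasJet_quadratic (sgn : Fin q → ℝ) :
    HasJet (fun x => ((-2 * (L x).1.re + quad sgn (L x).2.1 : ℝ) : ℂ)) 0
      (fun v => -((L v.1).1 + star (L (star v.2)).1))
      (fun v w => ∑ j, (sgn j : ℂ) * ((L v.1).2.1 j * star ((L (star w.2)).2.1 j) +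
        (L w.1).2.1 j * star ((L (star v.2)).2.1 j))) (fun _ _ _ => 0) := by
  have h1 := HasJet.sum Finset.univ fun j _ =>
      ((hasJet_z2 L j).mul_linear ((hasJet_z2 L j).star_linear)).const_mul (sgn j : ℂ)
  have h2 := ((hasJet_w L).add (hasJet_w L).star_linear).const_mul (-1)
  have e : (fun x => ((-2 * (L x).1.re + quad sgn (L x).2.1 : ℝ) : ℂ)) = fun x =>
      -1 * ((L x).1 + star (L x).1) + ∑ j, (sgn j : ℂ) * ((L x).2.1 j * star ((L x).2.1 j)) := by
    funext x
    rw [Complex.star_def, Complex.add_conj]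
    simp only [quad, Complex.mul_conj, Complex.normSq_eq_norm_sq]
    push_cast
    ring
  rw [e]
  refine (h2.add h1).of_eq (by simp) (fun v => ?_) (fun v w => ?_) (by simp)
  · simp
  · simp

/-- The third order jet of a model polynomial. -/
theorem exists_hasJet_model (J : ModelData q r) :
    ∃ d3, HasJet (rc fun x => J.model (L x)) 0 (fun v => -((L v.1).1 + star (L (star v.2)).1))
        (fun v w => ∑ j, (J.sgn j : ℂ) * ((L v.1).2.1 j * star ((L (star w.2)).2.1 j) +
          (L w.1).2.1 j * star ((L (star v.2)).2.1 j))) d3 ∧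
      HasJet (fun x => ((J.cubic (L x).2.1 (L x).2.2 (-2 * (L x).1.im) : ℝ) : ℂ)) 0 (fun _ => 0)
        (fun _ _ => 0) d3 ∧
      (∀ X Y z2 z3, L X = (0, z2, z3) → L (star Y) = (0, 0, z3) →
        d3 (X, 0) (X, 0) (0, Y) = 2 * cub21 J.a J.b J.c z2 z3) ∧
      (∀ X Y z3, L X = (Complex.I, 0, 0) → L Y = (0, 0, z3) →
        d3 (X, star X) (Y, 0) (0, star Y) = -2 * herm J.h z3) := by
  obtain ⟨d, hd, d1, d2, d4⟩ := exists_hasJet_cub21 L J.a J.b J.c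
  obtain ⟨e, he, e1, e2⟩ := exists_hasJet_herm L J.h
  have hd' := hd.star
  have hc := (hd.add hd').add he
  have eq : (fun x => ((J.cubic (L x).2.1 (L x).2.2 (-2 * (L x).1.im) : ℝ) : ℂ)) = fun x =>
      cub21 J.a J.b J.c (L x).2.1 (L x).2.2 + star (cub21 J.a J.b J.c (L x).2.1 (L x).2.2) +
        ((herm J.h (L x).2.2 * (-2 * (L x).1.im) : ℝ) : ℂ) := by
    funext x
    rw [Complex.star_def, Complex.add_conj]
    simp only [ModelData.cubic]
    push_cast
    ring
  have hc' := (eq ▸ hc).of_eq (c' := 0) (d1' := fun _ => 0) (d2' := fun _ _ => 0) (by simp)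
    (by simp) (by simp) (fun _ _ _ => rfl)
  have hm := (hasJet_quadratic L J.sgn).add hc'
  have eq2 : (rc fun x => J.model (L x)) = fun x =>
      ((-2 * (L x).1.re + quad J.sgn (L x).2.1 : ℝ) : ℂ) +
        ((J.cubic (L x).2.1 (L x).2.2 (-2 * (L x).1.im) : ℝ) : ℂ) := by
    funext x
    simp [rc, ModelData.model]
  refine ⟨_, (eq2 ▸ hm).of_eq (by simp) (by simp) (by simp) (fun v w u => zero_add _), hc', ?_, ?_⟩
  · intro X Y z2 z3 hX hY
    rw [d1 X Y z2 z3 (by rw [hX]) (by rw [hY]), e2]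
    · have : (conjVec n) ((X, 0) : CVec n) = (0, star X) := by ext <;> simp
      rw [this, d2]
      simp
    · simp [hX, hY]
  · intro X Y z3 hX hY
    rw [e1 X Y z3 hX hY, d4 _ _ _ (by simp [hX]) (by simp [hX]),
      d4 _ _ _ (by simp [hX]) (by simp [hX])]
    simp

end Jet

end

/-! ### Normalisation of quadratic and cubic forms -/

section

/-- The space of the coordinates `(w, z₂, z₃)`. -/
abbrev ModelSpace (q r : ℕ) := ℂ × (Fin q → ℂ) × (Fin r → ℂ)

variable {q r : ℕ}

/-- The coordinates of the model space. -/
def coord : Unit ⊕ Fin q ⊕ Fin r → ModelSpace q r →L[ℂ] ℂ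
  | .inl _ => ContinuousLinearMap.fst ℂ _ _
  | .inr (.inl j) => (ContinuousLinearMap.proj (R := ℂ) (φ := fun _ : Fin q => ℂ) j).comp
    ((ContinuousLinearMap.fst ℂ _ _).comp (ContinuousLinearMap.snd ℂ _ _))
  | .inr (.inr j) => (ContinuousLinearMap.proj (R := ℂ) (φ := fun _ : Fin r => ℂ) j).comp
    ((ContinuousLinearMap.snd ℂ _ _).comp (ContinuousLinearMap.snd ℂ _ _))

@[simp] theorem coord_inl (i : Unit) (y : ModelSpace q r) : coord (.inl i) y = y.1 := rfl
@[simp] theorem coord_inr_inl (j : Fin q) (y : ModelSpace q r) :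
    coord (.inr (.inl j)) y = y.2.1 j := rfl
@[simp] theorem coord_inr_inr (j : Fin r) (y : ModelSpace q r) :
    coord (.inr (.inr j)) y = y.2.2 j := rfl

/-- The coordinate vectors of the model space. -/
def coordVec : Unit ⊕ Fin q ⊕ Fin r → ModelSpace q r
  | .inl _ => (1, 0, 0)
  | .inr (.inl j) => (0, Pi.single j 1, 0)
  | .inr (.inr j) => (0, 0, Pi.single j 1)

theorem sum_coord_smul (y : ModelSpace q r) : ∑ i, coord i y • coordVec i = y := by
  rw [Fintype.sum_sum_type, Fintype.sum_sum_type]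
  refine Prod.ext ?_ (Prod.ext ?_ ?_)
  · simp [coordVec, Prod.fst_sum]
  · funext k
    simp [coordVec, Prod.fst_sum, Prod.snd_sum, Finset.sum_apply, Pi.single_apply]
  · funext k
    simp [coordVec, Prod.snd_sum, Finset.sum_apply, Pi.single_apply]

/-- The coordinates of the model space and, for the flag `true`, their conjugates. -/
def letter (l : (Unit ⊕ Fin q ⊕ Fin r) × Bool) (y : ModelSpace q r) : ℂ :=
  if l.2 then star (coord l.1 y) else coord l.1 y

/-- The splitting of a real linear map into its complex linear and antilinear parts. -/
theorem real_linear_apply_smul {E F : Type*} [NormedAddCommGroup E] [NormedSpace ℂ E]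
    [NormedAddCommGroup F] [NormedSpace ℝ F]
    [NormedSpace ℂ F] [IsScalarTower ℝ ℂ F] [NormedSpace ℝ E] [IsScalarTower ℝ ℂ E]
    (f : E →L[ℝ] F) (c : ℂ) (e : E) :
    f (c • e) = c • (1 / 2 : ℂ) • (f e - Complex.I • f (Complex.I • e)) +
      star c • (1 / 2 : ℂ) • (f e + Complex.I • f (Complex.I • e)) := by
  have h : c • e = c.re • e + c.im • (Complex.I • e) := by
    conv_lhs => rw [← Complex.re_add_im c, add_smul, mul_smul]
    rw [← algebraMap_smul ℂ c.re e, ← algebraMap_smul ℂ c.im (Complex.I • e)]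
    rfl
  rw [h, map_add, map_smul, map_smul, ← algebraMap_smul ℂ c.re (f e),
    ← algebraMap_smul ℂ c.im (f (Complex.I • e))]
  have hc : c = (c.re : ℂ) + (c.im : ℂ) * Complex.I := (Complex.re_add_im c).symm
  have hs : star c = (c.re : ℂ) - (c.im : ℂ) * Complex.I := by
    apply Complex.ext <;> simp
  rw [hs]
  clear hs h
  simp only [Complex.coe_algebraMap]
  generalize f e = A
  generalize f (Complex.I • e) = B
  generalize (c.re : ℂ) = x at hc ⊢
  generalize (c.im : ℂ) = t at hc ⊢
  subst hc
  simp only [smul_sub, smul_add, smul_smul]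
  match_scalars
  · ring
  · linear_combination t * Complex.I_mul_I

/-- A real linear map on the model space is a polynomial in the coordinates and their
conjugates. -/
theorem exists_eq_sum_letter {F : Type*} [NormedAddCommGroup F] [NormedSpace ℝ F]
    [NormedSpace ℂ F] [IsScalarTower ℝ ℂ F] (f : ModelSpace q r →L[ℝ] F) :
    ∃ A : (Unit ⊕ Fin q ⊕ Fin r) × Bool → F, ∀ y, f y = ∑ l, letter l y • A l := by
  refine ⟨fun l => if l.2 then (1 / 2 : ℂ) • (f (coordVec l.1) +
    Complex.I • f (Complex.I • coordVec l.1)) else (1 / 2 : ℂ) • (f (coordVec l.1) -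
    Complex.I • f (Complex.I • coordVec l.1)), fun y => ?_⟩
  conv_lhs => rw [← sum_coord_smul y, map_sum]
  rw [Fintype.sum_prod_type]
  refine Finset.sum_congr rfl fun i _ => ?_
  rw [real_linear_apply_smul, Fintype.sum_bool]
  simp only [letter, if_true, Bool.false_eq_true, if_false]
  rw [add_comm]

section Induction

variable {P : (ModelSpace q r → ℝ) → Prop}

theorem sum_induction (h0 : P fun _ => 0) (hadd : ∀ f g, P f → P g → P fun y => f y + g y)
    {ι : Type*} (s : Finset ι) {f : ι → ModelSpace q r → ℝ} (hf : ∀ i ∈ s, P (f i)) :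
    P fun y => ∑ i ∈ s, f i y := by
  classical
  induction s using Finset.induction_on with
  | empty => simpa using h0
  | insert i s hi ih =>
    simp only [Finset.sum_insert hi]
    exact hadd _ _ (hf i (Finset.mem_insert_self i s))
      (ih fun j hj => hf j (Finset.mem_insert_of_mem hj))

/-- A class of functions closed under addition contains all quadratic forms if it contains the
monomials. -/
theorem quadratic_induction (h0 : P fun _ => 0) (hadd : ∀ f g, P f → P g → P fun y => f y + g y)
    (h1 : ∀ c i j, P fun y => (c * coord i y * coord j y).re)
    (h2 : ∀ c i j, P fun y => (c * coord i y * star (coord j y)).re)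
    (B : ModelSpace q r →L[ℝ] ModelSpace q r →L[ℝ] ℂ) : P fun y => (B y y).re := by
  obtain ⟨A, hA⟩ := exists_eq_sum_letter (F := ModelSpace q r →L[ℝ] ℂ) B
  choose C hC using fun l => exists_eq_sum_letter (A l)
  have e : (fun y => (B y y).re) = fun y => ∑ l, ∑ m, (letter l y * (letter m y * C l m)).re := by
    funext y
    rw [hA]
    simp only [sum_apply, smul_apply, hC, Complex.re_sum,
      smul_eq_mul, Finset.mul_sum]
  rw [e]
  refine sum_induction h0 hadd _ fun l _ => sum_induction h0 hadd _ fun m _ => ?_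
  obtain ⟨i, b⟩ := l
  obtain ⟨j, b'⟩ := m
  generalize C (i, b) (j, b') = c
  cases b <;> cases b'
  · convert h1 c i j using 3 with y
    simp [letter]; ring
  · convert h2 c i j using 3 with y
    simp [letter]; ring
  · convert h2 c j i using 3 with y
    simp [letter]; ring
  · convert h1 (star c) i j using 2 with y
    rw [← Complex.conj_re]
    simp [letter]; ring

/-- A class of functions closed under addition contains all cubic forms if it contains the
monomials. -/
theorem cubic_induction (h0 : P fun _ => 0) (hadd : ∀ f g, P f → P g → P fun y => f y + g y)
    (h1 : ∀ c i j k, P fun y => (c * coord i y * coord j y * coord k y).re)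
    (h2 : ∀ c i j k, P fun y => (c * coord i y * coord j y * star (coord k y)).re)
    (T : ModelSpace q r →L[ℝ] ModelSpace q r →L[ℝ] ModelSpace q r →L[ℝ] ℂ) :
    P fun y => (T y y y).re := by
  obtain ⟨A, hA⟩ := exists_eq_sum_letter
    (F := ModelSpace q r →L[ℝ] ModelSpace q r →L[ℝ] ℂ) T
  choose C hC using fun l => exists_eq_sum_letter (F := ModelSpace q r →L[ℝ] ℂ) (A l)
  choose D hD using fun l m => exists_eq_sum_letter (C l m)
  have e : (fun y => (T y y y).re) =
      fun y => ∑ l, ∑ m, ∑ k, (letter l y * (letter m y * (letter k y * D l m k))).re := by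
    funext y
    rw [hA]
    simp only [sum_apply, smul_apply, hC, hD, Complex.re_sum,
      smul_eq_mul, Finset.mul_sum]
  rw [e]
  refine sum_induction h0 hadd _ fun l _ => sum_induction h0 hadd _ fun m _ =>
    sum_induction h0 hadd _ fun k _ => ?_
  obtain ⟨i, b⟩ := l
  obtain ⟨j, b'⟩ := m
  obtain ⟨k, b''⟩ := k
  generalize D (i, b) (j, b') (k, b'') = c
  cases b <;> cases b' <;> cases b''
  · convert h1 c i j k using 3 with y
    simp [letter]; ring
  · convert h2 c i j k using 3 with y
    simp [letter]; ring
  · convert h2 c i k j using 3 with y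
    simp [letter]; ring
  · convert h2 (star c) j k i using 2 with y
    rw [← Complex.conj_re]
    simp [letter]; ring
  · convert h2 c j k i using 3 with y
    simp [letter]; ring
  · convert h2 (star c) i k j using 2 with y
    rw [← Complex.conj_re]
    simp [letter]; ring
  · convert h2 (star c) i j k using 2 with y
    rw [← Complex.conj_re]
    simp [letter]; ring
  · convert h1 (star c) i j k using 2 with y
    rw [← Complex.conj_re]
    simp [letter]; ring

end Induction

theorem isBigO_coord (i : Unit ⊕ Fin q ⊕ Fin r) :
    (fun y => coord i y) =O[𝓝 0] fun y : ModelSpace q r => ‖y‖ ^ 1 := by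
  simpa using ((coord i).isBigO_id (𝓝 0)).norm_right

theorem isBigO_mul_pow {E R : Type*} [NormedAddCommGroup E] [NormedRing R] {f g : E → R} {j k m : ℕ}
    (hf : f =O[𝓝 0] fun y => ‖y‖ ^ j) (hg : g =O[𝓝 0] fun y => ‖y‖ ^ k) (hm : m ≤ j + k) :
    (fun y => f y * g y) =O[𝓝 0] fun y => ‖y‖ ^ m := by
  refine isBigO_pow_mono hm ?_
  have := hf.mul hg
  simpa [pow_add] using this

theorem isBigO_star_pow {E : Type*} [NormedAddCommGroup E] {f : E → ℂ} {j : ℕ}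
    (hf : f =O[𝓝 0] fun y => ‖y‖ ^ j) : (fun y => star (f y)) =O[𝓝 0] fun y => ‖y‖ ^ j :=
  (Asymptotics.isBigO_of_le _ fun y => by simp).trans hf

theorem isBigO_re_pow {E : Type*} [NormedAddCommGroup E] {f : E → ℂ} {j : ℕ}
    (hf : f =O[𝓝 0] fun y => ‖y‖ ^ j) : (fun y => (f y).re) =O[𝓝 0] fun y => ‖y‖ ^ j :=
  (Asymptotics.isBigO_of_le _ fun y => by simpa using Complex.abs_re_le_norm (f y)).trans hf

theorem isBigO_im_pow {E : Type*} [NormedAddCommGroup E] {f : E → ℂ} {j : ℕ}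
    (hf : f =O[𝓝 0] fun y => ‖y‖ ^ j) : (fun y => (f y).im) =O[𝓝 0] fun y => ‖y‖ ^ j :=
  (Asymptotics.isBigO_of_le _ fun y => by simpa using Complex.abs_im_le_norm (f y)).trans hf

/-- The quadratic forms on the model space that are brought to a Hermitian form in `(z₂, z₃)` by the
change `w ↦ w + W` of `w` and multiplication of the defining function `-2 Re w + ⋯` by `1 + g`.
As `W` is homogeneous of degree two, it changes sign under `y ↦ i y`, which leaves the Hermitian
form fixed. -/
def IsNormal2 (P : ModelSpace q r → ℝ) : Prop :=
  ∃ (W : ModelSpace q r → ℂ) (g : ModelSpace q r →L[ℝ] ℝ) (H : Fin q ⊕ Fin r → Fin q ⊕ Fin r → ℂ),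
    AnalyticAt ℂ W 0 ∧ (W =O[𝓝 0] fun y => ‖y‖ ^ 2) ∧ (∀ y, W (Complex.I • y) = -W y) ∧
    ∀ y, P y = -2 * (W y).re + 2 * g y * y.1.re +
      (∑ j, ∑ k, H j k * coord (.inr j) y * star (coord (.inr k) y)).re

theorem isNormal2_zero : IsNormal2 fun _ : ModelSpace q r => 0 :=
  ⟨fun _ => 0, 0, 0, analyticAt_const, Asymptotics.isBigO_zero _ _, by simp, by simp⟩

theorem IsNormal2.add {P P' : ModelSpace q r → ℝ} (h : IsNormal2 P) (h' : IsNormal2 P') :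
    IsNormal2 fun y => P y + P' y := by
  obtain ⟨W, g, H, a, b, c, d⟩ := h
  obtain ⟨W', g', H', a', b', c', d'⟩ := h'
  refine ⟨fun y => W y + W' y, g + g', H + H', a.add a', b.add b', fun y => ?_, fun y => ?_⟩
  · simp only [c, c']; ring
  · simp only [d, d', Pi.add_apply, add_mul, Finset.sum_add_distrib, Complex.add_re, add_apply]
    ring

theorem isNormal2_holomorphic (c : ℂ) (i j : Unit ⊕ Fin q ⊕ Fin r) :
    IsNormal2 fun y => (c * coord i y * coord j y).re := by
  refine ⟨fun y => -(c / 2) * (coord i y * coord j y), 0, 0, ?_, ?_, ?_, ?_⟩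
  · exact analyticAt_const.mul (((coord i).analyticAt _).mul ((coord j).analyticAt _))
  · exact (isBigO_mul_pow (isBigO_coord i) (isBigO_coord j) le_rfl).const_mul_left _
  · intro y
    simp only [map_smul, smul_eq_mul]
    linear_combination (-(c / 2) * (coord i y * coord j y)) * Complex.I_mul_I
  · intro y
    have : c * coord i y * coord j y = (-2 : ℝ) * (-(c / 2) * (coord i y * coord j y)) := by
      push_cast; ring
    beta_reduce
    rw [this, Complex.re_ofReal_mul]
    simp

theorem isNormal2_mul_re (f : ModelSpace q r →L[ℂ] ℂ) : IsNormal2 fun y => (f y).re * y.1.re := by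
  refine ⟨fun _ => 0, (1 / 2 : ℝ) • (Complex.reCLM.comp (f.restrictScalars ℝ)), 0, analyticAt_const,
    Asymptotics.isBigO_zero _ _, by simp, fun y => ?_⟩
  simp

/-- Mixed terms with a factor `w` or `w̄` are removed, the remaining ones are kept. -/
theorem isNormal2_mixed (c : ℂ) (i j : Unit ⊕ Fin q ⊕ Fin r) :
    IsNormal2 fun y => (c * coord i y * star (coord j y)).re := by
  have key (c : ℂ) (i : Unit ⊕ Fin q ⊕ Fin r) :
      IsNormal2 fun y => (c * coord i y * star y.1).re := by
    -- the conjugate coordinate is `w̄ = 2 Re w - w`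
    convert (isNormal2_mul_re ((2 * c) • coord i)).add (isNormal2_holomorphic (-c) i (.inl ()))
      using 2 with y
    simp
    ring
  rcases j with j | j
  · exact key c i
  rcases i with i | i
  · convert key (star c) (.inr j) using 2 with y
    rw [← Complex.conj_re]
    simp
    ring
  · refine ⟨fun _ => 0, 0, fun k l => if k = i then if l = j then c else 0 else 0, analyticAt_const,
      Asymptotics.isBigO_zero _ _, by simp, fun y => ?_⟩
    simp [ite_mul]

theorem isNormal2_quadratic (B : ModelSpace q r →L[ℝ] ModelSpace q r →L[ℝ] ℂ) :
    IsNormal2 fun y => (B y y).re :=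
  quadratic_induction isNormal2_zero (fun _ _ => IsNormal2.add) isNormal2_holomorphic
    isNormal2_mixed B

theorem cub21_add (a a' : Fin q → Fin q → Fin r → ℂ) (b b' : Fin q → Fin r → Fin r → ℂ)
    (c c' : Fin r → Fin r → Fin r → ℂ) (z2 : Fin q → ℂ) (z3 : Fin r → ℂ) :
    cub21 (a + a') (b + b') (c + c') z2 z3 = cub21 a b c z2 z3 + cub21 a' b' c' z2 z3 := by
  simp only [cub21, Pi.add_apply, add_mul, Finset.sum_add_distrib]
  ring

theorem herm_add (h h' : Fin r → Fin r → ℂ) (z : Fin r → ℂ) :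
    herm (h + h') z = herm h z + herm h' z := by
  simp only [herm, Pi.add_apply, add_mul, Finset.sum_add_distrib, Complex.add_re]

theorem herm_zero (z : Fin r → ℂ) : herm 0 z = 0 := by simp [herm]

theorem cub21_zero (z2 : Fin q → ℂ) (z3 : Fin r → ℂ) : cub21 0 0 0 z2 z3 = 0 := by simp [cub21]

/-- The cubic forms on the model space that are brought to the form `φ³` by the changes `w ↦ w + W`
and `z₂ ↦ z₂ + Y` and multiplication of the defining function `-2 Re w + ∑ ± |z₂ⱼ|² + ⋯` by `1 + g`.
-/
def IsNormal3 (sgn : Fin q → ℝ) (P : ModelSpace q r → ℝ) : Prop :=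
  ∃ (W : ModelSpace q r → ℂ) (Y : ModelSpace q r → Fin q → ℂ) (g : ModelSpace q r → ℝ)
    (a : Fin q → Fin q → Fin r → ℂ) (b : Fin q → Fin r → Fin r → ℂ)
    (c : Fin r → Fin r → Fin r → ℂ) (h : Fin r → Fin r → ℂ),
    (AnalyticAt ℂ W 0 ∧ W =O[𝓝 0] fun y => ‖y‖ ^ 3) ∧
    (AnalyticAt ℂ Y 0 ∧ ∀ j, (fun y => Y y j) =O[𝓝 0] fun y => ‖y‖ ^ 2) ∧
    (ContDiff ℝ ∞ g ∧ g =O[𝓝 0] fun y => ‖y‖ ^ 2) ∧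
    ∀ y, P y = -2 * (W y).re + 2 * (∑ j, (sgn j : ℂ) * Y y j * star (y.2.1 j)).re +
      (2 * (cub21 a b c y.2.1 y.2.2).re + herm h y.2.2 * (-2 * y.1.im)) + 2 * g y * y.1.re

section IsNormal3

variable {sgn : Fin q → ℝ}

theorem isNormal3_zero : IsNormal3 sgn fun _ : ModelSpace q r => 0 :=
  ⟨fun _ => 0, fun _ => 0, fun _ => 0, 0, 0, 0, 0, ⟨analyticAt_const, Asymptotics.isBigO_zero _ _⟩,
    ⟨analyticAt_const, fun _ => Asymptotics.isBigO_zero _ _⟩,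
    ⟨contDiff_const, Asymptotics.isBigO_zero _ _⟩, by simp [herm_zero, cub21_zero]⟩

theorem IsNormal3.add {P P' : ModelSpace q r → ℝ} (hP : IsNormal3 sgn P) (hP' : IsNormal3 sgn P') :
    IsNormal3 sgn fun y => P y + P' y := by
  obtain ⟨W, Y, g, a, b, c, h, ⟨w1, w2⟩, ⟨y1, y2⟩, ⟨g1, g2⟩, e⟩ := hP
  obtain ⟨W', Y', g', a', b', c', h', ⟨w1', w2'⟩, ⟨y1', y2'⟩, ⟨g1', g2'⟩, e'⟩ := hP'
  refine ⟨fun y => W y + W' y, fun y => Y y + Y' y, fun y => g y + g' y, a + a', b + b', c + c',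
    h + h', ⟨w1.add w1', w2.add w2'⟩, ⟨y1.add y1', fun j => (y2 j).add (y2' j)⟩,
    ⟨g1.add g1', g2.add g2'⟩, fun y => ?_⟩
  simp only [e, e', cub21_add, herm_add, Pi.add_apply, add_mul, mul_add, Finset.sum_add_distrib,
    Complex.add_re]
  ring

theorem isNormal3_holomorphic (c : ℂ) (i j k : Unit ⊕ Fin q ⊕ Fin r) :
    IsNormal3 sgn fun y => (c * coord i y * coord j y * coord k y).re := by
  refine ⟨fun y => -(c / 2) * (coord i y * coord j y * coord k y), fun _ => 0, fun _ => 0, 0, 0, 0, 0,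
    ⟨?_, ?_⟩, ⟨analyticAt_const, fun _ => Asymptotics.isBigO_zero _ _⟩,
    ⟨contDiff_const, Asymptotics.isBigO_zero _ _⟩, fun y => ?_⟩
  · exact analyticAt_const.mul ((((coord i).analyticAt _).mul ((coord j).analyticAt _)).mul
      ((coord k).analyticAt _))
  · exact (isBigO_mul_pow (isBigO_mul_pow (isBigO_coord i) (isBigO_coord j) le_rfl)
      (isBigO_coord k) le_rfl).const_mul_left _
  · have : c * coord i y * coord j y * coord k y =
        (-2 : ℝ) * (-(c / 2) * (coord i y * coord j y * coord k y)) := by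
      push_cast; ring
    beta_reduce
    rw [this, Complex.re_ofReal_mul]
    simp [herm_zero, cub21_zero]

theorem isNormal3_mul_re {f : ModelSpace q r → ℂ} (hf : ContDiff ℝ ∞ f)
    (hO : f =O[𝓝 0] fun y => ‖y‖ ^ 2) : IsNormal3 sgn fun y => (f y).re * y.1.re := by
  refine ⟨fun _ => 0, fun _ => 0, fun y => 1 / 2 * (f y).re, 0, 0, 0, 0,
    ⟨analyticAt_const, Asymptotics.isBigO_zero _ _⟩,
    ⟨analyticAt_const, fun _ => Asymptotics.isBigO_zero _ _⟩,
    ⟨contDiff_const.mul (Complex.reCLM.contDiff.comp hf), (isBigO_re_pow hO).const_mul_left _⟩,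
    fun y => ?_⟩
  simp [herm_zero, cub21_zero]

theorem contDiff_coord (i : Unit ⊕ Fin q ⊕ Fin r) :
    ContDiff ℝ ∞ fun y : ModelSpace q r => coord i y :=
  ((coord i).restrictScalars ℝ).contDiff

theorem contDiff_star_coord (i : Unit ⊕ Fin q ⊕ Fin r) :
    ContDiff ℝ ∞ fun y : ModelSpace q r => star (coord i y) :=
  (starL' ℝ : ℂ ≃L[ℝ] ℂ).contDiff.comp (contDiff_coord i)

theorem isNormal3_mul_coord (c : ℂ) (i j : Unit ⊕ Fin q ⊕ Fin r) :
    IsNormal3 sgn fun y => (c * coord i y * coord j y).re * y.1.re :=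
  isNormal3_mul_re ((contDiff_const.mul (contDiff_coord i)).mul (contDiff_coord j))
    (isBigO_mul_pow ((isBigO_coord i).const_mul_left c) (isBigO_coord j) le_rfl)

theorem isNormal3_mul_coord_star (c : ℂ) (i j : Unit ⊕ Fin q ⊕ Fin r) :
    IsNormal3 sgn fun y => (c * coord i y * star (coord j y)).re * y.1.re :=
  isNormal3_mul_re ((contDiff_const.mul (contDiff_coord i)).mul (contDiff_star_coord j))
    (isBigO_mul_pow ((isBigO_coord i).const_mul_left c) (isBigO_star_pow (isBigO_coord j)) le_rfl)

/-- Terms with a factor `w̄ = 2 Re w - w`. -/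
theorem isNormal3_star_w (c : ℂ) (i j : Unit ⊕ Fin q ⊕ Fin r) :
    IsNormal3 sgn fun y => (c * coord i y * coord j y * star y.1).re := by
  convert (isNormal3_mul_coord (2 * c) i j).add (isNormal3_holomorphic (-c) i j (.inl ()))
    using 2 with y
  simp
  ring

/-- Terms with a factor `z̄₂` are removed by a change of `z₂`. -/
theorem isNormal3_star_z2 (hs : ∀ j, sgn j = 1 ∨ sgn j = -1) (c : ℂ) (i j : Unit ⊕ Fin q ⊕ Fin r)
    (l : Fin q) :
    IsNormal3 sgn fun y => (c * coord i y * coord j y * star (y.2.1 l)).re := by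
  refine ⟨fun _ => 0, fun y => Pi.single l ((sgn l : ℂ) * c / 2 * (coord i y * coord j y)),
    fun _ => 0, 0, 0, 0, 0, ⟨analyticAt_const, Asymptotics.isBigO_zero _ _⟩, ⟨?_, fun k => ?_⟩,
    ⟨contDiff_const, Asymptotics.isBigO_zero _ _⟩, fun y => ?_⟩
  · have h1 : AnalyticAt ℂ (fun y : ModelSpace q r =>
        (sgn l : ℂ) * c / 2 * (coord i y * coord j y)) 0 :=
      analyticAt_const.mul (((coord i).analyticAt _).mul ((coord j).analyticAt _))
    exact ((ContinuousLinearMap.single ℂ (fun _ : Fin q => ℂ) l).analyticAt _).comp h1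
  · by_cases hk : k = l
    · subst hk
      simp only [Pi.single_eq_same]
      exact (isBigO_mul_pow (isBigO_coord i) (isBigO_coord j) le_rfl).const_mul_left _
    · simp only [Pi.single_eq_of_ne hk]
      exact Asymptotics.isBigO_zero _ _
  · have h2 : (sgn l : ℂ) * sgn l = 1 := by
      rcases hs l with h | h <;> simp [h]
    have e : ∑ k, (sgn k : ℂ) * (Pi.single l ((sgn l : ℂ) * c / 2 * (coord i y * coord j y)) :
        Fin q → ℂ) k * star (y.2.1 k) = c * coord i y * coord j y * star (y.2.1 l) / 2 := by
      rw [Finset.sum_eq_single l]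
      · rw [Pi.single_eq_same]
        linear_combination (c / 2 * (coord i y * coord j y) * star (y.2.1 l)) * h2
      · intro k _ hk
        simp [Pi.single_eq_of_ne hk]
      · simp
    rw [e]
    have : (c * coord i y * coord j y * star (y.2.1 l) / 2).re =
        (c * coord i y * coord j y * star (y.2.1 l)).re / 2 := Complex.div_ofNat_re _ 2
    rw [this]
    simp [herm_zero, cub21_zero]
    ring

/-- Terms with the factors `w` and `z̄₃`; the term `w z₃ z̄₃` is split by `w = Re w - i u / 2`. -/
theorem isNormal3_w_star_z3 (hs : ∀ j, sgn j = 1 ∨ sgn j = -1) (c : ℂ)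
    (j : Unit ⊕ Fin q ⊕ Fin r) (l : Fin r) :
    IsNormal3 sgn fun y => (c * y.1 * coord j y * star (y.2.2 l)).re := by
  rcases j with j | j | j
  · -- after conjugation this is `z₃ w̄²`, and `w̄² = w² + 2 Re w (w̄ - w)`
    convert ((isNormal3_holomorphic (star c) (.inr (.inr l)) (.inl ()) (.inl ())).add
      (isNormal3_mul_coord_star (sgn := sgn) (2 * star c) (.inr (.inr l)) (.inl ()))).add
      (isNormal3_mul_coord (-2 * star c) (.inr (.inr l)) (.inl ())) using 2 with y
    simp
    ring
  · convert (isNormal3_mul_coord_star (sgn := sgn) (2 * star c) (.inr (.inr l)) (.inr (.inl j))).add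
      (isNormal3_star_z2 hs (-star c) (.inl ()) (.inr (.inr l)) j) using 2 with y
    simp
    ring
  · have key : IsNormal3 sgn fun y : ModelSpace q r =>
        herm (fun m k => if m = j then if k = l then -(Complex.I * c / 2) else 0 else 0) y.2.2 *
          (-2 * y.1.im) :=
      ⟨fun _ => 0, fun _ => 0, fun _ => 0, 0, 0, 0,
        fun m k => if m = j then if k = l then -(Complex.I * c / 2) else 0 else 0,
        ⟨analyticAt_const, Asymptotics.isBigO_zero _ _⟩,
        ⟨analyticAt_const, fun _ => Asymptotics.isBigO_zero _ _⟩,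
        ⟨contDiff_const, Asymptotics.isBigO_zero _ _⟩, by simp [cub21_zero]⟩
    convert (isNormal3_mul_coord_star c (.inr (.inr j)) (.inr (.inr l))).add key using 2 with y
    simp [herm, ite_mul]
    ring

theorem isNormal3_star_z3 (hs : ∀ j, sgn j = 1 ∨ sgn j = -1) (c : ℂ)
    (i j : Unit ⊕ Fin q ⊕ Fin r) (l : Fin r) :
    IsNormal3 sgn fun y => (c * coord i y * coord j y * star (y.2.2 l)).re := by
  have key (A : Fin q → Fin q → Fin r → ℂ) (B : Fin q → Fin r → Fin r → ℂ)
      (C : Fin r → Fin r → Fin r → ℂ) :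
      IsNormal3 sgn fun y : ModelSpace q r => 2 * (cub21 A B C y.2.1 y.2.2).re :=
    ⟨fun _ => 0, fun _ => 0, fun _ => 0, A, B, C, 0, ⟨analyticAt_const, Asymptotics.isBigO_zero _ _⟩,
      ⟨analyticAt_const, fun _ => Asymptotics.isBigO_zero _ _⟩,
      ⟨contDiff_const, Asymptotics.isBigO_zero _ _⟩, by simp [herm_zero]⟩
  rcases i with i | i
  · exact isNormal3_w_star_z3 hs c j l
  rcases j with j | j
  · convert isNormal3_w_star_z3 hs c (.inr i) l using 3 with y
    simp only [coord_inl]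
    ring
  have h2 : ∀ z : ℂ, 2 * (z / 2).re = z.re := fun z => by
    have : (z / 2).re = z.re / 2 := by simp
    rw [this]; ring
  rcases i with i | i <;> rcases j with j | j
  · convert key (fun i' j' l' => if i' = i then if j' = j then if l' = l then c / 2 else 0 else 0
      else 0) 0 0 using 2 with y
    rw [← h2]
    simp only [cub21, ite_mul, zero_mul, Finset.sum_ite_eq', Finset.sum_ite_irrel,
      Finset.sum_const_zero, Finset.mem_univ, if_true, Pi.zero_apply, add_zero, coord_inr_inl]
    congr 2
    ring
  · convert key 0 (fun i' j' l' => if i' = i then if j' = j then if l' = l then c / 2 else 0 else 0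
      else 0) 0 using 2 with y
    rw [← h2]
    simp only [cub21, ite_mul, zero_mul, Finset.sum_ite_eq', Finset.sum_ite_irrel,
      Finset.sum_const_zero, Finset.mem_univ, if_true, Pi.zero_apply, add_zero, zero_add,
      coord_inr_inl, coord_inr_inr]
    congr 2
    ring
  · convert key 0 (fun i' j' l' => if i' = j then if j' = i then if l' = l then c / 2 else 0 else 0
      else 0) 0 using 2 with y
    rw [← h2]
    simp only [cub21, ite_mul, zero_mul, Finset.sum_ite_eq', Finset.sum_ite_irrel,
      Finset.sum_const_zero, Finset.mem_univ, if_true, Pi.zero_apply, add_zero, zero_add,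
      coord_inr_inl, coord_inr_inr]
    congr 2
    ring
  · convert key 0 0 (fun i' j' l' => if i' = i then if j' = j then if l' = l then c / 2 else 0 else 0
      else 0) using 2 with y
    rw [← h2]
    simp only [cub21, ite_mul, zero_mul, Finset.sum_ite_eq', Finset.sum_ite_irrel,
      Finset.sum_const_zero, Finset.mem_univ, if_true, Pi.zero_apply, zero_add,
      coord_inr_inr]
    congr 2
    ring

theorem isNormal3_cubic (hs : ∀ j, sgn j = 1 ∨ sgn j = -1)
    (T : ModelSpace q r →L[ℝ] ModelSpace q r →L[ℝ] ModelSpace q r →L[ℝ] ℂ) :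
    IsNormal3 sgn fun y => (T y y y).re := by
  refine cubic_induction isNormal3_zero (fun _ _ => IsNormal3.add) isNormal3_holomorphic
    (fun c i j k => ?_) T
  rcases k with k | k | k
  · exact isNormal3_star_w c i j
  · exact isNormal3_star_z2 hs c i j k
  · exact isNormal3_star_z3 hs c i j k

end IsNormal3

end

/-! ### Normalisation of third order jets -/

section

variable {n q r : ℕ}

theorem isNormal2_real (B : ModelSpace q r →L[ℝ] ModelSpace q r →L[ℝ] ℝ) :
    IsNormal2 fun y => B y y :=
  isNormal2_quadratic ((ContinuousLinearMap.compL ℝ (ModelSpace q r) ℝ ℂ Complex.ofRealCLM).comp B)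

theorem isNormal3_real {sgn : Fin q → ℝ} (hs : ∀ j, sgn j = 1 ∨ sgn j = -1)
    (T : ModelSpace q r →L[ℝ] ModelSpace q r →L[ℝ] ModelSpace q r →L[ℝ] ℝ) :
    IsNormal3 sgn fun y => T y y y :=
  isNormal3_cubic hs ((ContinuousLinearMap.compL ℝ (ModelSpace q r) (ModelSpace q r →L[ℝ] ℝ)
    (ModelSpace q r →L[ℝ] ℂ)
      (ContinuousLinearMap.compL ℝ (ModelSpace q r) ℝ ℂ Complex.ofRealCLM)).comp T)

theorem quad_add_sub (sgn : Fin q → ℝ) (z y : Fin q → ℂ) :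
    quad sgn (z + y) = quad sgn z + 2 * (∑ j, (sgn j : ℂ) * y j * star (z j)).re + quad sgn y := by
  simp only [quad, Complex.re_sum, Finset.mul_sum, ← Finset.sum_add_distrib]
  refine Finset.sum_congr rfl fun j _ => ?_
  rw [mul_assoc (sgn j : ℂ), Complex.re_ofReal_mul, ← Complex.normSq_eq_norm_sq,
    ← Complex.normSq_eq_norm_sq, ← Complex.normSq_eq_norm_sq, Pi.add_apply, add_comm (z j),
    Complex.normSq_add, Complex.star_def]
  ring

theorem isBigO_cub21_sub {E : Type*} [NormedAddCommGroup E] (a : Fin q → Fin q → Fin r → ℂ)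
    (b : Fin q → Fin r → Fin r → ℂ) (c : Fin r → Fin r → Fin r → ℂ) {z y : E → Fin q → ℂ}
    {z3 : E → Fin r → ℂ} (hz : ∀ j, (fun x => z x j) =O[𝓝 0] fun x => ‖x‖ ^ 1)
    (hy : ∀ j, (fun x => y x j) =O[𝓝 0] fun x => ‖x‖ ^ 2)
    (hz3 : ∀ j, (fun x => z3 x j) =O[𝓝 0] fun x => ‖x‖ ^ 1) :
    (fun x => cub21 a b c (z x + y x) (z3 x) - cub21 a b c (z x) (z3 x)) =O[𝓝 0]
      fun x => ‖x‖ ^ 4 := by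
  have e : (fun x => cub21 a b c (z x + y x) (z3 x) - cub21 a b c (z x) (z3 x)) = fun x =>
      (∑ j, ∑ k, ∑ l, a j k l * ((y x j * z x k + z x j * y x k + y x j * y x k) * star (z3 x l))) +
      ∑ j, ∑ k, ∑ l, b j k l * ((y x j * z3 x k) * star (z3 x l)) := by
    funext x
    simp only [cub21, add_sub_add_comm, sub_self, add_zero, ← Finset.sum_sub_distrib]
    refine congr_arg₂ _ ?_ ?_ <;>
    · refine Finset.sum_congr rfl fun j _ => Finset.sum_congr rfl fun k _ =>
        Finset.sum_congr rfl fun l _ => ?_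
      simp only [Pi.add_apply]
      ring
  rw [e]
  have h3 (l : Fin r) := isBigO_star_pow (hz3 l)
  refine Asymptotics.IsBigO.add ?_ ?_
  · refine Asymptotics.IsBigO.fun_sum fun j _ => ?_
    refine Asymptotics.IsBigO.fun_sum fun k _ => ?_
    refine Asymptotics.IsBigO.fun_sum fun l _ => ?_
    refine Asymptotics.IsBigO.const_mul_left ?_ _
    refine isBigO_mul_pow (j := 3) (k := 1) ?_ (h3 l) (by norm_num)
    exact ((isBigO_mul_pow (hy j) (hz k) le_rfl).add (isBigO_mul_pow (hz j) (hy k) le_rfl)).add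
      (isBigO_mul_pow (hy j) (hy k) (by norm_num))
  · refine Asymptotics.IsBigO.fun_sum fun j _ => ?_
    refine Asymptotics.IsBigO.fun_sum fun k _ => ?_
    refine Asymptotics.IsBigO.fun_sum fun l _ => ?_
    refine Asymptotics.IsBigO.const_mul_left ?_ _
    exact isBigO_mul_pow (isBigO_mul_pow (hy j) (hz3 k) le_rfl) (h3 l) (by norm_num)

theorem isBigO_quad {E : Type*} [NormedAddCommGroup E] (sgn : Fin q → ℝ) {y : E → Fin q → ℂ}
    (hy : ∀ j, (fun x => y x j) =O[𝓝 0] fun x => ‖x‖ ^ 2) :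
    (fun x => quad sgn (y x)) =O[𝓝 0] fun x => ‖x‖ ^ 4 := by
  refine Asymptotics.IsBigO.fun_sum fun j _ => ?_
  refine Asymptotics.IsBigO.const_mul_left ?_ _
  have := isBigO_mul_pow (hy j).norm_left (hy j).norm_left (m := 4) (by norm_num)
  simpa only [sq] using this

theorem isBigO_herm {E : Type*} [NormedAddCommGroup E] (h : Fin r → Fin r → ℂ) {z : E → Fin r → ℂ}
    (hz : ∀ j, (fun x => z x j) =O[𝓝 0] fun x => ‖x‖ ^ 1) :
    (fun x => herm h (z x)) =O[𝓝 0] fun x => ‖x‖ ^ 2 := by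
  refine isBigO_re_pow ?_
  refine Asymptotics.IsBigO.fun_sum fun j _ => ?_
  refine Asymptotics.IsBigO.fun_sum fun k _ => ?_
  exact isBigO_mul_pow ((hz j).const_mul_left _) (isBigO_star_pow (hz k)) le_rfl

theorem isBigO_clm {E F : Type*} [NormedAddCommGroup E] [NormedSpace ℝ E] [NormedAddCommGroup F]
    [NormedSpace ℝ F] (L : E →L[ℝ] F) : (fun y => L y) =O[𝓝 0] fun y => ‖y‖ ^ 1 := by
  simpa using (L.isBigO_id (𝓝 0)).norm_right

theorem isBigO_clm_apply {E F : Type*} [NormedAddCommGroup E] [NormedSpace ℝ E]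
    [NormedAddCommGroup F] [NormedSpace ℝ F] {A : E → E →L[ℝ] F} {j : ℕ}
    (hA : A =O[𝓝 0] fun y => ‖y‖ ^ j) : (fun y => A y y) =O[𝓝 0] fun y => ‖y‖ ^ (j + 1) := by
  have h1 : (fun y => A y y) =O[𝓝 0] fun y => ‖A y‖ * ‖y‖ :=
    Asymptotics.IsBigO.of_bound 1 (Filter.Eventually.of_forall fun y => by
      simpa using (A y).le_opNorm y)
  refine h1.trans ?_
  have h2 := hA.norm_left.mul (Asymptotics.isBigO_refl (fun y : E => ‖y‖) (𝓝 0))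
  simpa only [pow_succ] using h2

theorem isBigO_bilinear {E : Type*} [NormedAddCommGroup E] [NormedSpace ℝ E]
    (B : E →L[ℝ] E →L[ℝ] ℝ) : (fun y => B y y) =O[𝓝 0] fun y => ‖y‖ ^ 2 :=
  isBigO_clm_apply (isBigO_clm (F := E →L[ℝ] ℝ) B)

theorem isBigO_trilinear {E : Type*} [NormedAddCommGroup E] [NormedSpace ℝ E]
    (T : E →L[ℝ] E →L[ℝ] E →L[ℝ] ℝ) : (fun y => T y y y) =O[𝓝 0] fun y => ‖y‖ ^ 3 :=
  isBigO_clm_apply (isBigO_clm_apply (F := E →L[ℝ] ℝ) (isBigO_clm (F := E →L[ℝ] E →L[ℝ] ℝ) T))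

/-- The third order normal form of a function on the model space with differential `-2 Re w` and
Hermitian part of the second derivative on `w = 0` given by `∑ ± |z₂ⱼ|²`. The quadratic terms are
normalised by `W2` and the linear factor `g1`. In the presence of `g1` it is not the third
derivative of `P` but the sum with `g1` times the second one that is normalised by `W3`, `Y` and
`g2`. -/
theorem exists_model_of_jet {P : ModelSpace q r → ℝ} (hP : SmAt P 0) (h0 : P 0 = 0)
    (h1 : ∀ y, fderiv ℝ P 0 y = -2 * y.1.re) {sgn : Fin q → ℝ} (hs : ∀ j, sgn j = 1 ∨ sgn j = -1)
    (h2 : ∀ y : ModelSpace q r, y.1 = 0 → fderiv ℝ (fderiv ℝ P) 0 y y +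
      fderiv ℝ (fderiv ℝ P) 0 (Complex.I • y) (Complex.I • y) = 4 * quad sgn y.2.1) :
    ∃ (J : ModelData q r) (F : ModelSpace q r → ModelSpace q r) (g : ModelSpace q r → ℝ),
      J.sgn = sgn ∧ AnalyticAt ℂ F 0 ∧ F 0 = 0 ∧
      HasFDerivAt F (ContinuousLinearMap.id ℂ (ModelSpace q r)) 0 ∧ SmAt g 0 ∧ g 0 = 1 ∧
      (fun y => J.model (F y) - g y * P y) =O[𝓝 0] fun y => ‖y‖ ^ 4 := by
  set B := fderiv ℝ (fderiv ℝ P) 0 with hB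
  set T := fderiv ℝ (fderiv ℝ (fderiv ℝ P)) 0 with hT
  obtain ⟨W2, g1, H, W2a, W2O, W2I, e2⟩ := isNormal2_real ((1 / 2 : ℝ) • B)
  obtain ⟨W3, Y, g2, a, b, c, h, ⟨W3a, W3O⟩, ⟨Ya, YO⟩, ⟨g2s, g2O⟩, e3⟩ := isNormal3_real hs
    ((1 / 6 : ℝ) • T + ContinuousLinearMap.smulRight g1 ((1 / 2 : ℝ) • B))
  simp only [smul_apply, add_apply, ContinuousLinearMap.smulRight_apply, smul_eq_mul] at e2 e3
  -- the Hermitian part of the second derivative is the given quadratic form: average the second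
  -- derivative over `y0` and `i y0`, where the terms `W2` cancel and `Re w` vanishes
  have hH (y : ModelSpace q r) : (∑ j, ∑ k, H j k * coord (.inr j) y * star (coord (.inr k) y)).re =
      quad sgn y.2.1 := by
    set y0 : ModelSpace q r := (0, y.2) with hy0
    have k0 : ∀ j, coord (.inr j) y = coord (.inr j) y0 := by
      rintro (j | j) <;> rfl
    have k1 : ∀ j k, coord (.inr j) (Complex.I • y0) * star (coord (.inr k) (Complex.I • y0)) =
        coord (.inr j) y0 * star (coord (.inr k) y0) := by
      intro j k
      simp only [map_smul, smul_eq_mul, star_mul', Complex.star_def, Complex.conj_I]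
      linear_combination (-(coord (.inr j) y0 * (starRingEnd ℂ) (coord (.inr k) y0))) *
        Complex.I_mul_I
    have a1 := e2 y0
    have a2 := e2 (Complex.I • y0)
    have a3 := h2 y0 rfl
    simp only [mul_assoc, k1] at a2
    simp only [mul_assoc] at a1
    rw [W2I] at a2
    simp only [k0, mul_assoc]
    have e4 : y0.1.re = 0 := rfl
    have e5 : (Complex.I • y0).1.re = 0 := by simp [hy0]
    have e6 : y0.2.1 = y.2.1 := rfl
    rw [e4] at a1
    rw [e5, Complex.neg_re] at a2
    rw [e6] at a3
    linarith
  simp only [hH] at e2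
  have zero_of {F : Type} [NormedAddCommGroup F] {f : ModelSpace q r → F} {k : ℕ} (hk : k ≠ 0)
      (hf : f =O[𝓝 0] fun y => ‖y‖ ^ k) : f 0 = 0 := by
    have := hf.eq_zero_imp.self_of_nhds
    exact this (by simp [hk])
  have W20 : W2 0 = 0 := zero_of two_ne_zero W2O
  have W30 : W3 0 = 0 := zero_of three_ne_zero W3O
  have Y0 : Y 0 = 0 := funext fun j => zero_of (f := fun y => Y y j) two_ne_zero (YO j)
  have g20 : g2 0 = 0 := zero_of two_ne_zero g2O
  have YO' : Y =O[𝓝 0] fun y => ‖y‖ ^ 2 := Asymptotics.isBigO_pi.2 YO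
  have W3O' : W3 =O[𝓝 0] fun y => ‖y‖ ^ 2 := isBigO_pow_mono (by norm_num) W3O
  set N : ModelSpace q r → ModelSpace q r := fun y => (W2 y + W3 y, Y y, 0) with hN
  have hNa : AnalyticAt ℂ N 0 := (W2a.add W3a).prod (Ya.prod analyticAt_const)
  have hNO : N =O[𝓝 0] fun y => ‖y‖ ^ 2 :=
    (W2O.add W3O').prod_left (YO'.prod_left (Asymptotics.isBigO_zero _ _))
  refine ⟨⟨sgn, hs, a, b, c, h⟩, fun y => y + N y, fun y => 1 + g1 y + g2 y, rfl,
    analyticAt_id.add hNa, by simp [hN, W20, W30, Y0], ?_, ?_, by simp [g20], ?_⟩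
  · have : HasFDerivAt N (0 : ModelSpace q r →L[ℂ] ModelSpace q r) 0 :=
      Asymptotics.IsBigO.hasFDerivAt (n := 2) (by simpa using hNO) one_lt_two
    have h' := (hasFDerivAt_id (0 : ModelSpace q r)).add this
    rw [add_zero] at h'
    exact h'
  · exact ((contDiff_const.add g1.contDiff).add g2s).smAt
  set E : ModelSpace q r → ℝ := fun y => P y - (P 0 + fderiv ℝ P 0 y + (1 / 2 : ℝ) • B y y +
    (1 / 6 : ℝ) • T y y y) with hE
  have EO : E =O[𝓝 0] fun y => ‖y‖ ^ 4 := hP.taylor_three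
  have g1O : (fun y => g1 y) =O[𝓝 0] fun y => ‖y‖ ^ 1 := isBigO_clm g1
  have key : (fun y => ModelData.model ⟨sgn, hs, a, b, c, h⟩ (y + N y) - (1 + g1 y + g2 y) * P y) =
      fun y => quad sgn (Y y) + 2 * (cub21 a b c (y.2.1 + Y y) y.2.2 - cub21 a b c y.2.1 y.2.2).re +
        -2 * (herm h y.2.2 * (W2 y + W3 y).im) - (1 / 6) * (g1 y * T y y y) -
        (g2 y * (1 / 2 * B y y + 1 / 6 * T y y y)) - (1 + g1 y + g2 y) * E y := by
    funext y
    have a2 := e2 y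
    have a3 := e3 y
    simp only [hE, ModelData.model, ModelData.cubic, hN, Prod.fst_add, Prod.snd_add, add_zero,
      quad_add_sub, h0, h1, smul_eq_mul, Complex.add_re, Complex.add_im, Complex.sub_re]
    have a2' : B y y = 2 * (-2 * (W2 y).re + 2 * g1 y * y.1.re + quad sgn y.2.1) := by linarith
    have a3' : T y y y = 6 * (-2 * (W3 y).re + 2 * (∑ j, (sgn j : ℂ) * Y y j * star (y.2.1 j)).re +
        (2 * (cub21 a b c y.2.1 y.2.2).re + herm h y.2.2 * (-2 * y.1.im)) + 2 * g2 y * y.1.re -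
        g1 y * (1 / 2 * B y y)) := by linarith
    rw [a3', a2']
    ring
  -- every remaining term is of order four
  rw [key]
  have hc (i) : (fun y => coord i y) =O[𝓝 0] fun y : ModelSpace q r => ‖y‖ ^ 1 := isBigO_coord i
  have o1 := isBigO_quad sgn YO
  have o2 := (isBigO_re_pow (isBigO_cub21_sub a b c (z := fun y : ModelSpace q r => y.2.1) (y := Y)
    (z3 := fun y => y.2.2) (fun j => hc (.inr (.inl j))) YO
    (fun j => hc (.inr (.inr j))))).const_mul_left 2
  have o3 := (isBigO_mul_pow (m := 4) (isBigO_herm h (z := fun y : ModelSpace q r => y.2.2)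
    (fun j => hc (.inr (.inr j)))) (isBigO_im_pow (W2O.add W3O')) le_rfl).const_mul_left (-2)
  have o4 := (isBigO_mul_pow (m := 4) g1O (isBigO_trilinear T) le_rfl).const_mul_left (1 / 6)
  have o5 := isBigO_mul_pow (m := 4) g2O (((isBigO_bilinear B).const_mul_left (1 / 2)).add
    ((isBigO_pow_mono (by norm_num) (isBigO_trilinear T)).const_mul_left (1 / 6))) le_rfl
  have o6 : (fun y => (1 + g1 y + g2 y) * E y) =O[𝓝 0] fun y => ‖y‖ ^ 4 := by
    have : (fun y => 1 + g1 y + g2 y) =O[𝓝 0] fun y => ‖y‖ ^ 0 := by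
      simp only [pow_zero]
      exact Filter.Tendsto.isBigO_one ℝ
        (ContinuousAt.tendsto <| (continuousAt_const.add g1.continuous.continuousAt).add
          g2s.continuous.continuousAt)
    exact isBigO_mul_pow this EO (by norm_num)
  exact ((((o1.add o2).add o3).sub o4).sub o5).sub o6

end

/-! ### Normalised defining functions -/

section

variable {n q r : ℕ} {M : Set (Cn n)} {p : Cn n} {ρ : Cn n → ℝ}

/-- In the holomorphic coordinates `Φ`, with linear part `ℓ`, the function `ρ` is given by the model
polynomial with data `J` up to terms of order four. -/
structure IsNormalised (p : Cn n) (ρ : Cn n → ℝ) (Φ : Cn n → ModelSpace q r)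
    (ℓ : Cn n ≃L[ℂ] ModelSpace q r) (J : ModelData q r) : Prop where
  analytic : AnalyticAt ℂ Φ p
  map_zero : Φ p = 0
  hasFDerivAt : HasFDerivAt Φ (ℓ : Cn n →L[ℂ] ModelSpace q r) p
  close : (fun x => ρ x - J.model (Φ x)) =O[𝓝 p] fun x => ‖x - p‖ ^ 4

theorem fderiv_fderiv_comp_affine {ρ : Cn n → ℝ} (hρ : SmAt ρ p)
    (L : ModelSpace q r →L[ℝ] Cn n) :
    SmAt (fun y => ρ (p + L y)) 0 ∧
      (∀ y, fderiv ℝ (fun y => ρ (p + L y)) 0 y = fderiv ℝ ρ p (L y)) ∧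
      ∀ y z, fderiv ℝ (fderiv ℝ fun y => ρ (p + L y)) 0 y z =
        fderiv ℝ (fderiv ℝ ρ) p (L y) (L z) := by
  have h0 : p + L 0 = p := by simp
  have haff : ∀ y, HasFDerivAt (fun y => p + L y) L y := fun y => L.hasFDerivAt.const_add p
  have hs : SmAt (fun y => p + L y) 0 := (contDiff_const.add L.contDiff).smAt
  have e : fderiv ℝ (fun y => ρ (p + L y)) =ᶠ[𝓝 0] fun y => (fderiv ℝ ρ (p + L y)).comp L := by
    have : ∀ᶠ y in 𝓝 0, SmAt ρ (p + L y) :=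
      hs.continuousAt.eventually (by simpa only [h0] using hρ.eventually)
    filter_upwards [this] with y hy
    exact (hy.differentiableAt.hasFDerivAt.comp y (haff y)).fderiv
  refine ⟨SmAt.comp (by rwa [h0]) hs, fun y => ?_, fun y z => ?_⟩
  · rw [e.self_of_nhds]
    beta_reduce
    rw [h0]
    rfl
  · have h1 : HasFDerivAt (fun y => fderiv ℝ ρ (p + L y)) ((fderiv ℝ (fderiv ℝ ρ) p).comp L) 0 := by
      have hd : HasFDerivAt (fderiv ℝ ρ) (fderiv ℝ (fderiv ℝ ρ) p) (p + L 0) := by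
        rw [h0]; exact hρ.fderiv.differentiableAt.hasFDerivAt
      exact hd.comp 0 (haff 0)
    have h2 := h1.clm_comp (hasFDerivAt_const L 0)
    rw [e.fderiv_eq, h2.fderiv]
    simp

/-- The complex Hessian of a real function on `(a, ā)`, in terms of the real one. -/
theorem cd_cd_rc_apply_star (hρ : SmAt ρ p) (a : Cn n) :
    cd (cd (rc ρ)) p (a, 0) (0, star a) = ((1 / 4 * (fderiv ℝ (fderiv ℝ ρ) p a a +
      fderiv ℝ (fderiv ℝ ρ) p (Complex.I • a) (Complex.I • a)) : ℝ) : ℂ) := by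
  have e : fderiv ℝ (rc ρ) =ᶠ[𝓝 p] fun x => Complex.ofRealCLM.comp (fderiv ℝ ρ x) := by
    filter_upwards [hρ.eventually] with x hx
    exact (Complex.ofRealCLM.hasFDerivAt.comp x hx.differentiableAt.hasFDerivAt).fderiv
  have h1 := (hasFDerivAt_const Complex.ofRealCLM p).clm_comp
    hρ.fderiv.differentiableAt.hasFDerivAt
  rw [hρ.rc.cd_cd_apply, e.fderiv_eq, h1.fderiv]
  simp only [cExt, LinearMap.coe_mk, AddHom.coe_mk]
  simp [hρ.fderiv_fderiv_symm (Complex.I • a) a]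
  linear_combination (-(fderiv ℝ (fderiv ℝ ρ) p (Complex.I • a) (Complex.I • a) : ℂ) / 4) *
    Complex.I_mul_I

/-- The third order normal form of a function whose first derivative and Levi form are
normalised by the linear coordinates `ℓ`. -/
theorem exists_isNormalised (hρ : SmAt ρ p) (h0 : ρ p = 0) (ℓ : Cn n ≃L[ℂ] ModelSpace q r)
    {sgn : Fin q → ℝ} (hs : ∀ j, sgn j = 1 ∨ sgn j = -1)
    (h1 : ∀ X, fderiv ℝ ρ p X = -2 * (ℓ X).1.re)
    (h2 : ∀ X, (ℓ X).1 = 0 → cd (cd (rc ρ)) p (X, 0) (0, star X) = quad sgn (ℓ X).2.1) :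
    ∃ (J : ModelData q r) (Φ : Cn n → ModelSpace q r) (g : Cn n → ℝ), J.sgn = sgn ∧ SmAt g p ∧
      g p = 1 ∧ IsNormalised p (fun x => g x * ρ x) Φ ℓ J := by
  set L : ModelSpace q r →L[ℝ] Cn n := (ℓ.symm : ModelSpace q r →L[ℂ] Cn n).restrictScalars ℝ
  have hL : ∀ y, L y = ℓ.symm y := fun _ => rfl
  obtain ⟨a1, a2, a3⟩ := fderiv_fderiv_comp_affine hρ L
  obtain ⟨J, F, g, hJ, F1, F2, F3, g1, g2, O⟩ := exists_model_of_jet a1 (by simpa using h0)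
    (fun y => by rw [a2, h1, hL]; simp) hs (fun y hy => by
      rw [a3, a3]
      have := h2 (ℓ.symm y) (by simpa using hy)
      rw [cd_cd_rc_apply_star hρ, Complex.ofReal_inj] at this
      rw [hL, hL, map_smul]
      simp only [ContinuousLinearEquiv.apply_symm_apply] at this
      linarith)
  set A : Cn n → ModelSpace q r := fun x => ℓ (x - p) with hA
  have hAp : A p = 0 := by simp [hA]
  have hAd (x : Cn n) : HasFDerivAt A (ℓ : Cn n →L[ℂ] ModelSpace q r) x :=
    (ℓ : Cn n →L[ℂ] ModelSpace q r).hasFDerivAt.comp x ((hasFDerivAt_id x).sub_const p)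
  have hAa : AnalyticAt ℂ A p :=
    ((ℓ : Cn n →L[ℂ] ModelSpace q r).analyticAt _).comp (analyticAt_id.sub analyticAt_const)
  refine ⟨J, fun x => F (A x), fun x => g (A x), hJ, ?_, by simp [hAp, g2], ?_, by simp [hAp, F2],
    ?_, ?_⟩
  · exact SmAt.comp (by rwa [hAp]) hAa.smAt
  · exact AnalyticAt.comp (by rwa [hAp]) hAa
  · have h := (show HasFDerivAt F (ContinuousLinearMap.id ℂ (ModelSpace q r)) (A p) by
      rwa [hAp]).comp p (hAd p)
    rwa [ContinuousLinearMap.id_comp] at h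
  · have hc : Filter.Tendsto A (𝓝 p) (𝓝 0) := by
      have := hAa.continuousAt.tendsto
      rwa [hAp] at this
    have h3 := (O.comp_tendsto hc).neg_left
    have h4 : (fun x => ‖A x‖ ^ 4) =O[𝓝 p] fun x => ‖x - p‖ ^ 4 :=
      (((ℓ : Cn n →L[ℂ] ModelSpace q r).isBigO_sub (𝓝 p) p).norm_norm.pow 4).congr_left
        fun x => by simp [hA]
    refine (h3.trans h4).congr_left fun x => ?_
    have e : p + L (A x) = x := by rw [hL]; simp [hA]
    simp only [Function.comp_apply, e]
    ring

theorem isDefiningFunction_of_eventually (hρ : SmAt ρ p) (hd : fderiv ℝ ρ p ≠ 0)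
    (h : ∀ᶠ x in 𝓝 p, x ∈ M ↔ ρ x = 0) : IsDefiningFunction M p ρ := by
  have hd' : ∀ᶠ x in 𝓝 p, fderiv ℝ ρ x ≠ 0 := hρ.fderiv.continuousAt.eventually_ne hd
  obtain ⟨U, hU, hp, hs, hU'⟩ := hρ.exists_contDiffOn (hd'.and h)
  exact ⟨U, hU, hp, hs, fun x hx => (hU' x hx).1, fun x hx => (hU' x hx).2⟩

protected theorem SmAt.mul_real {E : Type*} [NormedAddCommGroup E] [NormedSpace ℝ E] {f g : E → ℝ}
    {x : E} (hf : SmAt f x) (hg : SmAt g x) : SmAt (fun y => f y * g y) x := by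
  filter_upwards [hf, hg] with y h1 h2 using h1.mul h2

theorem IsDefiningFunction.mul (hρ : IsDefiningFunction M p ρ) (hp : p ∈ M) {g : Cn n → ℝ}
    (hg : SmAt g p) (hg0 : g p ≠ 0) : IsDefiningFunction M p fun x => g x * ρ x := by
  refine isDefiningFunction_of_eventually (hg.mul_real hρ.smAt) ?_ ?_
  · have h := hg.differentiableAt.hasFDerivAt.mul hρ.smAt.differentiableAt.hasFDerivAt
    have e : fderiv ℝ (fun x => g x * ρ x) p = g p • fderiv ℝ ρ p + ρ p • fderiv ℝ g p := h.fderiv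
    rw [e, hρ.mem_iff.1 hp, zero_smul, add_zero]
    exact smul_ne_zero hg0 hρ.fderiv_ne_zero
  · filter_upwards [hρ.eventually_mem_iff, hg.continuousAt.eventually_ne hg0] with x h1 h2
    rw [h1, mul_eq_zero, or_iff_right h2]

namespace IsNormalised

variable {Φ : Cn n → ModelSpace q r} {ℓ : Cn n ≃L[ℂ] ModelSpace q r} {J : ModelData q r}

theorem agreesWith (h : IsNormalised p ρ Φ ℓ J) :
    AgreesWith p ρ (fun x => ℓ.symm (Φ x)) (fun x => J.model (ℓ x)) where
  analytic := ((ℓ.symm : ModelSpace q r →L[ℂ] Cn n).analyticAt _).comp h.analytic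
  map_eq := by rw [h.map_zero, _root_.map_zero]
  fderiv_eq := by
    have := ((ℓ.symm : ModelSpace q r →L[ℂ] Cn n).hasFDerivAt.comp p h.hasFDerivAt).fderiv
    refine Eq.trans this ?_
    ext x
    simp
  smooth := by
    obtain ⟨d3, hd, -⟩ := exists_hasJet_model (ℓ : Cn n →L[ℂ] ModelSpace q r) J
    exact Complex.reCLM.contDiff.comp hd.smooth
  close := by simpa using h.close

theorem cd_eq (h : IsNormalised p ρ Φ ℓ J) (hρ : SmAt ρ p) (v : CVec n) :
    cd (rc ρ) p v = -((ℓ v.1).1 + star (ℓ (star v.2)).1) := by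
  obtain ⟨d3, hd, -⟩ := exists_hasJet_model (ℓ : Cn n →L[ℂ] ModelSpace q r) J
  rw [h.agreesWith.cd_eq hρ]
  exact hd.first v

theorem hessian (J : ModelData q r) (ℓ : Cn n ≃L[ℂ] ModelSpace q r) (a b : Cn n) :
    cd (cd (rc fun x => J.model (ℓ x))) 0 (a, 0) (0, b) =
      ∑ j, (J.sgn j : ℂ) * ((ℓ a).2.1 j * star ((ℓ (star b)).2.1 j)) := by
  obtain ⟨d3, hd, -⟩ := exists_hasJet_model (ℓ : Cn n →L[ℂ] ModelSpace q r) J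
  refine (hd.second _ _).trans ?_
  simp

theorem mem_cT (h : IsNormalised p ρ Φ ℓ J) (hρ : IsDefiningFunction M p ρ) (hp : p ∈ M)
    {v : CVec n} : v ∈ cT M p ↔ (ℓ v.1).1 + star (ℓ (star v.2)).1 = 0 := by
  rw [CRCubic.mem_cT hρ hp, h.cd_eq hρ.smAt, neg_eq_zero]

theorem mem_H10 (h : IsNormalised p ρ Φ ℓ J) (hρ : IsDefiningFunction M p ρ) (hp : p ∈ M)
    {v : CVec n} : v ∈ H10 M p ↔ v.2 = 0 ∧ (ℓ v.1).1 = 0 := by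
  rw [CRCubic.mem_H10 hρ hp, h.cd_eq hρ.smAt]
  simp

theorem mem_K10 (h : IsNormalised p ρ Φ ℓ J) (hρ : IsDefiningFunction M p ρ) (hp : p ∈ M)
    {v : CVec n} : v ∈ K10 M p ↔ v.2 = 0 ∧ (ℓ v.1).1 = 0 ∧ (ℓ v.1).2.1 = 0 := by
  rw [CRCubic.mem_K10 hρ hp, h.mem_H10 hρ hp, and_assoc]
  refine and_congr_right fun hv => and_congr_right fun hv' => ?_
  have hvv : v = (v.1, 0) := by ext <;> simp [hv]
  constructor
  · intro hw
    funext j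
    set b := ℓ.symm (0, Pi.single j 1, 0) with hb
    have hbm : ((0, star b) : CVec n) ∈ H01 M p := by
      rw [mem_H01 hρ hp, h.cd_eq hρ.smAt]
      simp [hb]
    have := hw _ hbm
    rw [hvv, h.agreesWith.cd_cd_eq hρ, hessian, star_star] at this
    simp only [hb, ContinuousLinearEquiv.apply_symm_apply] at this
    rw [Finset.sum_eq_single j (fun k _ hk => by simp [Pi.single_eq_of_ne hk]) (by simp)] at this
    rcases J.sgn_mem j with h1 | h1 <;> simpa [h1] using this
  · intro hz w hw
    have hw1 := eq_of_mem_H01 hw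
    rw [hvv, ← hw1, h.agreesWith.cd_cd_eq hρ, hessian]
    simp [hz]

theorem hasModel (h : IsNormalised p ρ Φ ℓ J) (hρ : IsDefiningFunction M p ρ) (hp : p ∈ M) :
    HasModel M p ρ (fun x => ℓ.symm (Φ x)) (fun x => J.model (ℓ x)) where
  toAgreesWith := h.agreesWith
  ker10 v hv b := by
    have hvv := eq_of_mem_H10 (K10_le_H10 hv)
    rw [h.mem_K10 hρ hp] at hv
    rw [← hvv, hessian]
    simp [hv.2.2]
  ker01 v hv a := by
    have hvv := eq_of_mem_H01 (K01_le_H01 hv)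
    rw [mem_K01, h.mem_K10 hρ hp, conjVec_fst] at hv
    rw [← hvv, hessian]
    simp [hv.2.2]

theorem mem_K01 (h : IsNormalised p ρ Φ ℓ J) (hρ : IsDefiningFunction M p ρ) (hp : p ∈ M)
    {v : CVec n} : v ∈ K01 M p ↔ v.1 = 0 ∧ (ℓ (star v.2)).1 = 0 ∧ (ℓ (star v.2)).2.1 = 0 := by
  rw [CRCubic.mem_K01, h.mem_K10 hρ hp]
  simp

end IsNormalised

/-- The third derivatives of a model that determine `φ³`; they are values of the tensors `τ²¹` and
`τ³`. -/
theorem third_derivative_model (J : ModelData q r) (ℓ : Cn n ≃L[ℂ] ModelSpace q r) :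
    (∀ X Y z2 z3, ℓ X = (0, z2, z3) → ℓ Y = (0, 0, z3) →
      cd (cd (cd (rc fun x => J.model (ℓ x)))) 0 (X, 0) (X, 0) (0, star Y) =
        2 * cub21 J.a J.b J.c z2 z3) ∧
    (∀ X Y z3, ℓ X = (Complex.I, 0, 0) → ℓ Y = (0, 0, z3) →
      cd (cd (cd (rc fun x => J.model (ℓ x)))) 0 (X, star X) (Y, 0) (0, star Y) =
        -2 * herm J.h z3) := by
  obtain ⟨d3, hd, -, h1, h2⟩ := exists_hasJet_model (ℓ : Cn n →L[ℂ] ModelSpace q r) J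
  refine ⟨fun X Y z2 z3 hX hY => ?_, fun X Y z3 hX hY => ?_⟩
  · exact (hd.third _ _ _).trans (h1 X (star Y) z2 z3 hX (by rw [star_star]; exact hY))
  · exact (hd.third _ _ _).trans (h2 X Y z3 hX hY)

end

/-! ### Adapted linear coordinates -/

section

variable {n q r : ℕ} {M : Set (Cn n)} {p : Cn n} {ρ : Cn n → ℝ}

/-- Diagonalisation of a Hermitian form with entries `0` and `±1`: unitary eigencoordinates,
rescaled by the roots of the absolute values of the eigenvalues that are not zero. -/
theorem exists_diagonal {m : ℕ} (h : Fin m → Fin m → ℂ) :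
    ∃ (S : (Fin m → ℂ) ≃ₗ[ℂ] (Fin m → ℂ)) (ε : Fin m → ℝ),
      (∀ j, ε j = -1 ∨ ε j = 0 ∨ ε j = 1) ∧ ∀ z, herm h z = ∑ j, ε j * ‖S z j‖ ^ 2 := by
  classical
  set A : Matrix (Fin m) (Fin m) ℂ := fun k j => (h j k + star (h k j)) / 2 with hA
  have hH : A.IsHermitian := by
    ext k j
    rw [Matrix.conjTranspose_apply]
    simp [hA, add_comm]
  have hherm (z : Fin m → ℂ) : herm h z = (star z ⬝ᵥ A.mulVec z).re := by
    have e1 : star z ⬝ᵥ A.mulVec z = 1 / 2 * ((∑ j, ∑ k, h j k * z j * star (z k)) +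
        star (∑ j, ∑ k, h j k * z j * star (z k))) := by
      rw [star_sum]
      simp only [star_sum, dotProduct, Matrix.mulVec, hA, Pi.star_apply, Finset.mul_sum, mul_add]
      conv_rhs => rw [Finset.sum_comm]
      rw [← Finset.sum_add_distrib]
      refine Finset.sum_congr rfl fun k _ => ?_
      rw [← Finset.sum_add_distrib]
      refine Finset.sum_congr rfl fun j _ => ?_
      simp only [star_mul', star_star]
      ring
    rw [e1, Complex.star_def, Complex.add_conj, herm]
    simp
  set U : Matrix (Fin m) (Fin m) ℂ := hH.eigenvectorUnitary.1 with hU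
  have hUU : U * star U = 1 := Unitary.coe_mul_star_self hH.eigenvectorUnitary
  have hspec : A = U * Matrix.diagonal (RCLike.ofReal ∘ hH.eigenvalues) * star U := by
    conv_lhs => rw [hH.spectral_theorem]
    rw [Unitary.conjStarAlgAut_apply]
  set d : Fin m → ℝ := fun i => if hH.eigenvalues i = 0 then 1 else √|hH.eigenvalues i| with hd
  have hd0 (i : Fin m) : (d i : ℂ) ≠ 0 := by
    rw [Complex.ofReal_ne_zero]
    simp only [hd]
    split_ifs with h0
    · exact one_ne_zero
    · exact (Real.sqrt_pos.2 (abs_pos.2 h0)).ne'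
  have hmul (z : Fin m → ℂ) : (Matrix.diagonal (fun i => (d i : ℂ)) * star U).mulVec z =
      fun i => (d i : ℂ) * (star U).mulVec z i := by
    rw [← Matrix.mulVec_mulVec]
    funext i
    rw [Matrix.mulVec_diagonal]
  have hinj : Function.Injective
      (Matrix.mulVecLin (Matrix.diagonal (fun i => (d i : ℂ)) * star U)) := by
    rw [injective_iff_map_eq_zero]
    intro z hz
    rw [Matrix.mulVecLin_apply, hmul] at hz
    have h1 : (star U).mulVec z = 0 := by
      funext i
      have := congrFun hz i
      simpa [hd0 i] using this
    have h2 : U.mulVec ((star U).mulVec z) = z := by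
      rw [Matrix.mulVec_mulVec, hUU, Matrix.one_mulVec]
    rw [← h2, h1, Matrix.mulVec_zero]
  refine ⟨LinearEquiv.ofInjectiveEndo _ hinj, fun i => SignType.sign (hH.eigenvalues i), fun j => ?_,
    fun z => ?_⟩
  · rcases lt_trichotomy (hH.eigenvalues j) 0 with h0 | h0 | h0
    · left; simp [sign_neg h0]
    · right; left; simp [h0]
    · right; right; simp [sign_pos h0]
  · rw [hherm]
    have e2 : star z ⬝ᵥ A.mulVec z = ∑ i, (hH.eigenvalues i : ℂ) *
        ((star U).mulVec z i * star ((star U).mulVec z i)) := by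
      conv_lhs => rw [hspec]
      rw [← Matrix.mulVec_mulVec, ← Matrix.mulVec_mulVec, Matrix.dotProduct_mulVec]
      have e3 : Matrix.vecMul (star z) U = star ((star U).mulVec z) := by
        rw [Matrix.star_mulVec, Matrix.star_eq_conjTranspose, Matrix.conjTranspose_conjTranspose]
      rw [e3]
      simp only [dotProduct, Matrix.mulVec_diagonal, Pi.star_apply, Function.comp_apply]
      refine Finset.sum_congr rfl fun i _ => ?_
      simp
      ring
    rw [e2, Complex.re_sum]
    refine Finset.sum_congr rfl fun i _ => ?_
    rw [LinearEquiv.coe_ofInjectiveEndo, Matrix.mulVecLin_apply, hmul, Complex.re_ofReal_mul,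
      Complex.star_def, Complex.mul_conj, Complex.ofReal_re, Complex.normSq_eq_norm_sq, norm_mul,
      mul_pow, Complex.norm_real, ← mul_assoc]
    congr 1
    simp only [hd]
    split_ifs with h0
    · simp [h0]
    · rw [Real.norm_of_nonneg (Real.sqrt_nonneg _), Real.sq_sqrt (abs_nonneg _),
        sign_mul_abs]

/-- Diagonalisation of a Hermitian form, with the radical split off. -/
theorem exists_diagonal_sum {m : ℕ} (h : Fin m → Fin m → ℂ) :
    ∃ (q r : ℕ) (S : (Fin m → ℂ) ≃ₗ[ℂ] (Fin q → ℂ) × (Fin r → ℂ)) (sgn : Fin q → ℝ),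
      (∀ j, sgn j = 1 ∨ sgn j = -1) ∧ ∀ z, herm h z = quad sgn (S z).1 := by
  classical
  obtain ⟨S, ε, hε, hS⟩ := exists_diagonal h
  set σ : Fin m ≃ Fin _ ⊕ Fin _ := (Equiv.sumCompl fun j => ε j ≠ 0).symm.trans
    (Equiv.sumCongr (Fintype.equivFin {j // ε j ≠ 0}) (Fintype.equivFin {j // ¬ε j ≠ 0})) with hσ
  have h1 (j) : ε (σ.symm (.inl j)) ≠ 0 := ((Fintype.equivFin {j // ε j ≠ 0}).symm j).2
  have h2 (j) : ε (σ.symm (.inr j)) = 0 := by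
    exact not_not.1 ((Fintype.equivFin {j // ¬ε j ≠ 0}).symm j).2
  refine ⟨_, _, S.trans ((LinearEquiv.funCongrLeft ℂ ℂ σ.symm).trans
    (LinearEquiv.sumArrowLequivProdArrow _ _ ℂ ℂ)), fun j => ε (σ.symm (.inl j)), fun j => ?_,
    fun z => ?_⟩
  · rcases hε (σ.symm (.inl j)) with h | h | h
    · exact .inr h
    · exact absurd h (h1 j)
    · exact .inl h
  · rw [hS, ← Equiv.sum_comp σ.symm, Fintype.sum_sum_type]
    simp only [h2, zero_mul, Finset.sum_const_zero, add_zero]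
    rfl

/-- A linear function that is not zero is the first coordinate of a linear coordinate system. -/
theorem exists_coordinates {w : Cn n →ₗ[ℂ] ℂ} (hw : w ≠ 0) :
    ∃ (m : ℕ) (T : Cn n ≃ₗ[ℂ] ℂ × (Fin m → ℂ)), ∀ X, (T X).1 = w X := by
  obtain ⟨e, he⟩ : ∃ e, w e = 1 := by
    obtain ⟨e, he⟩ := DFunLike.ne_iff.1 hw
    exact ⟨(w e)⁻¹ • e, by simpa using inv_mul_cancel₀ he⟩
  set K := LinearMap.ker w
  set b := (Module.finBasis ℂ K).equivFun
  set π : Cn n →ₗ[ℂ] K := LinearMap.codRestrict K (LinearMap.id - w.smulRight e) (fun X => by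
    simp [K, he])
  refine ⟨_, LinearEquiv.ofLinearMap (w.prod (b.toLinearMap ∘ₗ π))
    ((LinearMap.toSpanSingleton ℂ (Cn n) e).coprod (K.subtype ∘ₗ b.symm.toLinearMap)) ?_ ?_,
    fun X => rfl⟩
  · refine LinearMap.ext fun y => ?_
    have h1 : w ((b.symm y.2 : K) : Cn n) = 0 := (b.symm y.2).2
    have h2 : w (y.1 • e + ((b.symm y.2 : K) : Cn n)) = y.1 := by simp [he, h1]
    refine Prod.ext h2 ?_
    have h3 : π (y.1 • e + ((b.symm y.2 : K) : Cn n)) = b.symm y.2 := by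
      refine Subtype.ext ?_
      change (y.1 • e + ((b.symm y.2 : K) : Cn n)) - w (y.1 • e + ((b.symm y.2 : K) : Cn n)) • e = _
      rw [h2]
      abel
    change b (π (y.1 • e + ((b.symm y.2 : K) : Cn n))) = y.2
    rw [h3, LinearEquiv.apply_symm_apply]
  · refine LinearMap.ext fun X => ?_
    change w X • e + ((b.symm (b (π X)) : K) : Cn n) = X
    rw [LinearEquiv.symm_apply_apply]
    change w X • e + (X - w X • e) = X
    abel

/-- Linear coordinates adapted to the tangent space and the Levi form. -/
theorem exists_adapted (hρ : IsDefiningFunction M p ρ) :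
    ∃ (q r : ℕ) (ℓ : Cn n ≃L[ℂ] ModelSpace q r) (sgn : Fin q → ℝ), n = q + r + 1 ∧
      (∀ j, sgn j = 1 ∨ sgn j = -1) ∧ (∀ X, fderiv ℝ ρ p X = -2 * (ℓ X).1.re) ∧
      ∀ X, (ℓ X).1 = 0 → cd (cd (rc ρ)) p (X, 0) (0, star X) = quad sgn (ℓ X).2.1 := by
  -- the coordinate `w` is `-∂ρ`, so that `dρ = ∂ρ + ∂̄ρ = -2 Re w`
  set w : Cn n →ₗ[ℂ] ℂ :=
    -((cd (rc ρ) p : CVec n →ₗ[ℂ] ℂ) ∘ₗ LinearMap.inl ℂ (Cn n) (Cn n)) with hw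
  have hwX (X : Cn n) : w X = -cd (rc ρ) p (X, 0) := rfl
  have hdρ (X : Cn n) : fderiv ℝ ρ p X = -2 * (w X).re := by
    have h1 : ((X, star X) : CVec n) = (X, 0) + conjVec n (X, 0) := by
      ext <;> simp
    have h2 := cd_rc_real hρ.smAt.differentiableAt X
    rw [h1, map_add, cd_rc_conjVec hρ.smAt.differentiableAt, Complex.star_def, Complex.add_conj,
      Complex.ofReal_inj] at h2
    rw [← h2, hwX, Complex.neg_re]
    ring
  have hw0 : w ≠ 0 := by
    intro h0
    refine hρ.fderiv_ne_zero (ContinuousLinearMap.ext fun X => ?_)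
    rw [hdρ, h0]
    simp
  obtain ⟨m, T, hT⟩ := exists_coordinates hw0
  set B : Cn n → Cn n → ℂ := fun X Y => cd (cd (rc ρ)) p (X, 0) (0, star Y) with hB
  obtain ⟨q, r, S, sgn, hs, hS⟩ := exists_diagonal_sum fun j k =>
    B (T.symm (0, Pi.single j 1)) (T.symm (0, Pi.single k 1))
  set L : Cn n ≃ₗ[ℂ] ModelSpace q r := T.trans ((LinearEquiv.refl ℂ ℂ).prodCongr S) with hL
  refine ⟨q, r, L.toContinuousLinearEquiv, sgn, ?_, hs, fun X => ?_, fun X hX => ?_⟩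
  · have := L.finrank_eq
    simp only [Module.finrank_prod, Module.finrank_fin_fun, Module.finrank_self] at this
    omega
  · rw [hdρ, ← hT]; rfl
  · have hX' : (T X).1 = 0 := hX
    have e : X = ∑ j, (T X).2 j • T.symm (0, Pi.single j 1) := by
      apply T.injective
      rw [map_sum]
      simp only [map_smul, LinearEquiv.apply_symm_apply]
      refine Prod.ext ?_ ?_
      · rw [hX']; simp [Prod.fst_sum]
      · funext k
        simp [Prod.snd_sum, Finset.sum_apply, Pi.single_apply]
    have hBX : B X X = ∑ j, ∑ k, B (T.symm (0, Pi.single j 1)) (T.symm (0, Pi.single k 1)) *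
        (T X).2 j * star ((T X).2 k) := by
      generalize (T X).2 = x at e
      rw [e]
      have e1 : ((∑ j, x j • T.symm (0, Pi.single j 1), 0) : CVec n) =
          ∑ j, x j • ((T.symm (0, Pi.single j 1), 0) : CVec n) := by
        refine Prod.ext ?_ ?_
        · simp [Prod.fst_sum]
        · simp [Prod.snd_sum]
      have e2 : ((0, star (∑ j, x j • T.symm (0, Pi.single j 1))) : CVec n) =
          ∑ j, star (x j) • ((0, star (T.symm (0, Pi.single j 1))) : CVec n) := by
        refine Prod.ext ?_ ?_
        · simp [Prod.fst_sum]
        · simp [Prod.snd_sum, star_sum, star_smul]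
      simp only [hB, e1, e2, map_sum, map_smul, sum_apply,
        smul_apply, smul_eq_mul, Finset.mul_sum]
      rw [Finset.sum_comm]
      refine Finset.sum_congr rfl fun j _ => Finset.sum_congr rfl fun k _ => ?_
      ring
    have h3 : (B X X).im = 0 := by
      rw [hB]
      beta_reduce
      rw [cd_cd_rc_apply_star hρ.smAt, Complex.ofReal_im]
    change B X X = _
    have h4 : (B X X).re = quad sgn (S (T X).2).1 := by
      rw [← hS, herm, hBX]
    exact Complex.ext h4 (by rw [h3, Complex.ofReal_im])

end

/-! ### Invariance of the tensors -/

section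

variable {n q r : ℕ} {M M' : Set (Cn n)} {p p' : Cn n} {ρ ρ' : Cn n → ℝ}
  {Φ Φ' : Cn n → ModelSpace q r} {J J' : ModelData q r}

/-- The Levi rank of a normalised hypersurface: the kernel of the Levi form is given by `z₂ = 0`. -/
theorem IsNormalised.leviRank_eq {ℓ : Cn n ≃L[ℂ] ModelSpace q r} (h : IsNormalised p ρ Φ ℓ J)
    (hρ : IsDefiningFunction M p ρ) (hp : p ∈ M) : leviRank M p = q := by
  set π : H10 M p →ₗ[ℂ] (Fin q → ℂ) := LinearMap.fst ℂ _ (Fin r → ℂ) ∘ₗ LinearMap.snd ℂ ℂ _ ∘ₗ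
    ℓ.toLinearEquiv.toLinearMap ∘ₗ LinearMap.fst ℂ _ _ ∘ₗ (H10 M p).subtype with hπ
  have hπv (v : H10 M p) : π v = (ℓ (v : CVec n).1).2.1 := rfl
  have hker : LinearMap.ker (leviForm M p) = LinearMap.ker π := by
    ext v
    have h1 : v ∈ LinearMap.ker (leviForm M p) ↔ (v : CVec n) ∈ K10 M p := by
      rw [K10, Submodule.mem_map]
      constructor
      · exact fun hv => ⟨v, hv, rfl⟩
      · rintro ⟨w, hw, e⟩
        rwa [← Subtype.ext e]
    have h2 := (h.mem_H10 hρ hp).1 v.2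
    rw [h1, h.mem_K10 hρ hp, LinearMap.mem_ker, hπv]
    simp [h2]
  have hsurj : LinearMap.range π = ⊤ := by
    rw [LinearMap.range_eq_top]
    intro z
    refine ⟨⟨(ℓ.symm (0, z, 0), 0), (h.mem_H10 hρ hp).2 ⟨rfl, ?_⟩⟩, ?_⟩
    · simp
    · simp [hπv]
  have h1 := LinearMap.finrank_range_add_finrank_ker (leviForm M p)
  have h2 := LinearMap.finrank_range_add_finrank_ker π
  rw [hsurj, finrank_top, Module.finrank_fin_fun, ← hker] at h2
  rw [leviRank]
  omega

/-- Every complex number is the value of `∂ρ` at a tangent vector. -/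
theorem exists_mem_cT_of_normalised {ℓ : Cn n ≃L[ℂ] ModelSpace q r} (h : IsNormalised p ρ Φ ℓ J)
    (hρ : IsDefiningFunction M p ρ) (hp : p ∈ M) (s : ℂ) :
    ∃ u ∈ cT M p, cd (rc ρ) p (u.1, 0) = s := by
  refine ⟨(ℓ.symm (-s, 0, 0), star (ℓ.symm (star s, 0, 0))), ?_, ?_⟩
  · rw [h.mem_cT hρ hp]
    simp
  · rw [h.cd_eq hρ.smAt]
    simp

theorem push_conjVec (A : Cn n →L[ℂ] Cn n) (v : CVec n) :
    push A (conjVec n v) = conjVec n (push A v) := by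
  simp [push, conjVec]

theorem cd_cd_cd_comp_clm {f : Cn n → ℂ} (hf : ContDiff ℝ ∞ f) (A : Cn n →L[ℂ] Cn n)
    (v w u : CVec n) :
    cd (cd (cd fun x => f (A x))) 0 v w u = cd (cd (cd f)) 0 (push A v) (push A w) (push A u) := by
  have F (x : Cn n) : SmAt f x := hf.smAt
  have H (x : Cn n) : SmAt (fun x => f (A x)) x :=
    (hf.comp (A.restrictScalars ℝ).contDiff).smAt
  have e {f : Cn n → ℂ} (hf : ∀ x, SmAt f x) (u : CVec n) :
      (fun x => cd (fun x => f (A x)) x u) = fun x => cd f (A x) (push A u) :=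
    funext fun x => by
      rw [cd_comp_holomorphic (hf _).differentiableAt A.differentiableAt, A.fderiv]
  have k {f : Cn n → ℂ} (hf : ∀ x, SmAt f x) (w u : CVec n) (x : Cn n) :
      cd (fun x => cd f x u) x w = cd (cd f) x w u :=
    cd_clm_apply_const (hf x).cd.differentiableAt _ _
  have Fu (u : CVec n) (x : Cn n) : SmAt (fun x => cd f x u) x := (F x).cd.clmC_apply (smAt_const u)
  have Fwu (w u : CVec n) (x : Cn n) : SmAt (fun x => cd (cd f) x w u) x :=
    ((F x).cd.cd.clmC_apply (smAt_const w)).clmC_apply (smAt_const u)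
  have e2 (w u : CVec n) : (fun x => cd (cd fun x => f (A x)) x w u) =
      fun x => cd (cd f) (A x) (push A w) (push A u) :=
    funext fun x => by
      rw [← k H, e F, congrFun (e (Fu (push A u)) w) x, k F]
  rw [(H 0).cd_cd_cd_apply_const, e2, congrFun (e (Fwu (push A w) (push A u)) v) 0,
    ← (F (A 0)).cd_cd_cd_apply_const, map_zero]

/-- The tensors of two hypersurfaces with the same model correspond to each other. -/
theorem transport_of_isNormalised {A : Cn n ≃L[ℂ] Cn n} {ℓ : Cn n ≃L[ℂ] ModelSpace q r}
    (h : IsNormalised p ρ Φ (A.trans ℓ) J) (hρ : IsDefiningFunction M p ρ) (hp : p ∈ M)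
    (h' : IsNormalised p' ρ' Φ' ℓ J) (hρ' : IsDefiningFunction M' p' ρ') (hp' : p' ∈ M') :
    (∀ v, v ∈ cT M p ↔ push A v ∈ cT M' p') ∧
    (∀ v2 v1 u, LeviGraph M p v2 v1 u ↔ LeviGraph M' p' (push A v2) (push A v1) (push A u)) ∧
    (∀ v3 v2 v1 u, Tau3Graph M p v3 v2 v1 u ↔
      Tau3Graph M' p' (push A v3) (push A v2) (push A v1) (push A u)) ∧
    (∀ v3 v2 v1 u, Tau21Graph M p v3 v2 v1 u ↔
      Tau21Graph M' p' (push A v3) (push A v2) (push A v1) (push A u)) ∧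
    (∀ v3 v2 v1 u, Tau21ExtGraph M p v3 v2 v1 u ↔
      Tau21ExtGraph M' p' (push A v3) (push A v2) (push A v1) (push A u)) := by
  have hm := h.hasModel hρ hp
  have hm' := h'.hasModel hρ' hp'
  have p1 (v : CVec n) : (push A v).1 = A v.1 := rfl
  have p2 (v : CVec n) : (push A v).2 = star (A (star v.2)) := rfl
  have z2 (v : CVec n) : (push A v).2 = 0 ↔ v.2 = 0 := by
    rw [p2, star_eq_zero]
    simp
  have z1 (v : CVec n) : (push A v).1 = 0 ↔ v.1 = 0 := by
    rw [p1]
    simp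
  have q1 (v : CVec n) : (((push A v).1, 0) : CVec n) = push A (v.1, 0) := by
    simp [push]
  have q2 (v : CVec n) : ((0, (push A v).2) : CVec n) = push A (0, v.2) := by
    simp [push]
  have hcd (v : CVec n) : cd (rc ρ') p' (push A v) = cd (rc ρ) p v := by
    rw [h'.cd_eq hρ'.smAt, h.cd_eq hρ.smAt, p1, p2, star_star]
    rfl
  have hcT (v : CVec n) : v ∈ cT M p ↔ push A v ∈ cT M' p' := by
    rw [mem_cT hρ hp, mem_cT hρ' hp', hcd]
  have hH10 (v : CVec n) : v ∈ H10 M p ↔ push A v ∈ H10 M' p' := by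
    rw [mem_H10 hρ hp, mem_H10 hρ' hp', q1, hcd, z2]
  have hH01 (v : CVec n) : v ∈ H01 M p ↔ push A v ∈ H01 M' p' := by
    rw [mem_H01 hρ hp, mem_H01 hρ' hp', q2, hcd, z1]
  have hcH (v : CVec n) : v ∈ cH M p ↔ push A v ∈ cH M' p' := by
    rw [mem_cH hρ hp, mem_cH hρ' hp', q1, q2, hcd, hcd]
  have hK10 (v : CVec n) : v ∈ K10 M p ↔ push A v ∈ K10 M' p' := by
    rw [h.mem_K10 hρ hp, h'.mem_K10 hρ' hp', z2, p1]
    rfl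
  have hK01 (v : CVec n) : v ∈ K01 M p ↔ push A v ∈ K01 M' p' := by
    rw [mem_K01, mem_K01, hK10]
    exact iff_of_eq (congrArg _ (push_conjVec _ _))
  have hcK (v : CVec n) : v ∈ cK M p ↔ push A v ∈ cK M' p' := by
    rw [mem_cK, mem_cK, q1, q2, ← hK10, ← hK01]
  have hR : ContDiff ℝ ∞ (rc fun x => J.model (ℓ x)) :=
    Complex.ofRealCLM.contDiff.comp h'.agreesWith.smooth
  have hT (v w u : CVec n) : cd (cd (cd (rc fun x => J.model (A.trans ℓ x)))) 0 v w u =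
      cd (cd (cd (rc fun x => J.model (ℓ x)))) 0 (push A v) (push A w) (push A u) :=
    cd_cd_cd_comp_clm hR (A : Cn n →L[ℂ] Cn n) v w u
  have hu (u : CVec n) : cd (rc ρ') p' ((push A u).1, 0) = cd (rc ρ) p (u.1, 0) := by
    rw [q1, hcd]
  refine ⟨hcT, fun v2 v1 u => ?_, fun v3 v2 v1 u => ?_, fun v3 v2 v1 u => ?_, fun v3 v2 v1 u => ?_⟩
  · rw [leviGraph_iff hρ hp, leviGraph_iff hρ' hp', ← hH10, ← hH01, ← hcT, hu]
    refine and_congr_right fun h2 => and_congr_right fun h1 => and_congr_right fun h0 => ?_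
    have e : cd (cd (rc ρ')) p' (push A v2) (push A v1) = cd (cd (rc ρ)) p v2 v1 := by
      rw [← eq_of_mem_H10 h2, ← eq_of_mem_H01 h1, ← q1, ← q2, h'.agreesWith.cd_cd_eq hρ',
        h.agreesWith.cd_cd_eq hρ, IsNormalised.hessian, IsNormalised.hessian]
      simp [p1, p2]
    rw [e]
  · rw [hm.tau3Graph_iff hρ hp, hm'.tau3Graph_iff hρ' hp', ← hcT, ← hK10, ← hK01, ← hcT, hu, ← hT]
  · rw [hm.tau21Graph_iff hρ hp, hm'.tau21Graph_iff hρ' hp', ← hH10, ← hH10, ← hK01, ← hcT, hu,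
      ← hT]
  · rw [hm.tau21ExtGraph_iff hρ hp, hm'.tau21ExtGraph_iff hρ' hp', ← hcH, ← hcK, ← hcK, ← hcT, hu,
      q1, q1, q2, q2, ← hT, ← hT]

theorem isBigO_sub_of_differentiableAt {E F : Type*} [NormedAddCommGroup E] [NormedSpace ℂ E]
    [NormedAddCommGroup F] [NormedSpace ℂ F] {f : E → F} {x : E} (hf : DifferentiableAt ℂ f x)
    (k : ℕ) : (fun y => ‖f y - f x‖ ^ k) =O[𝓝 x] fun y => ‖y - x‖ ^ k :=
  (hf.hasFDerivAt.isBigO_sub.norm_norm).pow k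

/-- A third order equivalence `F` transports tensors: coordinates that normalise `ρ'` pull back
under `F` to coordinates that normalise `ρ`, with the same model. -/
theorem transport_of_equiv (hp : p ∈ M) (hp' : p' ∈ M') {A : Cn n ≃L[ℂ] Cn n}
    (hA : ThirdOrderEquivVia M p M' p' A) :
    (∀ v, v ∈ cT M p ↔ push A v ∈ cT M' p') ∧
    (∀ v2 v1 u, LeviGraph M p v2 v1 u ↔ LeviGraph M' p' (push A v2) (push A v1) (push A u)) ∧
    (∀ v3 v2 v1 u, Tau3Graph M p v3 v2 v1 u ↔
      Tau3Graph M' p' (push A v3) (push A v2) (push A v1) (push A u)) ∧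
    (∀ v3 v2 v1 u, Tau21Graph M p v3 v2 v1 u ↔
      Tau21Graph M' p' (push A v3) (push A v2) (push A v1) (push A u)) ∧
    (∀ v3 v2 v1 u, Tau21ExtGraph M p v3 v2 v1 u ↔
      Tau21ExtGraph M' p' (push A v3) (push A v2) (push A v1) (push A u)) := by
  obtain ⟨F, Fa, Fp, Fd, ρ, ρ', hρ, hρ', O⟩ := hA
  obtain ⟨q, r, ℓ, sgn, -, hs, h1, h2⟩ := exists_adapted hρ'
  obtain ⟨J, Φ', g, hJ, hg, hg1, hN⟩ := exists_isNormalised hρ'.smAt (hρ'.mem_iff.1 hp') ℓ hs h1 h2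
  have hgF : SmAt (fun x => g (F x)) p := SmAt.comp (by rwa [Fp]) Fa.smAt
  have hdef' := hρ'.mul hp' hg (by rw [hg1]; exact one_ne_zero)
  have hdef := hρ.mul hp hgF (by rw [Fp, hg1]; exact one_ne_zero)
  have hN0 : IsNormalised p (fun x => g (F x) * ρ x) (fun x => Φ' (F x)) (A.trans ℓ) J := by
    refine ⟨AnalyticAt.comp (by rw [Fp]; exact hN.analytic) Fa, by rw [Fp]; exact hN.map_zero, ?_,
      ?_⟩
    · have := HasFDerivAt.comp p (show HasFDerivAt Φ' (ℓ : Cn n →L[ℂ] ModelSpace q r) (F p) by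
        rw [Fp]; exact hN.hasFDerivAt) Fd
      exact this
    · have hF : Filter.Tendsto F (𝓝 p) (𝓝 p') := by
        simpa only [Fp] using Fa.continuousAt.tendsto
      have o0 := isBigO_sub_of_differentiableAt Fd.differentiableAt 4
      rw [Fp] at o0
      have o1 := (hN.close.comp_tendsto hF).trans o0
      have o2 : (fun x => g (F x) * (ρ' (F x) - ρ x)) =O[𝓝 p] fun x => 1 * ‖x - p‖ ^ 4 :=
        (hgF.continuousAt.tendsto.isBigO_one ℝ).mul O
      simp only [one_mul] at o2
      refine (o1.sub o2).congr_left fun x => ?_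
      simp only [Function.comp_apply]
      ring
  exact transport_of_isNormalised hN0 hdef hp hN hdef' hp'

end

/-! ### Equivalence of hypersurfaces with the same tensors -/

section

variable {n q r : ℕ} {M M' : Set (Cn n)} {p p' : Cn n} {ρ ρ' : Cn n → ℝ}

theorem real_mem_cT (hρ : IsDefiningFunction M p ρ) (hp : p ∈ M) (X : Cn n) :
    ((X, star X) : CVec n) ∈ cT M p ↔ fderiv ℝ ρ p X = 0 := by
  rw [mem_cT hρ hp, cd_rc_real hρ.smAt.differentiableAt, Complex.ofReal_eq_zero]

/-- If `A` maps the tangent spaces onto each other, it transforms the differentials of defining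
functions into each other up to a factor, as functionals with the same kernel are proportional. -/
theorem exists_fderiv_eq_smul (hρ : IsDefiningFunction M p ρ) (hp : p ∈ M)
    (hρ' : IsDefiningFunction M' p' ρ') (hp' : p' ∈ M') {A : Cn n ≃L[ℂ] Cn n}
    (hT : ∀ v, v ∈ cT M p ↔ push A v ∈ cT M' p') :
    ∃ c : ℝ, c ≠ 0 ∧ ∀ X, fderiv ℝ ρ' p' (A X) = c * fderiv ℝ ρ p X := by
  have hker (X : Cn n) : fderiv ℝ ρ p X = 0 ↔ fderiv ℝ ρ' p' (A X) = 0 := by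
    rw [← real_mem_cT hρ hp, hT, ← real_mem_cT hρ' hp']
    simp [push]
  obtain ⟨X0, h0⟩ := DFunLike.ne_iff.1 hρ.fderiv_ne_zero
  have h0 : fderiv ℝ ρ p X0 ≠ 0 := h0
  refine ⟨fderiv ℝ ρ' p' (A X0) / fderiv ℝ ρ p X0,
    div_ne_zero (fun h => h0 ((hker X0).2 h)) h0, fun X => ?_⟩
  have hX := (hker (X - (fderiv ℝ ρ p X / fderiv ℝ ρ p X0) • X0)).1 (by
    rw [map_sub, map_smul, smul_eq_mul, div_mul_cancel₀ _ h0, sub_self])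
  have hA : A ((fderiv ℝ ρ p X / fderiv ℝ ρ p X0) • X0) =
      (fderiv ℝ ρ p X / fderiv ℝ ρ p X0) • A X0 :=
    ((A : Cn n →L[ℂ] Cn n).restrictScalars ℝ).map_smul _ X0
  rw [map_sub, hA, map_sub, map_smul, smul_eq_mul, sub_eq_zero] at hX
  rw [hX]
  ring

theorem cd_rc_push (hρ : SmAt ρ p) (hρ' : SmAt ρ' p') {A : Cn n ≃L[ℂ] Cn n}
    (h : ∀ X, fderiv ℝ ρ' p' (A X) = fderiv ℝ ρ p X) (v : CVec n) :
    cd (rc ρ') p' (push A v) = cd (rc ρ) p v := by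
  rw [cd_rc hρ.differentiableAt, cd_rc hρ'.differentiableAt, cExtL_apply, cExtL_apply]
  have e (X : Cn n) : fderiv ℝ ρ' p' (Complex.I • A X) = fderiv ℝ ρ p (Complex.I • X) := by
    rw [← map_smul, h]
  simp [cExt, push, h, e]

/-- The local biholomorphism `Φ'⁻¹ ∘ Φ` between two holomorphic coordinate systems. -/
theorem exists_biholomorphism {Φ Φ' : Cn n → ModelSpace q r} {ℓ ℓ' : Cn n ≃L[ℂ] ModelSpace q r}
    (ha : AnalyticAt ℂ Φ p) (h0 : Φ p = 0)
    (hd : HasFDerivAt Φ (ℓ : Cn n →L[ℂ] ModelSpace q r) p) (ha' : AnalyticAt ℂ Φ' p')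
    (h0' : Φ' p' = 0) (hd' : HasFDerivAt Φ' (ℓ' : Cn n →L[ℂ] ModelSpace q r) p') :
    ∃ F : Cn n → Cn n, AnalyticAt ℂ F p ∧ F p = p' ∧
      HasFDerivAt F (ℓ.trans ℓ'.symm : Cn n →L[ℂ] Cn n) p ∧ ∀ᶠ x in 𝓝 p, Φ' (F x) = Φ x := by
  have hs : HasStrictFDerivAt Φ' (ℓ' : Cn n →L[ℂ] ModelSpace q r) p' := by
    have := ha'.hasStrictFDerivAt
    rwa [hd'.fderiv] at this
  set e := hs.toOpenPartialHomeomorph Φ' with he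
  have hsrc : p' ∈ e.source := hs.mem_toOpenPartialHomeomorph_source
  have hcoe : (e : Cn n → ModelSpace q r) = Φ' := rfl
  have hsymm : e.symm 0 = p' := by rw [← h0', ← hcoe]; exact e.left_inv hsrc
  have ha1 : AnalyticAt ℂ e.symm (Φ p) := by
    rw [h0, ← h0', ← hcoe]
    exact e.analyticAt_symm' hsrc ha' hd'.fderiv
  have htgt : (0 : ModelSpace q r) ∈ e.target := by
    rw [← h0', ← hcoe]; exact e.map_source hsrc
  have hd1 : HasFDerivAt e.symm (ℓ'.symm : ModelSpace q r →L[ℂ] Cn n) (Φ p) := by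
    rw [h0]
    exact e.hasFDerivAt_symm htgt (by rw [hsymm]; exact hd')
  refine ⟨fun x => e.symm (Φ x), AnalyticAt.comp ha1 ha, by
    beta_reduce
    rw [h0, hsymm], hd1.comp p hd, ?_⟩
  have : ∀ᶠ x in 𝓝 p, Φ x ∈ e.target := by
    refine hd.continuousAt.eventually_mem ?_
    rw [h0]
    exact e.open_target.mem_nhds htgt
  filter_upwards [this] with x hx
  exact e.right_inv hx

/-- The Hermitian forms of two normalised models correspond if the tensors `τ³` do. -/
theorem herm_eq_of_tau3 {q' r' : ℕ} {A : Cn n ≃L[ℂ] Cn n} {ℓ : Cn n ≃L[ℂ] ModelSpace q r}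
    {ℓ' : Cn n ≃L[ℂ] ModelSpace q' r'} {Φ : Cn n → ModelSpace q r} {Φ' : Cn n → ModelSpace q' r'}
    {J : ModelData q r} {J' : ModelData q' r'}
    (h : IsNormalised p ρ Φ ℓ J) (hρ : IsDefiningFunction M p ρ) (hp : p ∈ M)
    (h' : IsNormalised p' ρ' Φ' ℓ' J') (hρ' : IsDefiningFunction M' p' ρ')
    (hp' : p' ∈ M') (hw : ∀ X, (ℓ' (A X)).1 = (ℓ X).1)
    (h3 : ∀ v3 v2 v1 u, Tau3Graph M p v3 v2 v1 u ↔
      Tau3Graph M' p' (push A v3) (push A v2) (push A v1) (push A u))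
    {X Y : Cn n} {z : Fin r → ℂ} {z' : Fin r' → ℂ} (hX : ℓ X = (Complex.I, 0, 0))
    (hX' : ℓ' (A X) = (Complex.I, 0, 0)) (hY : ℓ Y = (0, 0, z)) (hY' : ℓ' (A Y) = (0, 0, z')) :
    herm J.h z = herm J'.h z' := by
  have hm := h.hasModel hρ hp
  have hm' := h'.hasModel hρ' hp'
  have t2 := (third_derivative_model J ℓ).2
  have t2' := (third_derivative_model J' ℓ').2
  have hcd (u : CVec n) : cd (rc ρ') p' ((push A u).1, 0) = cd (rc ρ) p (u.1, 0) := by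
    rw [h'.cd_eq hρ'.smAt, h.cd_eq hρ.smAt]
    simp [push, hw]
  have pX (X : Cn n) : push A ((X, 0) : CVec n) = (A X, 0) := by simp [push]
  have pY (Y : Cn n) : push A ((0, star Y) : CVec n) = (0, star (A Y)) := by simp [push]
  have pR (Y : Cn n) : push A ((Y, star Y) : CVec n) = (A Y, star (A Y)) := by simp [push]
  obtain ⟨u, hu, hus⟩ := exists_mem_cT_of_normalised h hρ hp (-Complex.I * (2 * herm J.h z))
  have hg : Tau3Graph M p (X, star X) (Y, 0) (0, star Y) u := by
    rw [hm.tau3Graph_iff hρ hp, h.mem_cT hρ hp, h.mem_K10 hρ hp, h.mem_K01 hρ hp,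
      t2 X Y z hX hY, hus]
    refine ⟨by simp [hX], by simp [hY], by simp [hY], hu, ?_⟩
    linear_combination (-(2 * herm J.h z) : ℂ) * Complex.I_mul_I
  rw [h3, hm'.tau3Graph_iff hρ' hp', hcd, hus, pX, pY, pR, t2' (A X) (A Y) z' hX' hY'] at hg
  have hI := hg.2.2.2.2
  have : (herm J.h z : ℂ) = herm J'.h z' := by
    linear_combination (1 / 2 : ℂ) * hI + (herm J.h z : ℂ) * Complex.I_mul_I
  exact_mod_cast this

/-- Two normalised models with the same third order tensors agree. -/
theorem model_eq_of_tensors {A : Cn n ≃L[ℂ] Cn n} {ℓ : Cn n ≃L[ℂ] ModelSpace q r}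
    {Φ Φ' : Cn n → ModelSpace q r} {J J' : ModelData q r}
    (h : IsNormalised p ρ Φ ℓ J) (hρ : IsDefiningFunction M p ρ) (hp : p ∈ M)
    (h' : IsNormalised p' ρ' Φ' (A.symm.trans ℓ) J') (hρ' : IsDefiningFunction M' p' ρ')
    (hp' : p' ∈ M') (hsgn : J.sgn = J'.sgn)
    (h3 : ∀ v3 v2 v1 u, Tau3Graph M p v3 v2 v1 u ↔
      Tau3Graph M' p' (push A v3) (push A v2) (push A v1) (push A u))
    (h21 : ∀ v3 v2 v1 u, Tau21Graph M p v3 v2 v1 u ↔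
      Tau21Graph M' p' (push A v3) (push A v2) (push A v1) (push A u)) :
    J.model = J'.model := by
  have hm := h.hasModel hρ hp
  have hm' := h'.hasModel hρ' hp'
  have hl (X : Cn n) : (A.symm.trans ℓ) (A X) = ℓ X := by simp
  have hcd (u : CVec n) : cd (rc ρ') p' ((push A u).1, 0) = cd (rc ρ) p (u.1, 0) := by
    rw [h'.cd_eq hρ'.smAt, h.cd_eq hρ.smAt]
    simp [push]
  have pX (X : Cn n) : push A ((X, 0) : CVec n) = (A X, 0) := by simp [push]
  have pY (Y : Cn n) : push A ((0, star Y) : CVec n) = (0, star (A Y)) := by simp [push]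
  have t1 := (third_derivative_model J ℓ).1
  have t1' := (third_derivative_model J' (A.symm.trans ℓ)).1
  have hcub (z2 z3) : cub21 J.a J.b J.c z2 z3 = cub21 J'.a J'.b J'.c z2 z3 := by
    set X := ℓ.symm (0, z2, z3) with hX
    set Y := ℓ.symm (0, 0, z3) with hY
    have eX : ℓ X = (0, z2, z3) := by simp [hX]
    have eY : ℓ Y = (0, 0, z3) := by simp [hY]
    obtain ⟨u, hu, hus⟩ := exists_mem_cT_of_normalised h hρ hp (-(2 * cub21 J.a J.b J.c z2 z3))
    have hg : Tau21Graph M p (X, 0) (X, 0) (0, star Y) u := by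
      rw [hm.tau21Graph_iff hρ hp, h.mem_H10 hρ hp, h.mem_K01 hρ hp, t1 X Y z2 z3 eX eY, hus]
      simp [eX, eY, hu]
    rw [h21, hm'.tau21Graph_iff hρ' hp', hcd, hus, pX, pY,
      t1' (A X) (A Y) z2 z3 (by rw [hl, eX]) (by rw [hl, eY])] at hg
    have hI := hg.2.2.2.2
    have := mul_left_cancel₀ Complex.I_ne_zero
      (hI.trans (show _ = Complex.I * -(2 * cub21 J'.a J'.b J'.c z2 z3) by ring))
    linear_combination (-1 / 2 : ℂ) * this
  have hherm (z3) : herm J.h z3 = herm J'.h z3 :=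
    herm_eq_of_tau3 h hρ hp h' hρ' hp' (fun X => by rw [hl]) h3
      (X := ℓ.symm (Complex.I, 0, 0)) (Y := ℓ.symm (0, 0, z3)) (by simp) (by simp) (by simp)
      (by simp)
  funext y
  simp only [ModelData.model, ModelData.cubic, hsgn, hcub, hherm]

/-- Hypersurfaces with the same tensors are equivalent to third order: the equivalence is `Φ'⁻¹ ∘ Φ`
for normalising coordinates `Φ`, `Φ'` with linear parts `ℓ` and `ℓ ∘ A⁻¹`. -/
theorem equiv_of_tensors (hρ : IsDefiningFunction M p ρ) (hp : p ∈ M)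
    (hρ' : IsDefiningFunction M' p' ρ') (hp' : p' ∈ M') {A : Cn n ≃L[ℂ] Cn n}
    (hT : ∀ v, v ∈ cT M p ↔ push A v ∈ cT M' p')
    (hL : ∀ v2 v1 u, LeviGraph M p v2 v1 u ↔ LeviGraph M' p' (push A v2) (push A v1) (push A u))
    (h3 : ∀ v3 v2 v1 u, Tau3Graph M p v3 v2 v1 u ↔
      Tau3Graph M' p' (push A v3) (push A v2) (push A v1) (push A u))
    (h21 : ∀ v3 v2 v1 u, Tau21Graph M p v3 v2 v1 u ↔
      Tau21Graph M' p' (push A v3) (push A v2) (push A v1) (push A u)) :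
    ThirdOrderEquivVia M p M' p' A := by
  obtain ⟨c, hc, hcX⟩ := exists_fderiv_eq_smul hρ hp hρ' hp' hT
  obtain ⟨q, r, ℓ, sgn, -, hs, h1, h2⟩ := exists_adapted hρ
  obtain ⟨J, Φ, g, hJ, hg, hg1, hN⟩ := exists_isNormalised hρ.smAt (hρ.mem_iff.1 hp) ℓ hs h1 h2
  have hdef := hρ.mul hp hg (by rw [hg1]; exact one_ne_zero)
  -- rescale `ρ'` such that the differentials at the reference points correspond
  have hσ := hρ'.mul hp' (smAt_const c⁻¹) (inv_ne_zero hc)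
  set σ : Cn n → ℝ := fun x => c⁻¹ * ρ' x with hσe
  have hσX (X : Cn n) : fderiv ℝ σ p' (A X) = fderiv ℝ ρ p X := by
    have : fderiv ℝ σ p' = c⁻¹ • fderiv ℝ ρ' p' := fderiv_const_mul hρ'.smAt.differentiableAt c⁻¹
    rw [this, smul_apply, hcX, smul_eq_mul, inv_mul_cancel_left₀ hc]
  have hcd := cd_rc_push hρ.smAt hσ.smAt hσX
  have h1' (X : Cn n) : fderiv ℝ σ p' X = -2 * ((A.symm.trans ℓ) X).1.re := by
    have := hσX (A.symm X)
    rw [A.apply_symm_apply] at this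
    rw [this, h1]
    rfl
  -- the Levi form of `σ` is diagonal in the transported coordinates as `A` preserves the Levi form
  have h2' (X : Cn n) (hX : ((A.symm.trans ℓ) X).1 = 0) :
      cd (cd (rc σ)) p' (X, 0) (0, star X) = quad sgn ((A.symm.trans ℓ) X).2.1 := by
    set a := A.symm X with ha
    have haX : A a = X := A.apply_symm_apply X
    have hw : (ℓ a).1 = 0 := hX
    obtain ⟨u, hu, hus⟩ := exists_mem_cT_of_normalised hN hdef hp
      (Complex.I * cd (cd (rc ρ)) p (a, 0) (0, star a))
    have hus' : cd (rc ρ) p (u.1, 0) = Complex.I * cd (cd (rc ρ)) p (a, 0) (0, star a) := by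
      rw [← hus, hN.cd_eq hdef.smAt]
      have : cd (rc ρ) p (u.1, 0) = -((ℓ u.1).1) := by
        rw [cd_rc hρ.smAt.differentiableAt, cExtL_apply]
        simp only [cExt, LinearMap.coe_mk, AddHom.coe_mk, ContinuousLinearMap.comp_apply, h1,
          map_smul]
        apply Complex.ext <;> simp
      rw [this]
      simp
    have hgr : LeviGraph M p (a, 0) (0, star a) u := by
      rw [leviGraph_iff hρ hp, hN.mem_H10 hdef hp, mem_H01 hdef hp, hN.cd_eq hdef.smAt, hus']
      refine ⟨by simp [hw], by simp [hw], hu, ?_⟩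
      linear_combination (cd (cd (rc ρ)) p (a, 0) (0, star a)) * Complex.I_mul_I
    rw [hL, leviGraph_iff hσ hp'] at hgr
    have hgr := hgr.2.2.2
    have e1 : push A ((a, 0) : CVec n) = (X, 0) := by simp [push, haX]
    have e2 : push A ((0, star a) : CVec n) = (0, star X) := by simp [push, haX]
    have e3 : (((push A u).1, 0) : CVec n) = push A (u.1, 0) := by simp [push]
    rw [e1, e2, e3, hcd, hus', h2 a hw] at hgr
    change _ = ((quad sgn (ℓ a).2.1 : ℝ) : ℂ)
    linear_combination hgr - (quad sgn (ℓ a).2.1 : ℂ) * Complex.I_mul_I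
  obtain ⟨J', Φ', g', hJ', hg', hg1', hN'⟩ := exists_isNormalised hσ.smAt (hσ.mem_iff.1 hp')
    (A.symm.trans ℓ) hs h1' h2'
  have hdef' := hσ.mul hp' hg' (by rw [hg1']; exact one_ne_zero)
  have hmod := model_eq_of_tensors hN hdef hp hN' hdef' hp' (hJ.trans hJ'.symm) h3 h21
  obtain ⟨F, Fa, Fp, Fd, hF⟩ := exists_biholomorphism hN.analytic hN.map_zero hN.hasFDerivAt
    hN'.analytic hN'.map_zero hN'.hasFDerivAt
  have hFA : ((ℓ.trans (A.symm.trans ℓ).symm : Cn n ≃L[ℂ] Cn n) : Cn n →L[ℂ] Cn n) =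
      (A : Cn n →L[ℂ] Cn n) := by
    ext x
    simp
  rw [hFA] at Fd
  refine ⟨F, Fa, Fp, Fd, _, _, hdef, hdef', ?_⟩
  have o0 := isBigO_sub_of_differentiableAt Fd.differentiableAt 4
  rw [Fp] at o0
  have hFt : Filter.Tendsto F (𝓝 p) (𝓝 p') := by
    simpa only [Fp] using Fa.continuousAt.tendsto
  have o1 := (hN'.close.comp_tendsto hFt).trans o0
  refine (o1.sub hN.close).congr' ?_ Filter.EventuallyEq.rfl
  filter_upwards [hF] with x hx
  simp only [Function.comp_apply, hx, hmod]
  ring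

end

/-! ### The tensors of a cubic normal form -/

section

variable {n q r : ℕ} {M : Set (Cn n)} {p : Cn n} {ρ : Cn n → ℝ}

section NormalFormTensors

variable {Φ : Cn n → ModelSpace q r} {φ : (Fin q → ℂ) × (Fin r → ℂ) × ℝ → ℝ} {D : CubicData q r}

theorem CubicData.model_toModelData (D : CubicData q r) (y : ModelSpace q r) :
    D.toModelData.model y = -2 * y.1.re + (D.phi2 y.2.1 + D.phi3 y.2.1 y.2.2 (-2 * y.1.im)) := by
  rw [ModelData.model, CubicData.cubic_toModelData, add_assoc]
  rfl

/-- The real coordinates `(z, u)` of a point with complex coordinates `(w, z)`. -/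
def realCoord (q r : ℕ) : ModelSpace q r →L[ℝ] (Fin q → ℂ) × (Fin r → ℂ) × ℝ :=
  ((ContinuousLinearMap.fst ℝ _ _).comp (ContinuousLinearMap.snd ℝ ℂ _)).prod
    (((ContinuousLinearMap.snd ℝ _ _).comp (ContinuousLinearMap.snd ℝ ℂ _)).prod
      ((-2 : ℝ) • Complex.imCLM.comp (ContinuousLinearMap.fst ℝ ℂ _)))

theorem realCoord_apply (y : ModelSpace q r) : realCoord q r y = (y.2.1, y.2.2, -2 * y.1.im) := by
  simp [realCoord]

/-- The coordinates of a cubic normal form normalise the defining function `-2 Re w + φ`. -/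
theorem IsCubicNormalForm.exists_isNormalised (h : IsCubicNormalForm M p Φ φ D) :
    ∃ (ℓ : Cn n ≃L[ℂ] ModelSpace q r) (ρ : Cn n → ℝ),
      (ℓ : Cn n →L[ℂ] ModelSpace q r) = fderiv ℂ Φ p ∧
        IsDefiningFunction M p ρ ∧ IsNormalised p ρ Φ ℓ D.toModelData := by
  set ℓ : Cn n ≃L[ℂ] ModelSpace q r := (LinearEquiv.ofBijective
    (fderiv ℂ Φ p : Cn n →ₗ[ℂ] ModelSpace q r) h.bijective).toContinuousLinearEquiv with hℓ
  have hℓΦ : (ℓ : Cn n →L[ℂ] ModelSpace q r) = fderiv ℂ Φ p := by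
    ext1 x
    rfl
  set ρ : Cn n → ℝ := fun x => -2 * (Φ x).1.re + φ (realCoord q r (Φ x)) with hρ
  have hΦ0 : realCoord q r (Φ p) = 0 := by rw [h.map_zero, _root_.map_zero]
  have hφ : SmAt φ 0 := by
    obtain ⟨U, hU, h0, hs⟩ := h.smooth
    exact smAt_of_contDiffOn hU h0 hs
  have hΦs : SmAt Φ p := h.analytic.smAt
  have hr : SmAt (fun x => realCoord q r (Φ x)) p := hΦs.clm _
  have hρs : SmAt ρ p := by
    have h1 : SmAt (fun x => -2 * (Φ x).1.re) p :=
      hΦs.clm ((-2 : ℝ) • Complex.reCLM.comp (ContinuousLinearMap.fst ℝ ℂ _))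
    exact h1.add (SmAt.comp (by rwa [hΦ0]) hr)
  have hN : IsNormalised p ρ Φ ℓ D.toModelData := by
    refine ⟨h.analytic, h.map_zero, hℓΦ ▸ h.analytic.differentiableAt.hasFDerivAt, ?_⟩
    have ht : Filter.Tendsto (fun x => realCoord q r (Φ x)) (𝓝 p) (𝓝 0) := by
      simpa only [hΦ0] using hr.continuousAt.tendsto
    have o0 := isBigO_sub_of_differentiableAt h.analytic.differentiableAt 4
    have o1 : (fun x => ‖realCoord q r (Φ x)‖ ^ 4) =O[𝓝 p] fun x => ‖Φ x - Φ p‖ ^ 4 := by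
      have := (((realCoord q r).isBigO_id (⊤ : Filter (ModelSpace q r))).norm_norm.pow 4).comp_tendsto
        (k := Φ) (l' := 𝓝 p) Filter.tendsto_top
      simpa [h.map_zero, Function.comp_def] using this
    refine ((h.expansion.comp_tendsto ht).trans (o1.trans o0)).congr_left fun x => ?_
    simp only [Function.comp_apply, CubicData.model_toModelData, hρ, realCoord_apply]
    ring
  refine ⟨ℓ, ρ, hℓΦ, isDefiningFunction_of_eventually hρs (fun h0 => ?_) ?_, hN⟩
  · -- the differential is the one of `-2 Re w`
    have h1 := cd_rc_real hρs.differentiableAt (ℓ.symm (1, 0, 0))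
    rw [hN.cd_eq hρs, h0] at h1
    norm_num at h1
  · filter_upwards [h.graph] with x hx
    rw [hx, hρ]
    simp only [realCoord_apply]
    constructor <;> intro h' <;> linarith

/-- The linear and quadratic parts of the model polynomial do not contribute to the third
derivative. -/
theorem thirdDer_cubicTerm {ℓ : Cn n ≃L[ℂ] ModelSpace q r}
    (hℓ : (ℓ : Cn n →L[ℂ] ModelSpace q r) = fderiv ℂ Φ p) (v3 v2 v1 : CVec n) :
    thirdDer (cubicTerm p Φ D) v3 v2 v1 =
      cd (cd (cd (rc fun x => D.toModelData.model (ℓ x)))) 0 v3 v2 v1 := by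
  obtain ⟨d3, hd, hd', -⟩ := exists_hasJet_model (ℓ : Cn n →L[ℂ] ModelSpace q r) D.toModelData
  have e : cubicTerm p Φ D = fun x =>
      ((D.toModelData.cubic ((ℓ : Cn n →L[ℂ] ModelSpace q r) x).2.1
        ((ℓ : Cn n →L[ℂ] ModelSpace q r) x).2.2
        (-2 * ((ℓ : Cn n →L[ℂ] ModelSpace q r) x).1.im) : ℝ) : ℂ) := by
    funext x
    rw [CubicData.cubic_toModelData, hℓ]
    rfl
  have hs (x : Cn n) : SmAt (cubicTerm p Φ D) x := by rw [e]; exact hd'.smooth.smAt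
  have e2 : der (fun _ => v2) (der (fun _ => v1) (cubicTerm p Φ D)) =
      fun x => cd (cd (cubicTerm p Φ D)) x v2 v1 :=
    funext fun x => cd_clm_apply_const (hs x).cd.differentiableAt _ _
  have e3 : thirdDer (cubicTerm p Φ D) v3 v2 v1 = cd (cd (cd (cubicTerm p Φ D))) 0 v3 v2 v1 := by
    rw [thirdDer, e2, (hs 0).cd_cd_cd_apply_const]
    rfl
  rw [e3, e]
  exact (hd'.third _ _ _).trans (hd.third _ _ _).symm

/-- The cubic terms of a normal form are given by the tensors, because its polynomial part is a
model of the defining function `-2 Re w + φ`. -/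
theorem IsCubicNormalForm.cubic_eq (h : IsCubicNormalForm M p Φ φ D) (hp : p ∈ M)
    (v3 v2 v1 u : CVec n) :
    (Tau3Graph M p v3 v2 v1 u →
        normalContact p Φ u = -thirdDer (cubicTerm p Φ D) v3 v2 v1) ∧
      (Tau21Graph M p v3 v2 v1 u →
        normalContact p Φ u = -Complex.I * thirdDer (cubicTerm p Φ D) v3 v2 v1) := by
  obtain ⟨ℓ, ρ, hℓ, hρ, hN⟩ := h.exists_isNormalised
  have hm := hN.hasModel hρ hp
  have hc : normalContact p Φ u = Complex.I * cd (rc ρ) p (u.1, 0) := by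
    rw [hN.cd_eq hρ.smAt, normalContact, ← hℓ]
    simp
  rw [hm.tau3Graph_iff hρ hp, hm.tau21Graph_iff hρ hp, thirdDer_cubicTerm hℓ, hc]
  exact ⟨fun hu => hu.2.2.2.2, fun hu => hu.2.2.2.2⟩

end NormalFormTensors

end

/-! ### Existence of the cubic normal form -/

section

variable {n q r : ℕ} {M : Set (Cn n)} {p : Cn n} {ρ : Cn n → ℝ}

/-- The inverse function theorem for functions that are smooth near a point. -/
theorem SmAt.exists_inverse {E F : Type*} [NormedAddCommGroup E] [NormedSpace ℝ E] [CompleteSpace E]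
    [NormedAddCommGroup F] [NormedSpace ℝ F] {f : E → F} {a : E} (hf : SmAt f a) (G : E ≃L[ℝ] F)
    (hG : HasFDerivAt f (G : E →L[ℝ] F) a) :
    ∃ g : F → E, SmAt g (f a) ∧ g (f a) = a ∧ (∀ᶠ x in 𝓝 a, g (f x) = x) ∧
      ∀ᶠ y in 𝓝 (f a), f (g y) = y := by
  have hs : HasStrictFDerivAt f (G : E →L[ℝ] F) a := by
    have := hf.contDiffAt.hasStrictFDerivAt (by simp)
    rwa [hG.fderiv] at this
  set e := hs.toOpenPartialHomeomorph f with he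
  have hsrc : a ∈ e.source := hs.mem_toOpenPartialHomeomorph_source
  have hcoe : (e : E → F) = f := rfl
  have htgt : f a ∈ e.target := e.map_source hsrc
  have hsymm : e.symm (f a) = a := e.left_inv hsrc
  refine ⟨e.symm, ?_, hsymm, ?_, ?_⟩
  · have h1 : ∀ᶠ x in 𝓝 a, ∃ G' : E ≃L[ℝ] F, (G' : E →L[ℝ] F) = fderiv ℝ f x := by
      refine hf.fderiv.continuousAt.eventually
        (p := fun T => ∃ G' : E ≃L[ℝ] F, (G' : E →L[ℝ] F) = T) ?_
      rw [hG.fderiv]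
      exact ContinuousLinearEquiv.nhds G
    have h2 : Filter.Tendsto e.symm (𝓝 (f a)) (𝓝 a) := by
      have := (e.continuousAt_symm htgt).tendsto
      rwa [hsymm] at this
    filter_upwards [h2.eventually (h1.and hf), e.open_target.mem_nhds htgt] with y hy hyt
    obtain ⟨⟨G', hG'⟩, hfy⟩ := hy
    refine e.contDiffAt_symm hyt (f₀' := G') ?_ hfy
    rw [hG']
    exact (hfy.differentiableAt (by simp)).hasFDerivAt
  · filter_upwards [e.open_source.mem_nhds hsrc] with x hx using e.left_inv hx
  · filter_upwards [e.open_target.mem_nhds htgt] with y hy using e.right_inv hy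

/-- If the model of a normalised defining function `ρ` is given by normal form data, then `ρ = 0` is
solved for `Re w` by the inverse function theorem for `x ↦ (z, u, ρ)`, and the solution has the
expansion required of a normal form. -/
theorem IsNormalised.exists_isCubicNormalForm {Φ : Cn n → ModelSpace q r}
    {ℓ : Cn n ≃L[ℂ] ModelSpace q r} {J : ModelData q r} (h : IsNormalised p ρ Φ ℓ J)
    (hρ : IsDefiningFunction M p ρ) (hp : p ∈ M) (D : CubicData q r)
    (hD : J.model = D.toModelData.model) :
    ∃ φ, IsCubicNormalForm M p Φ φ D := by
  have hρ0 : ρ p = 0 := hρ.mem_iff.1 hp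
  have hΦs : SmAt Φ p := h.analytic.smAt
  have hρd (X : Cn n) : fderiv ℝ ρ p X = -2 * (ℓ X).1.re := by
    have h1 := cd_rc_real hρ.smAt.differentiableAt X
    rw [h.cd_eq hρ.smAt, star_star, Complex.star_def, Complex.add_conj] at h1
    have h2 : ((fderiv ℝ ρ p X : ℝ) : ℂ) = ((-2 * (ℓ X).1.re : ℝ) : ℂ) := by
      rw [← h1]; push_cast; ring
    exact_mod_cast h2
  set Γ : Cn n → ((Fin q → ℂ) × (Fin r → ℂ) × ℝ) × ℝ :=
    fun x => (realCoord q r (Φ x), ρ x) with hΓ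
  have hΓs : SmAt Γ p := (hΦs.clm _).prodMk hρ.smAt
  have hΓ0 : Γ p = 0 := by simp [hΓ, h.map_zero, hρ0]
  set G0 : Cn n →L[ℝ] ((Fin q → ℂ) × (Fin r → ℂ) × ℝ) × ℝ :=
    ((realCoord q r).comp ((ℓ : Cn n →L[ℂ] ModelSpace q r).restrictScalars ℝ)).prod (fderiv ℝ ρ p)
    with hG0
  have hG0X (X : Cn n) : G0 X = (((ℓ X).2.1, (ℓ X).2.2, -2 * (ℓ X).1.im), -2 * (ℓ X).1.re) :=
    Prod.ext (realCoord_apply _) (hρd X)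
  have hbij : Function.Bijective G0 := by
    constructor
    · refine (injective_iff_map_eq_zero G0).2 fun X hX => ?_
      rw [hG0X] at hX
      simp only [Prod.mk_eq_zero, mul_eq_zero, neg_eq_zero, OfNat.ofNat_ne_zero, false_or] at hX
      obtain ⟨⟨h1, h2, h3⟩, h4⟩ := hX
      have : ℓ X = 0 := Prod.ext (Complex.ext h4 h3) (Prod.ext h1 h2)
      simpa using this
    · rintro ⟨⟨a, b, u⟩, t⟩
      refine ⟨ℓ.symm (⟨-t / 2, -u / 2⟩, a, b), ?_⟩
      rw [hG0X]
      simp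
      constructor <;> ring
  have hGΓ : HasFDerivAt Γ G0 p := by
    have h1 : HasFDerivAt Φ ((ℓ : Cn n →L[ℂ] ModelSpace q r).restrictScalars ℝ) p :=
      h.hasFDerivAt.restrictScalars ℝ
    exact ((realCoord q r).hasFDerivAt.comp p h1).prodMk hρ.smAt.differentiableAt.hasFDerivAt
  obtain ⟨g, gs, gp, gl, gr⟩ := hΓs.exists_inverse
    (LinearEquiv.ofBijective (G0 : Cn n →ₗ[ℝ] _) hbij).toContinuousLinearEquiv
    (hGΓ.congr_fderiv (by ext1 x; rfl))
  rw [hΓ0] at gs gp gr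
  -- the hypersurface is parametrised by its real coordinates
  set Y : (Fin q → ℂ) × (Fin r → ℂ) × ℝ → Cn n := fun η => g (η, 0) with hY
  have hi : SmAt (fun η : (Fin q → ℂ) × (Fin r → ℂ) × ℝ => (η, (0 : ℝ))) 0 :=
    (contDiff_id.prodMk contDiff_const).smAt
  have hYs : SmAt Y 0 := SmAt.comp gs hi
  have hY0 : Y 0 = p := gp
  have hYr : ∀ᶠ η in 𝓝 0, realCoord q r (Φ (Y η)) = η ∧ ρ (Y η) = 0 := by
    have h1 : Filter.Tendsto (fun η : (Fin q → ℂ) × (Fin r → ℂ) × ℝ => (η, (0 : ℝ))) (𝓝 0) (𝓝 0) :=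
      hi.continuousAt.tendsto
    filter_upwards [h1.eventually gr] with η hη
    exact ⟨congrArg Prod.fst hη, congrArg Prod.snd hη⟩
  have hYt : Filter.Tendsto Y (𝓝 0) (𝓝 p) := by
    have := hYs.continuousAt.tendsto
    rwa [hY0] at this
  have hφs : SmAt (fun η => 2 * (Φ (Y η)).1.re) 0 := by
    have h1 : SmAt (fun η => Φ (Y η)) 0 := SmAt.comp (by rwa [hY0]) hYs
    have h2 := h1.clm ((2 : ℝ) • Complex.reCLM.comp (ContinuousLinearMap.fst ℝ ℂ _))
    exact h2
  refine ⟨fun η => 2 * (Φ (Y η)).1.re, h.analytic, ?_, h.map_zero, ?_, ?_, ?_⟩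
  · rw [h.hasFDerivAt.fderiv]
    exact ℓ.bijective
  · obtain ⟨U, hU, h0, hs, -⟩ := hφs.exists_contDiffOn (P := fun _ => True) (by simp)
    exact ⟨U, hU, h0, hs⟩
  · have hκ : Filter.Tendsto (fun x => realCoord q r (Φ x)) (𝓝 p) (𝓝 0) := by
      have := (hΦs.clm (realCoord q r)).continuousAt.tendsto
      rwa [h.map_zero, _root_.map_zero] at this
    -- only a left inverse `k` of `Φ` near `p` is needed
    obtain ⟨k, -, -, kl, -⟩ := hΦs.exists_inverse (LinearEquiv.toContinuousLinearEquiv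
      (ℓ.toLinearEquiv.restrictScalars ℝ)) ((h.hasFDerivAt.restrictScalars ℝ).congr_fderiv
        (by ext1 x; rfl))
    filter_upwards [hρ.eventually_mem_iff, gl, kl, hκ.eventually hYr,
      (hYt.comp hκ).eventually kl] with x h1 h2 h3 h4 h5
    rw [← realCoord_apply]
    simp only [Function.comp_apply] at h5
    constructor
    · intro hx
      have : Y (realCoord q r (Φ x)) = x := by
        rw [h1] at hx
        have e0 : Γ x = (realCoord q r (Φ x), 0) := by
          rw [hΓ]
          simp only [hx]
        rw [e0] at h2
        exact h2
      rw [this]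
    · intro hx
      have e : Φ (Y (realCoord q r (Φ x))) = Φ x := by
        have h6 := h4.1
        rw [realCoord_apply (Φ (Y _)), realCoord_apply (Φ x), Prod.mk.injEq, Prod.mk.injEq] at h6
        obtain ⟨a1, a2, a3⟩ := h6
        refine Prod.ext (Complex.ext ?_ ?_) (Prod.ext ?_ ?_)
        · rw [realCoord_apply] at hx ⊢; linarith
        · rw [realCoord_apply]; linarith
        · rw [realCoord_apply]; exact a1
        · rw [realCoord_apply]; exact a2
      have : Y (realCoord q r (Φ x)) = x := by rw [← h5, e, h3]
      rw [h1, ← this]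
      exact h4.2
  · have o1 := h.close.comp_tendsto hYt
    have o2 : (fun η => ‖Y η - p‖ ^ 4) =O[𝓝 0] fun η => ‖η‖ ^ 4 := by
      have := (hYs.differentiableAt.hasFDerivAt.isBigO_sub.norm_norm).pow 4
      simpa [hY0] using this
    refine (o1.trans o2).congr' ?_ Filter.EventuallyEq.rfl
    filter_upwards [hYr] with η hη
    obtain ⟨a1, a2⟩ := hη
    rw [realCoord_apply] at a1
    simp only [Function.comp_apply, a2, hD, CubicData.model_toModelData]
    have b1 : (Φ (Y η)).2.1 = η.1 := congrArg Prod.fst a1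
    have b2 : (Φ (Y η)).2.2 = η.2.1 := congrArg (fun y => y.2.1) a1
    have b3 : -2 * (Φ (Y η)).1.im = η.2.2 := congrArg (fun y => y.2.2) a1
    rw [b1, b2, b3]
    ring

/-- Every real hypersurface has a cubic normal form. A first normalisation gives the Hermitian form
that multiplies `u`; it is intrinsic, being a value of `τ³`, so in the second normalisation, with
linear coordinates `z₃` in which it is diagonal, it appears in diagonal form. -/
theorem exists_isCubicNormalForm (hρ : IsDefiningFunction M p ρ) (hp : p ∈ M) :
    ∃ (q r : ℕ) (Φ : Cn n → ℂ × (Fin q → ℂ) × (Fin r → ℂ))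
      (φ : (Fin q → ℂ) × (Fin r → ℂ) × ℝ → ℝ) (D : CubicData q r),
      n = q + r + 1 ∧ leviRank M p = q ∧ IsCubicNormalForm M p Φ φ D := by
  obtain ⟨q, r, ℓ, sgn, hn, hs, h1, h2⟩ := exists_adapted hρ
  obtain ⟨J, Φ, g, hJ, hg, hg1, hN⟩ := exists_isNormalised hρ.smAt (hρ.mem_iff.1 hp) ℓ hs h1 h2
  have hdef := hρ.mul hp hg (by rw [hg1]; exact one_ne_zero)
  -- diagonalise the Hermitian form in `z₃`
  obtain ⟨S, ε, hε, hS⟩ := exists_diagonal J.h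
  set ℓ' : Cn n ≃L[ℂ] ModelSpace q r := ℓ.trans ((ContinuousLinearEquiv.refl ℂ ℂ).prodCongr
    ((ContinuousLinearEquiv.refl ℂ (Fin q → ℂ)).prodCongr S.toContinuousLinearEquiv)) with hℓ'
  have hℓX (X : Cn n) : ℓ' X = ((ℓ X).1, (ℓ X).2.1, S (ℓ X).2.2) := rfl
  obtain ⟨J', Φ', g', hJ', hg', hg1', hN'⟩ :=
    exists_isNormalised hρ.smAt (hρ.mem_iff.1 hp) ℓ' hs h1 h2
  have hdef' := hρ.mul hp hg' (by rw [hg1']; exact one_ne_zero)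
  have hrefl (v : CVec n) : push (ContinuousLinearEquiv.refl ℂ (Cn n) : Cn n →L[ℂ] Cn n) v = v := by
    simp [push]
  have hherm (z : Fin r → ℂ) : herm J'.h z = ∑ j, ε j * ‖z j‖ ^ 2 := by
    have e1 := herm_eq_of_tau3 (A := ContinuousLinearEquiv.refl ℂ (Cn n)) hN hdef hp hN' hdef' hp
      (fun X => rfl) (fun v3 v2 v1 u => by simp only [hrefl]) (X := ℓ.symm (Complex.I, 0, 0))
      (Y := ℓ.symm (0, 0, S.symm z)) (z := S.symm z) (z' := z) (by simp) (by simp [hℓX]) (by simp)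
      (by simp [hℓX])
    rw [← e1, hS]
    simp
  set D : CubicData q r := ⟨J'.sgn, J'.sgn_mem, J'.a, J'.b, J'.c, ε, hε⟩ with hD
  have hmod : J'.model = D.toModelData.model := by
    funext y
    rw [CubicData.model_toModelData, ModelData.model, ModelData.cubic, add_assoc]
    simp only [CubicData.phi2, CubicData.phi3, CubicData.phi111, CubicData.phi21, quad, cub21, hherm,
      Finset.sum_mul, hD]
  obtain ⟨φ, hφ⟩ := hN'.exists_isCubicNormalForm hdef' hp D hmod
  exact ⟨q, r, Φ', φ, D, hn, hN.leviRank_eq hdef hp, hφ⟩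

end

end CRCubic

end

open CRCubic

theorem proposition3p6 {n : ℕ} (M : Set (Cn n)) (hM : IsRealHypersurface M) (p : Cn n)
    (hp : p ∈ M) :
    -- the tensors are well defined
    ((∃! τ, IsLeviForm M p τ) ∧ (∃! τ, IsTau3 M p τ) ∧ (∃! τ, IsTau21 M p τ) ∧
      (∃! τ, IsTau21Ext M p τ)) ∧
    -- the normal form
    (∀ q : ℕ, leviRank M p = q → q + 1 ≤ n ∧
      ∃ (Φ : Cn n → ℂ × (Fin q → ℂ) × (Fin (n - q - 1) → ℂ))
        (φ : (Fin q → ℂ) × (Fin (n - q - 1) → ℂ) × ℝ → ℝ) (D : CubicData q (n - q - 1)),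
        IsCubicNormalForm M p Φ φ D) ∧
    -- the two cubic tensors agree up to the constant `i` on their common domain
    (∀ v3 v2 v1 u : CVec n, Tau3Graph M p v3 v2 v1 u →
      (v3 ∈ cH M p → Tau21ExtGraph M p v3 v2 v1 (Complex.I • u)) ∧
      (v3 ∈ H10 M p → Tau21Graph M p v3 v2 v1 (Complex.I • u))) ∧
    -- in every normal form the cubic term is given by the two tensors
    (∀ (q r : ℕ) (Φ : Cn n → ℂ × (Fin q → ℂ) × (Fin r → ℂ))
      (φ : (Fin q → ℂ) × (Fin r → ℂ) × ℝ → ℝ) (D : CubicData q r),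
      IsCubicNormalForm M p Φ φ D → ∀ v3 v2 v1 u : CVec n,
      (Tau3Graph M p v3 v2 v1 u →
        normalContact p Φ u = -thirdDer (cubicTerm p Φ D) v3 v2 v1) ∧
      (Tau21Graph M p v3 v2 v1 u →
        normalContact p Φ u = -Complex.I * thirdDer (cubicTerm p Φ D) v3 v2 v1)) ∧
    -- together with the Levi form they are a complete set of third order invariants
    (∀ (M' : Set (Cn n)), IsRealHypersurface M' → ∀ p' ∈ M', ∀ A : Cn n ≃L[ℂ] Cn n,
      (ThirdOrderEquivVia M p M' p' A ↔
        (∀ v, v ∈ cT M p ↔ push A v ∈ cT M' p') ∧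
        (∀ v2 v1 u, LeviGraph M p v2 v1 u ↔ LeviGraph M' p' (push A v2) (push A v1) (push A u)) ∧
        (∀ v3 v2 v1 u, Tau3Graph M p v3 v2 v1 u ↔
          Tau3Graph M' p' (push A v3) (push A v2) (push A v1) (push A u)) ∧
        (∀ v3 v2 v1 u, Tau21Graph M p v3 v2 v1 u ↔
          Tau21Graph M' p' (push A v3) (push A v2) (push A v1) (push A u))) ∧
      (ThirdOrderEquivVia M p M' p' A → ∀ v3 v2 v1 u, Tau21ExtGraph M p v3 v2 v1 u ↔
        Tau21ExtGraph M' p' (push A v3) (push A v2) (push A v1) (push A u))) := by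
  obtain ⟨ρ, hρ⟩ := hM p hp
  obtain ⟨q, r, ℓ, sgn, -, hs, h1, h2⟩ := exists_adapted hρ
  obtain ⟨J, Φ, g, -, hg, hg1, hN⟩ := exists_isNormalised hρ.smAt (hρ.mem_iff.1 hp) ℓ hs h1 h2
  have hdef := hρ.mul hp hg (by rw [hg1]; exact one_ne_zero)
  have hm := hN.hasModel hdef hp
  refine ⟨⟨existsUnique_isLeviForm hρ hp, hm.existsUnique_isTau3 hdef hp,
    hm.existsUnique_isTau21 hdef hp, hm.existsUnique_isTau21Ext hdef hp⟩, ?_,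
    fun v3 v2 v1 u ht => hm.agreement hdef hp ht,
    fun q r Φ φ D h v3 v2 v1 u => h.cubic_eq hp v3 v2 v1 u, fun M' hM' p' hp' A => ?_⟩
  · obtain ⟨q', r', Φ', φ', D', hn, hq, hφ⟩ := exists_isCubicNormalForm hρ hp
    rintro q rfl
    rw [hq]
    obtain rfl : r' = n - q' - 1 := by omega
    exact ⟨by omega, Φ', φ', D', hφ⟩
  · obtain ⟨ρ', hρ'⟩ := hM' p' hp'
    refine ⟨⟨fun h => ?_, fun ⟨hT, hL, h3, h21⟩ => equiv_of_tensors hρ hp hρ' hp' hT hL h3 h21⟩,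
      fun h => (transport_of_equiv hp hp' h).2.2.2.2⟩
    obtain ⟨hT, hL, h3, h21, -⟩ := transport_of_equiv hp hp' h
    exact ⟨hT, hL, h3, h21⟩
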